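/- Let $k$ be a field. For a simplicial scheme $X_\bullet$ with face maps $\delta^i_\ell\colon X_i\to X_{i-1}$, let $\operatorname{Pic}(X_\bullet)$ be the group (under tensor product) of isomorphism classes of pairs $(L,\alpha)$, where $L$ is a line bundle on $X_0$ and $\alpha\colon(\delta^1_0)^*L\to(\delta^1_1)^*L$ is an isomorphism on $X_1$ satisfying the cocycle condition $(\delta^2_2)^*(\alpha)\circ(\delta^2_0)^*(\alpha)=(\delta^2_1)^*(\alpha)$ on $X_2$; an isomorphism $(L,\alpha)\to(M,\beta)$ is an isomorphism $\varphi\colon L\to M$ with $(\delta^1_1)^*(\varphi)\circ\alpha=\beta\circ(\delta^1_0)^*(\varphi)$. A morphism $j\colon U_\bullet\to X_\bullet$ of simplicial schemes induces by pull-back a homomorphism $j^*\colon\operatorname{Pic}(X_\bullet)\to\operatorname{Pic}(U_\bullet)$. Let $j\colon U_\bullet\to X_\bullet$ be a morphism of simplicial $k$-schemes such that 1. for every $p\ge 0$, $X_p$ is proper over $k$ and regular (all its local rings are regular local rings); 2. for every $p\ge 0$, $j_p\colon U_p\to X_p$ is an open immersion with dense image; 3. for every $p\ge 0$, every face map $X_{p+1}\to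 X_p$ maps $X_{p+1}\setminus U_{p+1}$ into $X_p\setminus U_p$. Then the cokernel of $j^*\colon\operatorname{Pic}(X_\bullet)\to\operatorname{Pic}(U_\bullet)$ is a finitely generated abelian group. -/

import Mathlib

open CategoryTheory AlgebraicGeometry TopologicalSpace Opposite Simplicial
universe u

namespace SimplicialPic
noncomputable section
variable {X : Scheme.{u}}

/-- Restriction of sections of a sheaf of modules. -/
def res {M : X.Modules} {U V : X.Opens} (h : V ≤ U) (s : Γ(M, U)) : Γ(M, V) :=
  M.presheaf.map (homOfLE h).op s

/-- Restriction of functions. -/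
def resR {U V : X.Opens} (h : V ≤ U) (r : Γ(X, U)) : Γ(X, V) :=
  X.presheaf.map (homOfLE h).op r

section
variable {M N : X.Modules} {U V W : X.Opens}
lemma res_add (h : V ≤ U) (s t : Γ(M, U)) : res h (s + t) = res h s + res h t := by
  simp [res]
lemma res_zero (h : V ≤ U)  : res h (0 : Γ(M, U)) = 0 := by
  simp [res]
lemma res_sub (h : V ≤ U) (s t : Γ(M, U)) : res h (s - t) = res h s - res h t := by
  simp [res]
lemma res_smul (h : V ≤ U) (r : Γ(X, U)) (s : Γ(M, U)) : res h (r • s) = resR h r • res h s := by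
  simp [res, resR]
lemma res_res (h : V ≤ U) (h' : W ≤ V) (s : Γ(M, U)) :
    res h' (res h s) = res (h'.trans h) s := by
  simp only [res, ← ConcreteCategory.comp_apply, ← Functor.map_comp]
  rfl
lemma res_self (h : U ≤ U) (s : Γ(M, U)) : res h s = s := by
  simp [res]
lemma app_res (φ : M ⟶ N) (h : V ≤ U) (s : Γ(M, U)) :
    φ.app V (res h s) = res h (φ.app U s) := by
  simp only [res, ← ConcreteCategory.comp_apply]
  exact congr($(φ.mapPresheaf.naturality (homOfLE h).op).hom s)
lemma resR_res (h : V ≤ U) (h' : W ≤ V) (s : Γ(X, U)) :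
    resR h' (resR h s) = resR (h'.trans h) s := by
  simp only [resR, ← ConcreteCategory.comp_apply, ← Functor.map_comp]
  rfl
lemma resR_self (h : U ≤ U) (s : Γ(X, U)) : resR h s = s := by
  simp [resR]

lemma res_ext (s t : Γ(M, U)) (H : ∀ x ∈ U, ∃ (V : X.Opens) (h : V ≤ U), x ∈ V ∧
    res h s = res h t) : s = t := by
  choose V h hx e using H
  refine TopCat.Sheaf.eq_of_locally_eq' ⟨M.presheaf, M.isSheaf⟩ (fun x : U => V x.1 x.2) U
    (fun x => homOfLE (h x.1 x.2)) ?_ s t ?_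
  · intro x hxU
    exact Opens.mem_iSup.2 ⟨⟨x, hxU⟩, hx x hxU⟩
  · intro x
    exact e x.1 x.2

lemma res_glue (P : ∀ V : X.Opens, Γ(M, V) → Prop)
    (hres : ∀ V W (h : W ≤ V) a, P V a → P W (res h a))
    (huniq : ∀ V a b, P V a → P V b → a = b)
    (hex : ∀ x ∈ U, ∃ V : X.Opens, V ≤ U ∧ x ∈ V ∧ ∃ a, P V a) :
    ∃ s : Γ(M, U), ∀ V (h : V ≤ U) a, P V a → res h s = a := by
  choose V h hx a ha using hex
  obtain ⟨s, hs, -⟩ := TopCat.Sheaf.existsUnique_gluing' ⟨M.presheaf, M.isSheaf⟩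
    (fun x : U => V x.1 x.2) U (fun x => homOfLE (h x.1 x.2))
    (by intro x hxU; exact Opens.mem_iSup.2 ⟨⟨x, hxU⟩, hx x hxU⟩)
    (fun x => a x.1 x.2) (by
      intro x y
      exact huniq _ _ _ (hres _ _ inf_le_left _ (ha _ _)) (hres _ _ inf_le_right _ (ha _ _)))
  refine ⟨s, fun W hW b hb => res_ext _ _ fun x hxW => ?_⟩
  refine ⟨V x (hW hxW) ⊓ W, inf_le_right, ⟨hx _ _, hxW⟩, ?_⟩
  have e : res (h x (hW hxW)) s = a x (hW hxW) := hs ⟨x, hW hxW⟩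
  rw [res_res, ← res_res (h x (hW hxW)) inf_le_left, e]
  exact huniq _ _ _ (hres _ _ _ _ (ha _ _)) (hres _ _ _ _ hb)
end

/-- `s` freely generates `M` over `U`: multiplication by `s` is an isomorphism from the structure
sheaf of `U` to the restriction of `M` to `U`. -/
def IsGen {M : X.Modules} {U : X.Opens} (s : Γ(M, U)) : Prop :=
  ∀ (V : X.Opens) (h : V ≤ U), Function.Bijective (fun r : Γ(X, V) => r • res h s)

/-- A line bundle: an `𝒪_X`-module which is locally free of rank one. -/
def IsLineBundle (M : X.Modules) : Prop :=
  ∀ x : X, ∃ (U : X.Opens) (s : Γ(M, U)), x ∈ U ∧ IsGen s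

section
variable {L M N : X.Modules} {U V W : X.Opens}

lemma IsGen.res {s : Γ(M, U)} (hs : IsGen s) (h : V ≤ U) : IsGen (res h s) := by
  intro W hW
  simpa [res_res] using hs W (hW.trans h)

lemma IsGen.bij {s : Γ(M, U)} (hs : IsGen s) : Function.Bijective (fun r : Γ(X, U) => r • s) := by
  simpa [res_self] using hs U le_rfl

lemma IsGen.eq_of_smul {s : Γ(M, U)} (hs : IsGen s) {r r' : Γ(X, U)} (h : r • s = r' • s) :
    r = r' := hs.bij.1 h

lemma IsGen.exists_smul {s : Γ(M, U)} (hs : IsGen s) (t : Γ(M, U)) : ∃ r : Γ(X, U), t = r • s := by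
  obtain ⟨r, hr⟩ := hs.bij.2 t
  exact ⟨r, hr.symm⟩

lemma IsLineBundle.exists_le (hM : IsLineBundle M) {x : X} (hx : x ∈ U) :
    ∃ (V : X.Opens) (_ : V ≤ U) (s : Γ(M, V)), x ∈ V ∧ IsGen s := by
  obtain ⟨V, s, hxV, hs⟩ := hM x
  exact ⟨V ⊓ U, inf_le_right, SimplicialPic.res inf_le_left s, ⟨hxV, hx⟩, hs.res _⟩

lemma isIso_of_isGen (φ : M ⟶ N) (H : ∀ x : X, ∃ (U : X.Opens) (s : Γ(M, U)), x ∈ U ∧ IsGen s ∧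
    IsGen (φ.app U s)) : IsIso φ := by
  rw [Scheme.Modules.Hom.isIso_iff_isIso_app]
  intro U
  rw [ConcreteCategory.isIso_iff_bijective]
  constructor
  · rw [injective_iff_map_eq_zero]
    intro a ha
    refine res_ext _ _ fun x hx => ?_
    obtain ⟨V, s, hxV, hs, ht⟩ := H x
    refine ⟨V ⊓ U, inf_le_right, ⟨hxV, hx⟩, ?_⟩
    obtain ⟨r, hr⟩ := (hs.res (inf_le_left : V ⊓ U ≤ V)).exists_smul (res inf_le_right a)
    have h1 : φ.app (V ⊓ U) (res inf_le_right a) = 0 := by rw [app_res, ha, res_zero]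
    rw [hr, Scheme.Modules.Hom.app_smul, app_res] at h1
    have := (ht.res (inf_le_left : V ⊓ U ≤ V)).eq_of_smul (r := r) (r' := 0) (by simpa using h1)
    rw [hr, this, res_zero, zero_smul]
  · intro b
    obtain ⟨a, ha⟩ := res_glue (M := M) (U := U)
      (fun V a => ∃ h : V ≤ U, φ.app V a = res h b ∧ ∃ s : Γ(M, V), IsGen s ∧ IsGen (φ.app V s))
      (by
        rintro V W h a ⟨hV, ha, s, hs, hs'⟩
        exact ⟨h.trans hV, by rw [app_res, ha, res_res], _, hs.res h, by
          rw [app_res]; exact hs'.res h⟩)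
      (by
        rintro V a a' ⟨hV, ha, s, hs, hs'⟩ ⟨_, ha', -⟩
        obtain ⟨r, rfl⟩ := hs.exists_smul a
        obtain ⟨r', rfl⟩ := hs.exists_smul a'
        rw [← ha', Scheme.Modules.Hom.app_smul, Scheme.Modules.Hom.app_smul] at ha
        rw [hs'.eq_of_smul ha])
      (by
        intro x hx
        obtain ⟨V, s, hxV, hs, ht⟩ := H x
        refine ⟨V ⊓ U, inf_le_right, ⟨hxV, hx⟩, ?_⟩
        obtain ⟨r, hr⟩ := (ht.res (inf_le_left : V ⊓ U ≤ V)).exists_smul (res inf_le_right b)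
        refine ⟨r • res inf_le_left s, inf_le_right, ?_, res inf_le_left s, hs.res _, ?_⟩
        · rw [Scheme.Modules.Hom.app_smul, app_res, hr]
        · rw [app_res]; exact ht.res _)
    refine ⟨a, res_ext _ _ fun x hx => ?_⟩
    obtain ⟨V, s, hxV, hs, ht⟩ := H x
    refine ⟨V ⊓ U, inf_le_right, ⟨hxV, hx⟩, ?_⟩
    obtain ⟨r, hr⟩ := (ht.res (inf_le_left : V ⊓ U ≤ V)).exists_smul (res inf_le_right b)
    rw [← app_res, ha (V ⊓ U) inf_le_right (r • res inf_le_left s) ⟨inf_le_right, ?_,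
      res inf_le_left s, hs.res _, ?_⟩, hr, Scheme.Modules.Hom.app_smul, app_res]
    · rw [Scheme.Modules.Hom.app_smul, app_res, hr]
    · rw [app_res]; exact ht.res _

lemma IsGen.app_iso {s : Γ(M, U)} (hs : IsGen s) (φ : M ⟶ N) [IsIso φ] : IsGen (φ.app U s) := by
  intro V h
  have := (ConcreteCategory.isIso_iff_bijective (φ.app V)).1 inferInstance
  convert this.comp (hs V h) using 1
  ext r
  simp [Scheme.Modules.Hom.app_smul, app_res]

lemma IsGen.of_app_iso {s : Γ(M, U)} (φ : M ⟶ N) [IsIso φ] (hs : IsGen (φ.app U s)) : IsGen s := by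
  have := hs.app_iso (inv φ)
  rwa [← ConcreteCategory.comp_apply, ← Scheme.Modules.Hom.comp_app, IsIso.hom_inv_id] at this

lemma IsLineBundle.of_iso (hM : IsLineBundle M) (e : M ≅ N) : IsLineBundle N := by
  intro x
  obtain ⟨U, s, hx, hs⟩ := hM x
  exact ⟨U, _, hx, hs.app_iso e.hom⟩

lemma hom_ext_isGen (φ ψ : M ⟶ N) (H : ∀ x : X, ∃ (U : X.Opens) (s : Γ(M, U)), x ∈ U ∧ IsGen s ∧
    φ.app U s = ψ.app U s) : φ = ψ := by
  refine Scheme.Modules.hom_ext _ _ fun U => ?_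
  ext a
  refine res_ext _ _ fun x hx => ?_
  obtain ⟨V, s, hxV, hs, e⟩ := H x
  refine ⟨V ⊓ U, inf_le_right, ⟨hxV, hx⟩, ?_⟩
  obtain ⟨r, hr⟩ := (hs.res (inf_le_left : V ⊓ U ≤ V)).exists_smul (res inf_le_right a)
  rw [← app_res, ← app_res, hr, Scheme.Modules.Hom.app_smul, Scheme.Modules.Hom.app_smul, app_res,
    app_res, e]

/-- Build a morphism out of additive, linear, natural maps on sections. -/
def mkHom (f : ∀ U : X.Opens, Γ(M, U) → Γ(N, U))
    (hadd : ∀ U a b, f U (a + b) = f U a + f U b)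
    (hsmul : ∀ U (r : Γ(X, U)) a, f U (r • a) = r • f U a)
    (hres : ∀ U V (h : V ≤ U) a, f V (res h a) = res h (f U a)) : M ⟶ N :=
  ⟨{ app := fun U => ModuleCat.ofHom (X := M.val.obj U) (Y := N.val.obj U)
        { toFun := f U.unop, map_add' := hadd U.unop, map_smul' := hsmul U.unop }
     naturality := fun {U V} i => by
      ext a
      exact hres U.unop V.unop i.unop.le a }⟩

lemma mkHom_app (f : ∀ U : X.Opens, Γ(M, U) → Γ(N, U)) (hadd hsmul hres) (U : X.Opens) (a : Γ(M, U)) :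
    (mkHom f hadd hsmul hres).app U a = f U a := rfl

lemma exists_hom_of_rel (R : ∀ U : X.Opens, Γ(M, U) → Γ(N, U) → Prop)
    (hgen : ∀ U s t, R U s t → IsGen s)
    (hres : ∀ U V (h : V ≤ U) s t, R U s t → R V (res h s) (res h t))
    (huniq : ∀ U s t s' t' (r : Γ(X, U)), R U s t → R U s' t' → s' = r • s → t' = r • t)
    (hcov : ∀ x : X, ∃ (U : X.Opens) (s : _) (t : _), x ∈ U ∧ R U s t) :
    ∃ φ : M ⟶ N, ∀ U s t, R U s t → φ.app U s = t := by
  let P (U : X.Opens) (a : Γ(M, U)) (b : Γ(N, U)) : Prop :=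
    ∃ s t, ∃ r : Γ(X, U), R U s t ∧ a = r • s ∧ b = r • t
  have hPres : ∀ U V (h : V ≤ U) a b, P U a b → P V (res h a) (res h b) := by
    rintro U V h _ _ ⟨s, t, r, hR, rfl, rfl⟩
    exact ⟨_, _, resR h r, hres _ _ h _ _ hR, res_smul .., res_smul ..⟩
  have hPuniq : ∀ U a b b', P U a b → P U a b' → b = b' := by
    rintro U a _ _ ⟨s, t, r, hR, ha, rfl⟩ ⟨s', t', r', hR', ha', rfl⟩
    obtain ⟨u, hu⟩ := (hgen _ _ _ hR).exists_smul s'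
    rw [huniq _ _ _ _ _ _ hR hR' hu, smul_smul]
    rw [ha, hu, smul_smul] at ha'
    rw [(hgen _ _ _ hR).eq_of_smul ha']
  have hPex : ∀ (U : X.Opens) (a : Γ(M, U)), ∀ x ∈ U, ∃ (V : X.Opens) (h : V ≤ U), x ∈ V ∧
      ∃ b, P V (res h a) b := by
    intro U a x hx
    obtain ⟨V, s, t, hxV, hR⟩ := hcov x
    refine ⟨V ⊓ U, inf_le_right, ⟨hxV, hx⟩, ?_⟩
    obtain ⟨r, hr⟩ := ((hgen _ _ _ hR).res (inf_le_left : V ⊓ U ≤ V)).exists_smul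
      (res inf_le_right a)
    exact ⟨_, _, _, r, hres _ _ inf_le_left _ _ hR, hr, rfl⟩
  have key : ∀ (U : X.Opens) (a : Γ(M, U)), ∃ b : Γ(N, U), ∀ V (h : V ≤ U) b',
      P V (res h a) b' → res h b = b' := by
    intro U a
    obtain ⟨b, hb⟩ := res_glue (M := N) (U := U) (fun V b' => ∃ h : V ≤ U, P V (res h a) b')
      (by
        rintro V W h b' ⟨hV, hP⟩
        exact ⟨h.trans hV, by simpa [res_res] using hPres _ _ h _ _ hP⟩)
      (by
        rintro V b b' ⟨h, hP⟩ ⟨_, hP'⟩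
        exact hPuniq _ _ _ _ hP hP')
      (by
        intro x hx
        obtain ⟨V, h, hxV, b, hb⟩ := hPex U a x hx
        exact ⟨V, h, hxV, b, h, hb⟩)
    exact ⟨b, fun V h b' hP => hb V h b' ⟨h, hP⟩⟩
  choose f hf using key
  refine ⟨mkHom f ?_ ?_ ?_, ?_⟩
  · intro U a a'
    refine res_ext _ _ fun x hx => ?_
    obtain ⟨V, h, hxV, b, s, t, r, hR, e, rfl⟩ := hPex U a x hx
    obtain ⟨r', hr'⟩ := (hgen _ _ _ hR).exists_smul (res h a')
    refine ⟨V, h, hxV, ?_⟩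
    rw [res_add, hf U (a + a') V h ((r + r') • t) ⟨s, t, _, hR, ?_, rfl⟩,
      hf U a V h _ ⟨s, t, _, hR, e, rfl⟩, hf U a' V h _ ⟨s, t, _, hR, hr', rfl⟩, add_smul]
    rw [res_add, e, hr', add_smul]
  · intro U c a
    refine res_ext _ _ fun x hx => ?_
    obtain ⟨V, h, hxV, b, s, t, r, hR, e, rfl⟩ := hPex U a x hx
    refine ⟨V, h, hxV, ?_⟩
    rw [res_smul, hf U (c • a) V h ((resR h c * r) • t) ⟨s, t, _, hR, ?_, rfl⟩,
      hf U a V h _ ⟨s, t, _, hR, e, rfl⟩, smul_smul]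
    rw [res_smul, e, smul_smul]
  · intro U V h a
    refine res_ext _ _ fun x hx => ?_
    obtain ⟨W, hW, hxW, b, hb⟩ := hPex V (res h a) x hx
    refine ⟨W, hW, hxW, ?_⟩
    rw [hf V _ W hW _ hb, res_res]
    rw [res_res] at hb
    rw [hf U _ W _ _ hb]
  · intro U s t hR
    have := hf U s U le_rfl t ⟨s, t, 1, hR, by rw [res_self, one_smul], by rw [one_smul]⟩
    rwa [res_self] at this
end
end
end SimplicialPic

namespace SimplicialPic
noncomputable section
variable {X : Scheme.{u}}

/-- The presheaf tensor product `U ↦ M(U) ⊗ N(U)`. -/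
def preTensor (M N : X.Modules) : X.PresheafOfModules :=
  PresheafOfModules.Monoidal.tensorObj (R := X.presheaf) M.val N.val

/-- The tensor product of sheaves of modules: the sheafification of `U ↦ M(U) ⊗ N(U)`. -/
def tensor (M N : X.Modules) : X.Modules :=
  (PresheafOfModules.sheafification (𝟙 X.ringCatSheaf.obj)).obj (preTensor M N)

/-- The canonical map from the presheaf tensor product to its sheafification. -/
def toTensor (M N : X.Modules) : preTensor M N ⟶ (tensor M N).val :=
  (PresheafOfModules.sheafificationAdjunction (𝟙 X.ringCatSheaf.obj)).unit.app (preTensor M N)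

/-- The map `M(U) ⊗ N(U) → (M ⊗ N)(U)`. -/
def toTensorApp (M N : X.Modules) (U : X.Opens) :
    TensorProduct Γ(X, U) Γ(M, U) Γ(N, U) →ₗ[Γ(X, U)] Γ(tensor M N, U) :=
  ((toTensor M N).app (op U)).hom

/-- `s ⊗ t` as a section of the tensor product. -/
def tmul {M N : X.Modules} {U : X.Opens} (s : Γ(M, U)) (t : Γ(N, U)) : Γ(tensor M N, U) :=
  toTensorApp M N U (TensorProduct.tmul Γ(X, U) s t)

section
variable {M N M' N' : X.Modules} {U V : X.Opens}

lemma smul_tmul_left (r : Γ(X, U)) (s : Γ(M, U)) (t : Γ(N, U)) :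
    tmul (r • s) t = r • tmul s t := by
  simp [tmul, ← TensorProduct.smul_tmul']

lemma smul_tmul_right (r : Γ(X, U)) (s : Γ(M, U)) (t : Γ(N, U)) :
    tmul s (r • t) = r • tmul s t := by
  simp [tmul]

/-- Restriction for the presheaf tensor product. -/
def preRes (h : V ≤ U) (a : TensorProduct Γ(X, U) Γ(M, U) Γ(N, U)) :
    TensorProduct Γ(X, V) Γ(M, V) Γ(N, V) :=
  (preTensor M N).presheaf.map (homOfLE h).op a

lemma preRes_tmul (h : V ≤ U) (s : Γ(M, U)) (t : Γ(N, U)) :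
    preRes h (TensorProduct.tmul Γ(X, U) s t) = TensorProduct.tmul Γ(X, V) (res h s) (res h t) :=
  rfl

lemma res_toTensorApp (h : V ≤ U) (a : TensorProduct Γ(X, U) Γ(M, U) Γ(N, U)) :
    res h (toTensorApp M N U a) = toTensorApp M N V (preRes h a) :=
  (PresheafOfModules.naturality_apply (toTensor M N) (homOfLE h).op a).symm

lemma res_tmul (h : V ≤ U) (s : Γ(M, U)) (t : Γ(N, U)) :
    res h (tmul s t) = tmul (res h s) (res h t) := by
  rw [tmul, res_toTensorApp, preRes_tmul, tmul]

/-- The tensor product of morphisms. -/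
def tensorMap (φ : M ⟶ M') (ψ : N ⟶ N') : tensor M N ⟶ tensor M' N' :=
  (PresheafOfModules.sheafification (𝟙 X.ringCatSheaf.obj)).map
    (PresheafOfModules.Monoidal.tensorHom (R := X.presheaf) φ.val ψ.val)

lemma tensorMap_app (φ : M ⟶ M') (ψ : N ⟶ N') (s : Γ(M, U)) (t : Γ(N, U)) :
    (tensorMap φ ψ).app U (tmul s t) = tmul (φ.app U s) (ψ.app U t) := by
  have := (PresheafOfModules.sheafificationAdjunction (𝟙 X.ringCatSheaf.obj)).unit.naturality
    (PresheafOfModules.Monoidal.tensorHom (R := X.presheaf) φ.val ψ.val)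
  have := congr((($this).app (op U)).hom
    (TensorProduct.tmul Γ(X, U) s t))
  exact this.symm

lemma exists_preRes_eq (a b : TensorProduct Γ(X, U) Γ(M, U) Γ(N, U))
    (e : toTensorApp M N U a = toTensorApp M N U b) (x : X) (hx : x ∈ U) :
    ∃ (V : X.Opens) (h : V ≤ U), x ∈ V ∧ preRes h a = preRes h b := by
  have : Presheaf.IsLocallyInjective (Opens.grothendieckTopology X)
    (CategoryTheory.toSheafify (Opens.grothendieckTopology X) (preTensor M N).presheaf) :=
      inferInstance
  obtain ⟨V, i, hi, hxV⟩ := Presheaf.equalizerSieve_mem (Opens.grothendieckTopology X)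
    (CategoryTheory.toSheafify (Opens.grothendieckTopology X) (preTensor M N).presheaf)
    (X := op U) a b e x hx
  exact ⟨V, i.le, hxV, hi⟩

lemma exists_toTensorApp_eq (a : Γ(tensor M N, U)) (x : X) (hx : x ∈ U) :
    ∃ (V : X.Opens) (h : V ≤ U), x ∈ V ∧ ∃ b, toTensorApp M N V b = res h a := by
  have : Presheaf.IsLocallySurjective (Opens.grothendieckTopology X)
    (CategoryTheory.toSheafify (Opens.grothendieckTopology X) (preTensor M N).presheaf) :=
      inferInstance
  obtain ⟨V, i, ⟨b, hb⟩, hxV⟩ := Presheaf.imageSieve_mem (Opens.grothendieckTopology X)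
    (CategoryTheory.toSheafify (Opens.grothendieckTopology X) (preTensor M N).presheaf)
    (U := op U) a x hx
  exact ⟨V, i.le, hxV, b, hb⟩

lemma resR_ext (a b : Γ(X, U)) (H : ∀ x ∈ U, ∃ (V : X.Opens) (h : V ≤ U), x ∈ V ∧
    resR h a = resR h b) : a = b := by
  choose V h hx e using H
  refine TopCat.Sheaf.eq_of_locally_eq' X.sheaf (fun x : U => V x.1 x.2) U
    (fun x => homOfLE (h x.1 x.2)) ?_ a b ?_
  · intro x hxU
    exact Opens.mem_iSup.2 ⟨⟨x, hxU⟩, hx x hxU⟩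
  · intro x
    exact e x.1 x.2

lemma isGen_of_locally {a : Γ(M, U)}
    (hinj : ∀ (V : X.Opens) (h : V ≤ U) (r r' : Γ(X, V)), r • res h a = r' • res h a →
      ∀ x ∈ V, ∃ (W : X.Opens) (h' : W ≤ V), x ∈ W ∧ resR h' r = resR h' r')
    (hsurj : ∀ (V : X.Opens) (h : V ≤ U) (b : Γ(M, V)), ∀ x ∈ V, ∃ (W : X.Opens) (h' : W ≤ V),
      x ∈ W ∧ ∃ r : Γ(X, W), res h' b = r • res (h'.trans h) a) : IsGen a := by
  have inj : ∀ (V : X.Opens) (h : V ≤ U) (r r' : Γ(X, V)), r • res h a = r' • res h a → r = r' :=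
    fun V h r r' e => resR_ext _ _ (hinj V h r r' e)
  intro V h
  refine ⟨inj V h, fun b => ?_⟩
  choose W hW hx r hr using hsurj V h b
  obtain ⟨s, hs, -⟩ := TopCat.Sheaf.existsUnique_gluing' X.sheaf
    (fun x : V => W x.1 x.2) V (fun x => homOfLE (hW x.1 x.2))
    (by intro x hxU; exact Opens.mem_iSup.2 ⟨⟨x, hxU⟩, hx x hxU⟩)
    (fun x => r x.1 x.2) (by
      intro x y
      refine inj _ (inf_le_left.trans ((hW x.1 x.2).trans h)) _ _ ?_
      have e1 := congrArg (res (inf_le_left : W x.1 x.2 ⊓ W y.1 y.2 ≤ _)) (hr x.1 x.2)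
      have e2 := congrArg (res (inf_le_right : W x.1 x.2 ⊓ W y.1 y.2 ≤ _)) (hr y.1 y.2)
      rw [res_smul, res_res, res_res] at e1 e2
      exact e1.symm.trans e2)
  refine ⟨s, res_ext _ _ fun x hxV => ⟨W x hxV, hW x hxV, hx x hxV, ?_⟩⟩
  have e : resR (hW x hxV) s = r x hxV := hs ⟨x, hxV⟩
  rw [hr, ← e, ← res_res h (hW x hxV)]
  exact res_smul _ _ _

lemma IsGen.tmul {s : Γ(M, U)} {t : Γ(N, U)} (hs : IsGen s) (ht : IsGen t) :
    IsGen (tmul s t) := by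
  have aux (V : X.Opens) (h : V ≤ U) (b : TensorProduct Γ(X, V) Γ(M, V) Γ(N, V)) :
      ∃ r : Γ(X, V), b = r • TensorProduct.tmul Γ(X, V) (SimplicialPic.res h s)
        (SimplicialPic.res h t) := by
    induction b with
    | zero => exact ⟨0, by simp⟩
    | add b b' hb hb' =>
      obtain ⟨r, rfl⟩ := hb
      obtain ⟨r', rfl⟩ := hb'
      exact ⟨r + r', by rw [add_smul]⟩
    | tmul m n =>
      obtain ⟨r, rfl⟩ := (hs.res h).exists_smul m
      obtain ⟨r', rfl⟩ := (ht.res h).exists_smul n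
      exact ⟨r' * r, by simp [← TensorProduct.smul_tmul', mul_smul]⟩
  have aux2 (V : X.Opens) (h : V ≤ U) (r r' : Γ(X, V))
      (e : r • TensorProduct.tmul Γ(X, V) (SimplicialPic.res h s) (SimplicialPic.res h t) =
        r' • TensorProduct.tmul Γ(X, V) (SimplicialPic.res h s) (SimplicialPic.res h t)) :
      r = r' := by
    let es := LinearEquiv.ofBijective
      (LinearMap.toSpanSingleton Γ(X, V) _ (SimplicialPic.res h s)) (hs V h)
    let et := LinearEquiv.ofBijective
      (LinearMap.toSpanSingleton Γ(X, V) _ (SimplicialPic.res h t)) (ht V h)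
    have e1 : es.symm (SimplicialPic.res h s) = 1 := by
      rw [LinearEquiv.symm_apply_eq]; exact (one_smul _ _).symm
    have e2 : et.symm (SimplicialPic.res h t) = 1 := by
      rw [LinearEquiv.symm_apply_eq]; exact (one_smul _ _).symm
    have := congrArg (TensorProduct.lid _ _ ∘ TensorProduct.congr es.symm et.symm) e
    simpa [e1, e2] using this
  refine isGen_of_locally ?_ ?_
  · intro V h r r' e x hx
    rw [res_tmul, SimplicialPic.tmul, ← map_smul, ← map_smul] at e
    obtain ⟨W, hW, hxW, e⟩ := exists_preRes_eq _ _ e x hx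
    refine ⟨W, hW, hxW, aux2 W (hW.trans h) _ _ ?_⟩
    rw [TensorProduct.smul_tmul', TensorProduct.smul_tmul', preRes_tmul, preRes_tmul, res_smul,
      res_smul, res_res, res_res, ← TensorProduct.smul_tmul', ← TensorProduct.smul_tmul'] at e
    exact e
  · intro V h b x hx
    obtain ⟨W, hW, hxW, c, hc⟩ := exists_toTensorApp_eq b x hx
    obtain ⟨r, rfl⟩ := aux W (hW.trans h) c
    exact ⟨W, hW, hxW, r, by rw [← hc, map_smul, res_tmul, SimplicialPic.tmul]⟩

lemma IsLineBundle.tensor (hM : IsLineBundle M) (hN : IsLineBundle N) :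
    IsLineBundle (tensor M N) := by
  intro x
  obtain ⟨U, s, hxU, hs⟩ := hM x
  obtain ⟨V, hV, t, hxV, ht⟩ := hN.exists_le hxU
  exact ⟨V, _, hxV, (hs.res hV).tmul ht⟩
end
end
end SimplicialPic

namespace SimplicialPic
noncomputable section
open Scheme.Modules (pullback pushforward pullbackPushforwardAdjunction pullbackComp)

section
variable {X Y Z : Scheme.{u}} (f : X ⟶ Y) (g : Y ⟶ Z)
/-- The pull-back of sections. -/
def pb {M : Y.Modules} {U : Y.Opens} (s : Γ(M, U)) : Γ((pullback f).obj M, f ⁻¹ᵁ U) :=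
  ((pullbackPushforwardAdjunction f).unit.app M).app U s

lemma pb_smul {M : Y.Modules} {U : Y.Opens} (r : Γ(Y, U)) (s : Γ(M, U)) :
    pb f (r • s) = f.app U r • pb f s :=
  ((pullbackPushforwardAdjunction f).unit.app M).app_smul r s

lemma res_pb {M : Y.Modules} {U V : Y.Opens} (h : V ≤ U) (h' : f ⁻¹ᵁ V ≤ f ⁻¹ᵁ U) (s : Γ(M, U)) :
    res h' (pb f s) = pb f (res h s) :=
  (app_res ((pullbackPushforwardAdjunction f).unit.app M) h s).symm

lemma map_pb {M N : Y.Modules} (φ : M ⟶ N) {U : Y.Opens} (s : Γ(M, U)) :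
    ((pullback f).map φ).app _ (pb f s) = pb f (φ.app U s) := by
  have := (pullbackPushforwardAdjunction f).unit.naturality φ
  exact congr((($this).app U) s).symm

lemma pb_hom_ext {M : Y.Modules} {N : X.Modules} (φ ψ : (pullback f).obj M ⟶ N)
    (H : ∀ (U : Y.Opens) (s : Γ(M, U)), φ.app _ (pb f s) = ψ.app _ (pb f s)) : φ = ψ := by
  apply ((pullbackPushforwardAdjunction f).homEquiv _ _).injective
  rw [Adjunction.homEquiv_unit, Adjunction.homEquiv_unit]
  refine Scheme.Modules.hom_ext _ _ fun U => ?_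
  ext s
  exact H U s

lemma pullbackComp_pb {M : Z.Modules} {U : Z.Opens} (s : Γ(M, U)) :
    ((pullbackComp f g).hom.app M).app _ (pb f (pb g s)) = pb (f ≫ g) s := by
  have h1 := Scheme.Modules.conjugateEquiv_pullbackComp_inv f g
  have h2 := unit_conjugateEquiv ((pullbackPushforwardAdjunction g).comp
    (pullbackPushforwardAdjunction f)) (pullbackPushforwardAdjunction (f ≫ g))
      (pullbackComp f g).inv M
  rw [h1] at h2
  have h3 := congr((($h2).app U) s)
  have h4 : pb f (pb g s) = ((pullbackComp f g).inv.app M).app _ (pb (f ≫ g) s) := h3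
  rw [h4]
  have h5 := congr((($((pullbackComp f g).inv_hom_id_app M)).app ((f ≫ g) ⁻¹ᵁ U)) (pb (f ≫ g) s))
  exact h5

/-- The canonical isomorphism `f^* g^* M ≅ h^* M` for `h = f ≫ g`. -/
def pc {f : X ⟶ Y} {g : Y ⟶ Z} {h : X ⟶ Z} (e : f ≫ g = h) (M : Z.Modules) :
    (pullback f).obj ((pullback g).obj M) ≅ (pullback h).obj M :=
  (pullbackComp f g).app M ≪≫ (Scheme.Modules.pullbackCongr e).app M

lemma pc_pb {f : X ⟶ Y} {g : Y ⟶ Z} {h : X ⟶ Z} (e : f ≫ g = h) {M : Z.Modules}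
    {U : Z.Opens} {V : X.Opens} (h1 : V ≤ f ⁻¹ᵁ g ⁻¹ᵁ U) (h2 : V ≤ h ⁻¹ᵁ U) (s : Γ(M, U)) :
    (pc e M).hom.app V (res h1 (pb f (pb g s))) = res h2 (pb h s) := by
  subst e
  rw [app_res]
  exact congrArg (res h2) (pullbackComp_pb f g s)

lemma pc_inv_pb {f : X ⟶ Y} {g : Y ⟶ Z} {h : X ⟶ Z} (e : f ≫ g = h) {M : Z.Modules}
    {U : Z.Opens} {V : X.Opens} (h1 : V ≤ f ⁻¹ᵁ g ⁻¹ᵁ U) (h2 : V ≤ h ⁻¹ᵁ U) (s : Γ(M, U)) :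
    (pc e M).inv.app V (res h2 (pb h s)) = res h1 (pb f (pb g s)) := by
  rw [← pc_pb e h1 h2, ← ConcreteCategory.comp_apply, ← Scheme.Modules.Hom.comp_app,
    Iso.hom_inv_id]
  rfl
end
section
variable {X Y : Scheme.{u}}

/-- The structure sheaf as a module over itself. -/
def unitM (X : Scheme.{u}) : X.Modules := SheafOfModules.unit X.ringCatSheaf

/-- The section `1` of the structure sheaf. -/
def one (U : X.Opens) : Γ(unitM X, U) := (1 : Γ(X, U))

lemma res_one {U V : X.Opens} (h : V ≤ U) : res h (one U) = one V :=
  map_one (X.presheaf.map (homOfLE h).op).hom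

lemma smul_one_eq {U : X.Opens} (r : Γ(X, U)) : r • one U = (r : Γ(X, U)) := mul_one r

lemma isGen_one (U : X.Opens) : IsGen (one U) := by
  intro V h
  rw [res_one]
  exact ⟨fun r r' e => (smul_one_eq r).symm.trans (e.trans (smul_one_eq r')), fun r => ⟨r, smul_one_eq r⟩⟩

lemma isLineBundle_unitM (X : Scheme.{u}) : IsLineBundle (unitM X) :=
  fun _ => ⟨⊤, one ⊤, trivial, isGen_one ⊤⟩

/-- The morphism `𝒪_X → M` given by a global section. -/
def unitHom {M : X.Modules} {T : X.Opens} (hT : ∀ U, U ≤ T) (s : Γ(M, T)) : unitM X ⟶ M :=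
  mkHom (fun U (r : Γ(X, U)) => r • res (hT U) s) (fun U r r' => add_smul (R := Γ(X, U)) r r' _)
    (fun U r r' => mul_smul (α := Γ(X, U)) r r' _) (fun U V h r => by
      rw [← res_res (hT U) h]
      exact (res_smul h _ _).symm)

lemma unitHom_one {M : X.Modules} {T : X.Opens} (hT : ∀ U, U ≤ T) (s : Γ(M, T)) (U : X.Opens) :
    (unitHom hT s).app U (one U) = res (hT U) s :=
  one_smul Γ(X, U) _

/-- The map `𝒪_Y → f_* 𝒪_X`. -/
def unitToPushforward (f : X ⟶ Y) : unitM Y ⟶ (pushforward f).obj (unitM X) :=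
  mkHom (fun U (r : Γ(Y, U)) => (f.app U r : Γ(X, f ⁻¹ᵁ U))) (fun U r r' => map_add (f.app U).hom r r')
    (fun U r r' => map_mul (f.app U).hom r r')
    (fun _ _ h r => congr(($(f.naturality (homOfLE h).op)).hom r))

/-- The canonical map `f^* 𝒪_Y → 𝒪_X`. -/
def pbUnit (f : X ⟶ Y) : (pullback f).obj (unitM Y) ⟶ unitM X :=
  ((pullbackPushforwardAdjunction f).homEquiv _ _).symm (unitToPushforward f)

lemma pbUnit_pb (f : X ⟶ Y) (U : Y.Opens) : (pbUnit f).app _ (pb f (one U)) = one (f ⁻¹ᵁ U) := by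
  have h : (pullbackPushforwardAdjunction f).homEquiv _ _ (pbUnit f) = unitToPushforward f :=
    Equiv.apply_symm_apply _ _
  rw [Adjunction.homEquiv_unit] at h
  have h' := congr((($h).app U) (one U))
  exact h'.trans (map_one (f.app U).hom)

instance (f : X ⟶ Y) : IsIso (pbUnit f) := by
  have hT : ∀ U : X.Opens, U ≤ f ⁻¹ᵁ ⊤ := fun _ _ _ => trivial
  refine ⟨unitHom hT (pb f (one ⊤)), ?_, ?_⟩
  · refine pb_hom_ext f _ _ fun U s => ?_
    obtain ⟨r, rfl⟩ := (isGen_one U).exists_smul s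
    rw [pb_smul, Scheme.Modules.Hom.app_smul, Scheme.Modules.Hom.app_smul,
      Scheme.Modules.Hom.comp_app, ConcreteCategory.comp_apply, pbUnit_pb, unitHom_one,
      res_pb f (le_top : U ≤ ⊤), res_one]
    rfl
  · refine hom_ext_isGen _ _ fun x => ⟨⊤, one ⊤, trivial, isGen_one ⊤, ?_⟩
    rw [Scheme.Modules.Hom.comp_app, ConcreteCategory.comp_apply, unitHom_one, app_res,
      pbUnit_pb, res_one]
    rfl

lemma isGen_pb_one (f : X ⟶ Y) (U : Y.Opens) : IsGen (pb f (one U)) := by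
  refine IsGen.of_app_iso (pbUnit f) ?_
  rw [pbUnit_pb]
  exact isGen_one _

/-- Restriction of a section along an open immersion. -/
def rs (f : X ⟶ Y) [IsOpenImmersion f] {M : Y.Modules} {U : Y.Opens} (s : Γ(M, U)) :
    Γ(M.restrict f, f ⁻¹ᵁ U) :=
  M.presheaf.map (homOfLE (f.image_preimage_le U)).op s

lemma isGen_rs_iff (f : X ⟶ Y) [IsOpenImmersion f] {M : Y.Modules}
    {U : Y.Opens} (hU : U ≤ f.opensRange) (s : Γ(M, U)) : IsGen (rs f s) ↔ IsGen s := by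
  have key (V : X.Opens) (h : V ≤ f ⁻¹ᵁ U) (h' : f ''ᵁ V ≤ U) :
      Function.Bijective (fun r : Γ(X, V) => r • res h (rs f s)) ↔
        Function.Bijective (fun r : Γ(Y, f ''ᵁ V) => r • res h' s) := by
    have e : (fun r : Γ(X, V) => r • res h (rs f s)) =
        (fun r : Γ(Y, f ''ᵁ V) => r • res h' s) ∘ (f.appIso V).inv := by
      funext r
      have : res h (rs f s) = res h' s := by
        exact res_res (M := M) (f.image_preimage_le U) (Scheme.Hom.image_mono f h) s
      rw [this]
      rfl
    rw [e]
    exact Function.Bijective.of_comp_iff _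
      ((ConcreteCategory.isIso_iff_bijective (f.appIso V).inv).1 inferInstance)
  have hle (V : X.Opens) (h : V ≤ f ⁻¹ᵁ U) : f ''ᵁ V ≤ U :=
    (Scheme.Hom.image_mono f h).trans (f.image_preimage_le U)
  refine ⟨fun H W hW => ?_, fun H V h => (key V h (hle V h)).2 (H _ _)⟩
  obtain ⟨V, rfl⟩ : ∃ V : X.Opens, W = f ''ᵁ V := ⟨f ⁻¹ᵁ W, by
    rw [Scheme.Hom.image_preimage_eq_opensRange_inf, inf_eq_right.2 (hW.trans hU)]⟩
  have hV : V ≤ f ⁻¹ᵁ U := by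
    rw [← f.preimage_image_eq V]
    exact fun x hx => hW hx
  exact (key V hV hW).1 (H V hV)

lemma isGen_pb_iff (f : X ⟶ Y) [IsOpenImmersion f] {M : Y.Modules}
    {U : Y.Opens} (hU : U ≤ f.opensRange) (s : Γ(M, U)) : IsGen (pb f s) ↔ IsGen s := by
  have h1 := (Scheme.Modules.restrictAdjunction f).homEquiv_leftAdjointUniq_hom_app
    (pullbackPushforwardAdjunction f) M
  rw [Adjunction.homEquiv_unit] at h1
  have h2 : ((Scheme.Modules.restrictFunctorIsoPullback f).hom.app M).app _ (rs f s) = pb f s :=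
    congr((($h1).app U) s)
  rw [← h2, ← isGen_rs_iff f hU]
  exact ⟨fun h => h.of_app_iso, fun h => h.app_iso _⟩

lemma IsGen.pb (f : X ⟶ Y) {M : Y.Modules} {U : Y.Opens} {s : Γ(M, U)} (hs : IsGen s) :
    IsGen (pb f s) := by
  let ι := U.ι
  let ι' := (f ⁻¹ᵁ U).ι
  let f' := f ∣_ U
  have comm : f' ≫ ι = ι' ≫ f := morphismRestrict_ι f U
  rw [← isGen_pb_iff ι' (by simp [ι'])]
  rw [← isGen_pb_iff ι (by simp [ι])] at hs
  let σ : unitM U ⟶ (pullback ι).obj M :=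
    unitHom (T := ι ⁻¹ᵁ U) (by simp [ι]) (SimplicialPic.pb ι s)
  have hσ (V) : σ.app V (one V) = SimplicialPic.res (by simp [ι]) (SimplicialPic.pb ι s) :=
    unitHom_one _ _ _
  have : IsIso σ := by
    refine isIso_of_isGen _ fun x => ⟨⊤, one ⊤, trivial, isGen_one ⊤, ?_⟩
    rw [hσ]
    exact hs.res _
  have h1 := (isGen_pb_one f' (ι ⁻¹ᵁ U)).app_iso ((pullback f').map σ)
  rw [map_pb, hσ, res_self] at h1
  have h2 := (h1.app_iso (pc comm M).hom).app_iso (pc rfl M).inv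
  have e : f' ⁻¹ᵁ ι ⁻¹ᵁ U = ι' ⁻¹ᵁ f ⁻¹ᵁ U := by
    rw [← Scheme.Hom.comp_preimage, comm, Scheme.Hom.comp_preimage]
  have h3 := pc_pb comm (V := f' ⁻¹ᵁ ι ⁻¹ᵁ U) le_rfl e.le s
  have h4 := pc_inv_pb (f := ι') (g := f) rfl (V := f' ⁻¹ᵁ ι ⁻¹ᵁ U) e.le e.le s
  rw [res_self] at h3
  rw [h3, h4] at h2
  have h5 := h2.res e.ge
  rwa [res_res, res_self] at h5

lemma IsLineBundle.pullback (f : X ⟶ Y) {M : Y.Modules} (hM : IsLineBundle M) :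
    IsLineBundle ((pullback f).obj M) := by
  intro x
  obtain ⟨U, s, hx, hs⟩ := hM (f x)
  exact ⟨f ⁻¹ᵁ U, _, hx, hs.pb f⟩

end
end
end SimplicialPic

namespace SimplicialPic
noncomputable section
open Scheme.Modules (pullback pushforward pullbackPushforwardAdjunction pullbackComp)

section
variable {X : Scheme.{u}} {M N K M' N' : X.Modules} {U V : X.Opens}

lemma lift_preRes (b : ∀ U : X.Opens, Γ(M, U) →ₗ[Γ(X, U)] Γ(N, U) →ₗ[Γ(X, U)] Γ(K, U))
    (hb : ∀ (U V : X.Opens) (h : V ≤ U) s t, res h (b U s t) = b V (res h s) (res h t))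
    (h : V ≤ U) (a : TensorProduct Γ(X, U) Γ(M, U) Γ(N, U)) :
    TensorProduct.lift (b V) (preRes h a) = res h (TensorProduct.lift (b U) a) := by
  induction a using TensorProduct.induction_on with
  | zero =>
    rw [map_zero, res_zero, show preRes h (0 : TensorProduct Γ(X, U) Γ(M, U) Γ(N, U)) = 0 from
      map_zero ((preTensor M N).presheaf.map (homOfLE h).op).hom, map_zero]
  | add x y hx hy =>
    rw [map_add, res_add, ← hx, ← hy, ← map_add]
    congr 1
    exact map_add ((preTensor M N).presheaf.map (homOfLE h).op).hom x y
  | tmul s t =>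
    rw [preRes_tmul, TensorProduct.lift.tmul, TensorProduct.lift.tmul, hb]

/-- A bilinear map on sections, as a map from the presheaf tensor product. -/
def preLift (b : ∀ U : X.Opens, Γ(M, U) →ₗ[Γ(X, U)] Γ(N, U) →ₗ[Γ(X, U)] Γ(K, U))
    (hb : ∀ (U V : X.Opens) (h : V ≤ U) s t, res h (b U s t) = b V (res h s) (res h t)) :
    preTensor M N ⟶ K.val where
  app := fun U => ModuleCat.ofHom (R := X.ringCatSheaf.obj.obj U)
    (X := (preTensor M N).obj U) (Y := K.val.obj U)
    { toFun := TensorProduct.lift (b U.unop)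
      map_add' := (TensorProduct.lift (b U.unop)).map_add'
      map_smul' := (TensorProduct.lift (b U.unop)).map_smul' }
  naturality := fun {U V} i => ModuleCat.hom_ext (LinearMap.ext fun a =>
    lift_preRes b hb i.unop.le a)

/-- The morphism out of the tensor product given by a bilinear map on sections. -/
def tensorLift (b : ∀ U : X.Opens, Γ(M, U) →ₗ[Γ(X, U)] Γ(N, U) →ₗ[Γ(X, U)] Γ(K, U))
    (hb : ∀ (U V : X.Opens) (h : V ≤ U) s t, res h (b U s t) = b V (res h s) (res h t)) :
    tensor M N ⟶ K :=
  (PresheafOfModules.sheafificationHomEquiv (𝟙 X.ringCatSheaf.obj)).symm (preLift b hb)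

lemma tensorLift_tmul (b : ∀ U : X.Opens, Γ(M, U) →ₗ[Γ(X, U)] Γ(N, U) →ₗ[Γ(X, U)] Γ(K, U))
    (hb) (s : Γ(M, U)) (t : Γ(N, U)) :
    (tensorLift b hb).app U (tmul s t) = b U s t := by
  have h := (PresheafOfModules.sheafificationHomEquiv (F := K) (𝟙 X.ringCatSheaf.obj)).apply_symm_apply
    (preLift b hb)
  exact congr((($h).app (op U)).hom (TensorProduct.tmul Γ(X, U) s t))

lemma app_toTensorApp_eq (φ ψ : tensor M N ⟶ K)
    (H : ∀ (s : Γ(M, U)) (t : Γ(N, U)), φ.app U (tmul s t) = ψ.app U (tmul s t))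
    (a : TensorProduct Γ(X, U) Γ(M, U) Γ(N, U)) :
    φ.app U (toTensorApp M N U a) = ψ.app U (toTensorApp M N U a) := by
  induction a using TensorProduct.induction_on with
  | zero => simp
  | add x y hx hy => simp only [map_add, hx, hy]
  | tmul s t => exact H s t

lemma tensor_hom_ext (φ ψ : tensor M N ⟶ K)
    (H : ∀ (U : X.Opens) (s : Γ(M, U)) (t : Γ(N, U)), φ.app U (tmul s t) = ψ.app U (tmul s t)) :
    φ = ψ := by
  apply (PresheafOfModules.sheafificationHomEquiv (𝟙 X.ringCatSheaf.obj)).injective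
  apply (PresheafOfModules.toPresheaf _).map_injective
  ext U a
  exact app_toTensorApp_eq φ ψ (H U.unop) a

lemma tmul_add_left (s s' : Γ(M, U)) (t : Γ(N, U)) : tmul (s + s') t = tmul s t + tmul s' t := by
  simp [tmul, TensorProduct.add_tmul]
lemma tmul_add_right (s : Γ(M, U)) (t t' : Γ(N, U)) : tmul s (t + t') = tmul s t + tmul s t' := by
  simp [tmul, TensorProduct.tmul_add]

lemma comp_app_apply (φ : M ⟶ N) (ψ : N ⟶ K) (s : Γ(M, U)) :
    (φ ≫ ψ).app U s = ψ.app U (φ.app U s) := rfl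

lemma hom_inv_app_apply (e : M ≅ N) (s : Γ(M, U)) : e.inv.app U (e.hom.app U s) = s := by
  rw [← comp_app_apply, Iso.hom_inv_id]; rfl

lemma inv_hom_app_apply (e : M ≅ N) (s : Γ(N, U)) : e.hom.app U (e.inv.app U s) = s := by
  rw [← comp_app_apply, Iso.inv_hom_id]; rfl

lemma tensorMap_comp {M'' N'' : X.Modules} (φ : M ⟶ M') (ψ : N ⟶ N') (φ' : M' ⟶ M'')
    (ψ' : N' ⟶ N'') :
    tensorMap (φ ≫ φ') (ψ ≫ ψ') = tensorMap φ ψ ≫ tensorMap φ' ψ' := by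
  refine tensor_hom_ext _ _ fun U s t => ?_
  simp only [comp_app_apply, tensorMap_app]

lemma tensorMap_id : tensorMap (𝟙 M) (𝟙 N) = 𝟙 (tensor M N) := by
  refine tensor_hom_ext _ _ fun U s t => ?_
  rw [tensorMap_app]; rfl

/-- The tensor product of isomorphisms. -/
def tensorIso (φ : M ≅ M') (ψ : N ≅ N') : tensor M N ≅ tensor M' N' where
  hom := tensorMap φ.hom ψ.hom
  inv := tensorMap φ.inv ψ.inv
  hom_inv_id := by rw [← tensorMap_comp, Iso.hom_inv_id, Iso.hom_inv_id, tensorMap_id]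
  inv_hom_id := by rw [← tensorMap_comp, Iso.inv_hom_id, Iso.inv_hom_id, tensorMap_id]
end

section
variable {X Y Z : Scheme.{u}}

lemma pb_add (f : X ⟶ Y) {M : Y.Modules} {U : Y.Opens} (s t : Γ(M, U)) :
    pb f (s + t) = pb f s + pb f t :=
  map_add (((pullbackPushforwardAdjunction f).unit.app M).app U).hom s t

/-- The canonical map `f^* (M ⊗ N) → f^* M ⊗ f^* N`, `f^*(s ⊗ t) ↦ f^* s ⊗ f^* t`. -/
def pbT (f : X ⟶ Y) (M N : Y.Modules) :
    (pullback f).obj (tensor M N) ⟶ tensor ((pullback f).obj M) ((pullback f).obj N) :=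
  ((pullbackPushforwardAdjunction f).homEquiv _ _).symm
    (tensorLift (K := (pushforward f).obj (tensor ((pullback f).obj M) ((pullback f).obj N)))
      (fun U => LinearMap.mk₂ Γ(Y, U) (fun s t => tmul (pb f s) (pb f t))
        (fun s s' t => by rw [pb_add]; exact tmul_add_left _ _ _)
        (fun r s t => by rw [pb_smul]; exact smul_tmul_left _ _ _)
        (fun s t t' => by rw [pb_add]; exact tmul_add_right _ _ _)
        (fun r s t => by rw [pb_smul]; exact smul_tmul_right _ _ _))
      (fun U V h s t => by
        have h' : f ⁻¹ᵁ V ≤ f ⁻¹ᵁ U := fun x hx => h hx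
        refine (res_tmul h' (pb f s) (pb f t)).trans ?_
        rw [res_pb f h h', res_pb f h h']
        rfl))

lemma pbT_pb (f : X ⟶ Y) {M N : Y.Modules} {U : Y.Opens} (s : Γ(M, U)) (t : Γ(N, U)) :
    (pbT f M N).app _ (pb f (tmul s t)) = tmul (pb f s) (pb f t) := by
  have h : (pullbackPushforwardAdjunction f).homEquiv _ _ (pbT f M N) = _ :=
    Equiv.apply_symm_apply _ _
  rw [Adjunction.homEquiv_unit] at h
  exact congr((($h).app U) (tmul s t)).trans (tensorLift_tmul _ _ s t)

lemma pbT_hom_ext (f : X ⟶ Y) {M N : Y.Modules} {K : X.Modules}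
    (φ ψ : (pullback f).obj (tensor M N) ⟶ K)
    (H : ∀ (U : Y.Opens) (s : Γ(M, U)) (t : Γ(N, U)),
      φ.app _ (pb f (tmul s t)) = ψ.app _ (pb f (tmul s t))) : φ = ψ := by
  apply ((pullbackPushforwardAdjunction f).homEquiv _ _).injective
  rw [Adjunction.homEquiv_unit, Adjunction.homEquiv_unit]
  exact tensor_hom_ext _ _ H

lemma pbT_isIso (f : X ⟶ Y) {M N : Y.Modules} (hM : IsLineBundle M) (hN : IsLineBundle N) :
    IsIso (pbT f M N) := by
  refine isIso_of_isGen _ fun x => ?_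
  obtain ⟨U, s, hxU, hs⟩ := hM (f x)
  obtain ⟨V, hV, t, hxV, ht⟩ := hN.exists_le hxU
  refine ⟨f ⁻¹ᵁ V, pb f (tmul (res hV s) t), hxV, ((hs.res hV).tmul ht).pb f, ?_⟩
  rw [pbT_pb]
  exact ((hs.res hV).pb f).tmul (ht.pb f)

/-- For line bundles `f^* (M ⊗ N) ≅ f^* M ⊗ f^* N`. -/
def pbTIso (f : X ⟶ Y) {M N : Y.Modules} (hM : IsLineBundle M) (hN : IsLineBundle N) :
    (pullback f).obj (tensor M N) ≅ tensor ((pullback f).obj M) ((pullback f).obj N) :=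
  haveI := pbT_isIso f hM hN
  asIso (pbT f M N)

@[simp] lemma pbTIso_hom (f : X ⟶ Y) {M N : Y.Modules} (hM : IsLineBundle M)
    (hN : IsLineBundle N) : (pbTIso f hM hN).hom = pbT f M N := rfl

lemma pbT_naturality (f : X ⟶ Y) {M N M' N' : Y.Modules} (φ : M ⟶ M') (ψ : N ⟶ N') :
    (pullback f).map (tensorMap φ ψ) ≫ pbT f M' N' =
      pbT f M N ≫ tensorMap ((pullback f).map φ) ((pullback f).map ψ) := by
  refine pbT_hom_ext f _ _ fun U s t => ?_
  simp only [comp_app_apply, map_pb, tensorMap_app, pbT_pb]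

lemma pbT_pc {f : X ⟶ Y} {g : Y ⟶ Z} {h : X ⟶ Z} (e : f ≫ g = h) (M N : Z.Modules) :
    (pc e (tensor M N)).hom ≫ pbT h M N =
      (pullback f).map (pbT g M N) ≫ pbT f _ _ ≫ tensorMap (pc e M).hom (pc e N).hom := by
  subst e
  rw [← Iso.eq_inv_comp]
  refine pbT_hom_ext (f ≫ g) _ _ fun U s t => ?_
  have e1 := pc_inv_pb (f := f) (g := g) rfl (V := f ⁻¹ᵁ g ⁻¹ᵁ U) le_rfl
    (show f ⁻¹ᵁ g ⁻¹ᵁ U ≤ (f ≫ g) ⁻¹ᵁ U from le_rfl) (tmul s t)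
  have e2 := pc_pb (f := f) (g := g) rfl (V := f ⁻¹ᵁ g ⁻¹ᵁ U) le_rfl
    (show f ⁻¹ᵁ g ⁻¹ᵁ U ≤ (f ≫ g) ⁻¹ᵁ U from le_rfl) s
  have e3 := pc_pb (f := f) (g := g) rfl (V := f ⁻¹ᵁ g ⁻¹ᵁ U) le_rfl
    (show f ⁻¹ᵁ g ⁻¹ᵁ U ≤ (f ≫ g) ⁻¹ᵁ U from le_rfl) t
  rw [res_self (le_refl (f ⁻¹ᵁ g ⁻¹ᵁ U))] at e1 e2 e3
  have h1 := map_pb f (pbT g M N) (pb g (tmul s t))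
  rw [pbT_pb] at h1
  have h2 := pbT_pb f (pb g s) (pb g t)
  have h3 := tensorMap_app (pc (f := f) (g := g) rfl M).hom (pc (f := f) (g := g) rfl N).hom
    (pb f (pb g s)) (pb f (pb g t))
  rw [pbT_pb, comp_app_apply, comp_app_apply, comp_app_apply]
  refine Eq.symm ?_
  have e1' : (pc (f := f) (g := g) rfl (tensor M N)).inv.app ((f ≫ g) ⁻¹ᵁ U) (pb (f ≫ g) (tmul s t)) =
    pb f (pb g (tmul s t)) := (congrArg _ (res_self _ _).symm).trans e1
  refine (congrArg _ (congrArg _ (congrArg _ e1'))).trans ?_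
  refine (congrArg _ (congrArg _ h1)).trans ((congrArg _ h2).trans (h3.trans ?_))
  rw [e2, e3]
  exact congrArg₂ tmul (res_self _ _) (res_self _ _)
end
end
end SimplicialPic

namespace SimplicialPic
noncomputable section
open Scheme.Modules (pullback pushforward pullbackPushforwardAdjunction pullbackComp)

section
variable {X : Scheme.{u}} {M N K M' N' K' : X.Modules} {U V : X.Opens}

/-- The symmetry of the tensor product. -/
def tensorSwap (M N : X.Modules) : tensor M N ⟶ tensor N M :=
  tensorLift (fun U => LinearMap.mk₂ Γ(X, U) (fun s t => tmul t s)
    (fun _ _ _ => tmul_add_right _ _ _) (fun _ _ _ => smul_tmul_right _ _ _)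
    (fun _ _ _ => tmul_add_left _ _ _) (fun _ _ _ => smul_tmul_left _ _ _))
    (fun _ _ h s t => by simp only [LinearMap.mk₂_apply, res_tmul])

lemma tensorSwap_tmul (s : Γ(M, U)) (t : Γ(N, U)) :
    (tensorSwap M N).app U (tmul s t) = tmul t s := by
  exact tensorLift_tmul _ _ s t

/-- The symmetry isomorphism of the tensor product. -/
def tensorComm (M N : X.Modules) : tensor M N ≅ tensor N M where
  hom := tensorSwap M N
  inv := tensorSwap N M
  hom_inv_id := tensor_hom_ext _ _ fun U s t => by
    rw [comp_app_apply, tensorSwap_tmul, tensorSwap_tmul]; rfl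
  inv_hom_id := tensor_hom_ext _ _ fun U s t => by
    rw [comp_app_apply, tensorSwap_tmul, tensorSwap_tmul]; rfl

/-- The action map `𝒪 ⊗ M → M`. -/
def unitTensor (M : X.Modules) : tensor (unitM X) M ⟶ M :=
  tensorLift (M := unitM X) (fun U => LinearMap.mk₂ Γ(X, U) (fun (r : Γ(X, U)) t => r • t)
    (fun r r' t => add_smul (R := Γ(X, U)) r r' t) (fun r r' t => mul_smul (α := Γ(X, U)) r r' t)
    (fun r t t' => smul_add (M := Γ(X, U)) r t t') (fun r r' t => smul_comm (M := Γ(X, U)) r' r t))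
    (fun _ _ h s t => res_smul h s t)

lemma unitTensor_one (t : Γ(M, U)) : (unitTensor M).app U (tmul (one U) t) = t := by
  exact (tensorLift_tmul _ _ (one U) t).trans (one_smul Γ(X, U) t)

lemma unitTensor_isIso (hM : IsLineBundle M) : IsIso (unitTensor M) := by
  refine isIso_of_isGen _ fun x => ?_
  obtain ⟨U, s, hx, hs⟩ := hM x
  exact ⟨U, _, hx, (isGen_one U).tmul hs, by rwa [unitTensor_one]⟩

lemma unitTensor_hom_ext (φ ψ : tensor (unitM X) M ⟶ N)
    (H : ∀ (U : X.Opens) (t : Γ(M, U)), φ.app U (tmul (one U) t) = ψ.app U (tmul (one U) t)) :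
    φ = ψ := by
  refine tensor_hom_ext _ _ fun U r t => ?_
  obtain ⟨r, rfl⟩ := (isGen_one U).exists_smul r
  rw [smul_tmul_left, Scheme.Modules.Hom.app_smul, Scheme.Modules.Hom.app_smul, H]

lemma exists_gen₃ (hM : IsLineBundle M) (hN : IsLineBundle N) (hK : IsLineBundle K) (x : X)
    (hx : x ∈ U) :
    ∃ (V : X.Opens) (_ : V ≤ U) (s : Γ(M, V)) (t : Γ(N, V)) (r : Γ(K, V)),
      x ∈ V ∧ IsGen s ∧ IsGen t ∧ IsGen r := by
  obtain ⟨A, hA, s, hxA, hs⟩ := hM.exists_le hx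
  obtain ⟨B, hB, t, hxB, ht⟩ := hN.exists_le hxA
  obtain ⟨C, hC, r, hxC, hr⟩ := hK.exists_le hxB
  exact ⟨C, hC.trans (hB.trans hA), res (hC.trans hB) s, res hC t, r, hxC, hs.res _, ht.res _, hr⟩

lemma exists_assoc (hM : IsLineBundle M) (hN : IsLineBundle N) (hK : IsLineBundle K) :
    ∃ φ : tensor (tensor M N) K ⟶ tensor M (tensor N K),
      ∀ (U : X.Opens) (s : Γ(M, U)) (t : Γ(N, U)) (r : Γ(K, U)),
        φ.app U (tmul (tmul s t) r) = tmul s (tmul t r) := by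
  obtain ⟨φ, hφ⟩ := exists_hom_of_rel (M := tensor (tensor M N) K) (N := tensor M (tensor N K))
    (fun U x y => ∃ s t r, IsGen s ∧ IsGen t ∧ IsGen r ∧ x = tmul (tmul s t) r ∧
      y = tmul s (tmul t r))
    (by rintro U _ _ ⟨s, t, r, hs, ht, hr, rfl, rfl⟩; exact (hs.tmul ht).tmul hr)
    (by
      rintro U V h _ _ ⟨s, t, r, hs, ht, hr, rfl, rfl⟩
      exact ⟨_, _, _, hs.res h, ht.res h, hr.res h, by simp only [res_tmul], by
        simp only [res_tmul]⟩)
    (by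
      rintro U _ _ _ _ c ⟨s, t, r, hs, ht, hr, rfl, rfl⟩ ⟨s', t', r', -, -, -, rfl, rfl⟩ e
      obtain ⟨a, rfl⟩ := hs.exists_smul s'
      obtain ⟨b, rfl⟩ := ht.exists_smul t'
      obtain ⟨d, rfl⟩ := hr.exists_smul r'
      simp only [smul_tmul_left, smul_tmul_right, smul_smul] at e ⊢
      rw [← ((hs.tmul ht).tmul hr).eq_of_smul e]
      congr 1
      ring)
    (by
      intro x
      obtain ⟨V, -, s, t, r, hxV, hs, ht, hr⟩ := exists_gen₃ (U := ⊤) hM hN hK x trivial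
      exact ⟨V, _, _, hxV, s, t, r, hs, ht, hr, rfl, rfl⟩)
  refine ⟨φ, fun U s t r => res_ext _ _ fun x hx => ?_⟩
  obtain ⟨V, h, s', t', r', hxV, hs, ht, hr⟩ := exists_gen₃ hM hN hK x hx
  refine ⟨V, h, hxV, ?_⟩
  obtain ⟨a, ha⟩ := hs.exists_smul (res h s)
  obtain ⟨b, hb⟩ := ht.exists_smul (res h t)
  obtain ⟨d, hd⟩ := hr.exists_smul (res h r)
  rw [← app_res]
  simp only [res_tmul, ha, hb, hd, smul_tmul_left, smul_tmul_right, Scheme.Modules.Hom.app_smul]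
  rw [hφ V _ _ ⟨s', t', r', hs, ht, hr, rfl, rfl⟩]

/-- The associativity morphism for line bundles. -/
def assoc (hM : IsLineBundle M) (hN : IsLineBundle N) (hK : IsLineBundle K) :
    tensor (tensor M N) K ⟶ tensor M (tensor N K) := (exists_assoc hM hN hK).choose

lemma assoc_tmul (hM : IsLineBundle M) (hN : IsLineBundle N) (hK : IsLineBundle K)
    (s : Γ(M, U)) (t : Γ(N, U)) (r : Γ(K, U)) :
    (assoc hM hN hK).app U (tmul (tmul s t) r) = tmul s (tmul t r) :=
  (exists_assoc hM hN hK).choose_spec U s t r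

lemma assoc_isIso (hM : IsLineBundle M) (hN : IsLineBundle N) (hK : IsLineBundle K) :
    IsIso (assoc hM hN hK) := by
  refine isIso_of_isGen _ fun x => ?_
  obtain ⟨V, -, s, t, r, hxV, hs, ht, hr⟩ := exists_gen₃ (U := ⊤) hM hN hK x trivial
  refine ⟨V, _, hxV, (hs.tmul ht).tmul hr, ?_⟩
  rw [assoc_tmul]
  exact hs.tmul (ht.tmul hr)

lemma tensor₃_hom_ext (hM : IsLineBundle M) (hN : IsLineBundle N) (hK : IsLineBundle K)
    (φ ψ : tensor (tensor M N) K ⟶ K')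
    (H : ∀ (U : X.Opens) (s : Γ(M, U)) (t : Γ(N, U)) (r : Γ(K, U)),
      φ.app U (tmul (tmul s t) r) = ψ.app U (tmul (tmul s t) r)) : φ = ψ := by
  refine hom_ext_isGen _ _ fun x => ?_
  obtain ⟨V, -, s, t, r, hxV, hs, ht, hr⟩ := exists_gen₃ (U := ⊤) hM hN hK x trivial
  exact ⟨V, _, hxV, (hs.tmul ht).tmul hr, H V s t r⟩

lemma tensorMap_left_cancel (hM : IsLineBundle M) (hN : IsLineBundle N) (α : M ≅ M')
    (β β' : N ≅ N') (e : tensorMap α.hom β.hom = tensorMap α.hom β'.hom) : β = β' := by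
  ext1
  refine hom_ext_isGen _ _ fun x => ?_
  obtain ⟨V, -, s, t, -, hxV, hs, ht, -⟩ := exists_gen₃ (U := ⊤) hM hN hN x trivial
  refine ⟨V, t, hxV, ht, ?_⟩
  have h := congr(($e).app V (tmul s t))
  rw [tensorMap_app, tensorMap_app] at h
  have h1 := hs.app_iso α.hom
  have h2 := ht.app_iso β.hom
  obtain ⟨r, hr⟩ := h2.exists_smul (β'.hom.app V t)
  rw [hr, smul_tmul_right, ← one_smul Γ(X, V) (tmul _ _)] at h
  have h3 := (h1.tmul h2).eq_of_smul (r := 1) (r' := r) (by simpa using h)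
  rw [hr, ← h3, one_smul]

lemma exists_tensorMap_eq (hM : IsLineBundle M) (hN : IsLineBundle N) (hN' : IsLineBundle N')
    (α : M ≅ M') (T : tensor M N ≅ tensor M' N') :
    ∃ β : N ≅ N', tensorMap α.hom β.hom = T.hom := by
  have loc (x : X) : ∃ (V : X.Opens) (s : Γ(M, V)) (t : Γ(N, V)) (t' : Γ(N', V)), x ∈ V ∧
      IsGen s ∧ IsGen t ∧ IsGen t' ∧ T.hom.app V (tmul s t) = tmul (α.hom.app V s) t' := by
    obtain ⟨V, -, s, t, t', hxV, hs, ht, ht'⟩ := exists_gen₃ (U := ⊤) hM hN hN' x trivial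
    have h1 := hs.app_iso α.hom
    have h2 := (hs.tmul ht).app_iso T.hom
    obtain ⟨r, hr⟩ := (h1.tmul ht').exists_smul (T.hom.app V (tmul s t))
    refine ⟨V, s, t, r • t', hxV, hs, ht, ?_, by rw [hr, smul_tmul_right]⟩
    obtain ⟨q, hq⟩ := h2.exists_smul (tmul (α.hom.app V s) t')
    rw [hr, smul_smul] at hq
    have h3 : 1 = q * r := (h1.tmul ht').eq_of_smul (by rwa [one_smul])
    intro W hW
    have h4 : resR hW q * resR hW r = 1 := by
      have := congrArg (resR hW) h3
      simpa [resR] using this.symm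
    rw [res_smul]
    refine ⟨fun a b e => ?_, fun y => ?_⟩
    · simp only [smul_smul] at e
      have := (ht'.res hW).eq_of_smul e
      calc a = a * resR hW r * resR hW q := by rw [mul_assoc, mul_comm (resR hW r), h4, mul_one]
        _ = b := by rw [this, mul_assoc, mul_comm (resR hW r), h4, mul_one]
    · obtain ⟨a, rfl⟩ := (ht'.res hW).exists_smul y
      exact ⟨a * resR hW q, by simp only [smul_smul]; rw [mul_assoc, h4, mul_one]⟩
  obtain ⟨β, hβ⟩ := exists_hom_of_rel (M := N) (N := N')
    (fun V t t' => ∃ s : Γ(M, V), IsGen s ∧ IsGen t ∧ IsGen t' ∧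
      T.hom.app V (tmul s t) = tmul (α.hom.app V s) t')
    (by rintro U t t' ⟨s, -, ht, -⟩; exact ht)
    (by
      rintro U V h t t' ⟨s, hs, ht, ht', e⟩
      refine ⟨res h s, hs.res h, ht.res h, ht'.res h, ?_⟩
      rw [← res_tmul, app_res, e, res_tmul, app_res])
    (by
      rintro U t t' q q' r ⟨s, hs, ht, ht', e⟩ ⟨p, hp, -, -, e'⟩ rfl
      obtain ⟨a, rfl⟩ := hs.exists_smul p
      obtain ⟨b, rfl⟩ := ht'.exists_smul q'
      obtain ⟨c, hc⟩ := hp.exists_smul s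
      rw [smul_smul] at hc
      have hca : 1 = c * a := hs.eq_of_smul (by rwa [one_smul])
      simp only [smul_tmul_left, smul_tmul_right, Scheme.Modules.Hom.app_smul, e, smul_smul] at e'
      have h2 := ((hs.app_iso α.hom).tmul ht').eq_of_smul e'
      have h3 : b = r := by
        linear_combination b * hca - r * hca - c * h2
      rw [h3])
    (by
      intro x
      obtain ⟨V, s, t, t', hxV, hs, ht, ht', e⟩ := loc x
      exact ⟨V, t, t', hxV, s, hs, ht, ht', e⟩)
  have : IsIso β := isIso_of_isGen _ fun x => by
    obtain ⟨V, s, t, t', hxV, hs, ht, ht', e⟩ := loc x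
    exact ⟨V, t, hxV, ht, by rwa [hβ V t t' ⟨s, hs, ht, ht', e⟩]⟩
  refine ⟨asIso β, hom_ext_isGen _ _ fun x => ?_⟩
  obtain ⟨V, s, t, t', hxV, hs, ht, ht', e⟩ := loc x
  refine ⟨V, _, hxV, hs.tmul ht, ?_⟩
  rw [tensorMap_app, e, asIso_hom, hβ V t t' ⟨s, hs, ht, ht', e⟩]
end
end
end SimplicialPic

namespace SimplicialPic
noncomputable section

section
variable {X : Scheme.{u}}

/-- Sections over `U` of the dual of `L`: compatible families of linear functionals on the
sections of `L` over the open subsets of `U`. -/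
def dualSections (L : X.Modules) (U : X.Opens) :
    AddSubgroup (∀ V : {V : X.Opens // V ≤ U}, Γ(L, V.1) → Γ(unitM X, V.1)) where
  carrier := {l | (∀ V a b, l V (a + b) = l V a + l V b) ∧
    (∀ V (r : Γ(X, V.1)) a, l V (r • a) = r • l V a) ∧
    (∀ (V W : X.Opens) (h : V ≤ U) (h' : W ≤ V) a,
      l ⟨W, h'.trans h⟩ (res h' a) = res h' (l ⟨V, h⟩ a))}
  zero_mem' := ⟨fun _ _ _ => (add_zero _).symm, fun _ _ _ => (smul_zero _).symm,
    fun _ _ _ _ _ => (res_zero _).symm⟩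
  add_mem' := by
    rintro l l' ⟨h1, h2, h3⟩ ⟨h1', h2', h3'⟩
    refine ⟨fun V a b => ?_, fun V r a => ?_, fun V W h h' a => ?_⟩
    · simp only [Pi.add_apply, h1, h1']; abel
    · simp only [Pi.add_apply, h2, h2', smul_add]
    · simp only [Pi.add_apply, res_add]
      rw [h3 V W h h' a, h3' V W h h' a]
  neg_mem' := by
    rintro l ⟨h1, h2, h3⟩
    refine ⟨fun V a b => ?_, fun V r a => ?_, fun V W h h' a => ?_⟩
    · simp only [Pi.neg_apply, h1]; abel
    · simp only [Pi.neg_apply, h2, smul_neg]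
    · simp only [Pi.neg_apply, ← zero_sub, res_sub, res_zero]
      rw [h3 V W h h' a]

variable {L : X.Modules} {U V W : X.Opens}

instance : SMul Γ(X, U) (dualSections L U) where
  smul r l := ⟨fun V a => resR V.2 r • l.1 V a, by
    obtain ⟨l, h1, h2, h3⟩ := l
    refine ⟨fun V a b => ?_, fun V r a => ?_, fun V W h h' a => ?_⟩
    · simp only [h1, smul_add]
    · simp only [h2, smul_smul, mul_comm]
    · simp only [res_smul, resR_res]
      rw [h3 V W h h' a]⟩

lemma dual_smul_apply (r : Γ(X, U)) (l : dualSections L U) (V : X.Opens) (h : V ≤ U) (a : Γ(L, V)) :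
    (r • l).1 ⟨V, h⟩ a = resR h r • l.1 ⟨V, h⟩ a := rfl

instance : Module Γ(X, U) (dualSections L U) where
  one_smul l := Subtype.ext (funext fun V => funext fun a => by
    rw [dual_smul_apply]; simp [resR])
  mul_smul r r' l := Subtype.ext (funext fun V => funext fun a => by
    rw [dual_smul_apply]; simp only [resR, map_mul, mul_smul]; rfl)
  smul_zero r := Subtype.ext (funext fun V => funext fun a => smul_zero _)
  smul_add r l l' := Subtype.ext (funext fun V => funext fun a => smul_add _ _ _)
  add_smul r r' l := Subtype.ext (funext fun V => funext fun a => by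
    rw [dual_smul_apply]; simp only [resR, map_add, add_smul]; rfl)
  zero_smul l := Subtype.ext (funext fun V => funext fun a => by
    rw [dual_smul_apply]; simp [resR])

/-- Restriction of functionals. -/
def dualRes (h : V ≤ U) : dualSections L U →+ dualSections L V where
  toFun l := ⟨fun W a => l.1 ⟨W.1, W.2.trans h⟩ a,
    fun _ _ _ => l.2.1 _ _ _, fun _ _ _ => l.2.2.1 _ _ _, fun _ _ _ _ _ => l.2.2.2 _ _ _ _ _⟩
  map_zero' := rfl
  map_add' _ _ := rfl

/-- The underlying presheaf of the dual. -/
def dualPresheaf (L : X.Modules) : TopCat.Presheaf Ab.{u} X where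
  obj U := AddCommGrpCat.of (dualSections L U.unop)
  map i := AddCommGrpCat.ofHom (dualRes i.unop.le)
  map_id _ := rfl
  map_comp _ _ := rfl

lemma dualPresheaf_isSheaf (L : X.Modules) : (dualPresheaf L).IsSheaf := by
  rw [TopCat.Presheaf.isSheaf_iff_isSheaf_comp (forget Ab)]
  apply TopCat.Presheaf.isSheaf_of_isSheafUniqueGluing_types
  intro ι B sf hsf
  change ∀ i, dualSections L (B i) at sf
  have compat (i j : ι) (W : X.Opens) (hi : W ≤ B i) (hj : W ≤ B j) (a : Γ(L, W)) :
      (sf i).1 ⟨W, hi⟩ a = (sf j).1 ⟨W, hj⟩ a := by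
    have h := hsf i j
    exact congrFun (congrFun (congrArg Subtype.val h) ⟨W, le_inf hi hj⟩) a
  have key (V : X.Opens) (hV : V ≤ iSup B) (a : Γ(L, V)) : ∃ b : Γ(unitM X, V),
      ∀ W (h : W ≤ V) i (hi : W ≤ B i), res h b = (sf i).1 ⟨W, hi⟩ (res h a) := by
    obtain ⟨b, hb⟩ := res_glue (M := unitM X) (U := V)
      (fun W b => ∃ (h : W ≤ V) (i : ι) (hi : W ≤ B i), b = (sf i).1 ⟨W, hi⟩ (res h a))
      (by
        rintro V' W h _ ⟨h', i, hi, rfl⟩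
        exact ⟨h.trans h', i, h.trans hi, by rw [← (sf i).2.2.2, res_res]⟩)
      (by
        rintro W _ _ ⟨h, i, hi, rfl⟩ ⟨_, j, hj, rfl⟩
        exact compat _ _ _ _ _ _)
      (by
        intro x hx
        obtain ⟨i, hi⟩ := Opens.mem_iSup.1 (hV hx)
        exact ⟨V ⊓ B i, inf_le_left, ⟨hx, hi⟩, _, inf_le_left, i, inf_le_right, rfl⟩)
    exact ⟨b, fun W h i hi => hb W h _ ⟨h, i, hi, rfl⟩⟩
  have ext' (V : X.Opens) (hV : V ≤ iSup B) (b b' : Γ(unitM X, V))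
      (H : ∀ W (h : W ≤ V) i, W ≤ B i → res h b = res h b') : b = b' := by
    refine res_ext _ _ fun x hx => ?_
    obtain ⟨i, hi⟩ := Opens.mem_iSup.1 (hV hx)
    exact ⟨V ⊓ B i, inf_le_left, ⟨hx, hi⟩, H _ _ i inf_le_right⟩
  choose l hl using key
  refine ⟨(⟨fun V a => l V.1 V.2 a, ?_, ?_, ?_⟩ : dualSections L (iSup B)), fun i => ?_, fun l' hl' => ?_⟩
  · rintro ⟨V, hV⟩ a b
    refine ext' V hV _ _ fun W h i hi => ?_
    rw [res_add, hl V hV _ W h i hi, hl V hV _ W h i hi, hl V hV _ W h i hi, res_add,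
      (sf i).2.1]
  · rintro ⟨V, hV⟩ r a
    refine ext' V hV _ _ fun W h i hi => ?_
    rw [res_smul, hl V hV _ W h i hi, hl V hV _ W h i hi, res_smul, (sf i).2.2.1]
  · intro V V' hV hV' a
    refine ext' V' (hV'.trans hV) _ _ fun W h i hi => ?_
    rw [hl _ _ _ W h i hi, res_res, res_res, hl _ _ _ W _ i hi]
  · refine Subtype.ext (funext fun ⟨V, h⟩ => funext fun a => ?_)
    have := hl V (h.trans (le_iSup B i)) a V le_rfl i h
    rw [res_self, res_self] at this
    exact this
  · change dualSections L (iSup B) at l'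
    refine Subtype.ext (funext fun ⟨V, h⟩ => funext fun a => ?_)
    refine ext' V h _ _ fun W h' i hi => ?_
    rw [hl V h a W h' i hi, ← l'.2.2.2]
    exact congrFun (congrFun (congrArg Subtype.val (hl' i)) ⟨W, hi⟩) _

/-- The dual `𝓗om(L, 𝒪_X)`. -/
def dual (L : X.Modules) : X.Modules where
  val :=
    { obj := fun U => ModuleCat.of Γ(X, U.unop) (dualSections L U.unop)
      map := fun {U V} i => ModuleCat.ofHom (R := Γ(X, U.unop))
        (Y := (ModuleCat.restrictScalars (X.presheaf.map i).hom).obj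
          (ModuleCat.of Γ(X, V.unop) (dualSections L V.unop)))
        { toFun := dualRes i.unop.le
          map_add' := map_add _
          map_smul' := fun r l => Subtype.ext (funext fun W => funext fun a => 
            congrArg (· • l.1 ⟨W.1, W.2.trans i.unop.le⟩ a) (resR_res i.unop.le W.2 r).symm) }
      map_id := fun _ => rfl
      map_comp := fun _ _ => rfl }
  isSheaf := dualPresheaf_isSheaf L

/-- Evaluation of a functional. -/
def dualEv (l : Γ(dual L, U)) (a : Γ(L, U)) : Γ(unitM X, U) :=
  (show dualSections L U from l).1 ⟨U, le_rfl⟩ a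

lemma dual_ext (l l' : Γ(dual L, U)) (H : ∀ (V : X.Opens) (h : V ≤ U) (a : Γ(L, V)),
    dualEv (res h l) a = dualEv (res h l') a) : l = l' :=
  Subtype.ext (a1 := (show dualSections L U from l)) (funext fun ⟨V, h⟩ => funext fun a => H V h a)

lemma res_dualEv (h : V ≤ U) (l : Γ(dual L, U)) (a : Γ(L, U)) :
    res h (dualEv l a) = dualEv (res h l) (res h a) :=
  ((show dualSections L U from l).2.2.2 U V le_rfl h a).symm

lemma dualEv_smul_left (r : Γ(X, U)) (l : Γ(dual L, U)) (a : Γ(L, U)) :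
    dualEv (r • l) a = r • dualEv l a :=
  (dual_smul_apply r (show dualSections L U from l) U le_rfl a).trans (by rw [resR_self]; rfl)

lemma dualEv_smul_right (r : Γ(X, U)) (l : Γ(dual L, U)) (a : Γ(L, U)) :
    dualEv l (r • a) = r • dualEv l a :=
  (show dualSections L U from l).2.2.1 _ _ _

lemma dualEv_add_left (l l' : Γ(dual L, U)) (a : Γ(L, U)) :
    dualEv (l + l') a = dualEv l a + dualEv l' a := rfl

lemma dualEv_add_right (l : Γ(dual L, U)) (a b : Γ(L, U)) :
    dualEv l (a + b) = dualEv l a + dualEv l b :=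
  (show dualSections L U from l).2.1 _ _ _

lemma exists_dual_gen {s : Γ(L, U)} (hs : IsGen s) :
    ∃ l : Γ(dual L, U), IsGen l ∧ dualEv l s = one U := by
  have key (V : X.Opens) (h : V ≤ U) (a : Γ(L, V)) := (hs.res h).exists_smul a
  choose c hc using key
  have huniq (V : X.Opens) (h : V ≤ U) (a : Γ(L, V)) (r : Γ(X, V)) (e : a = r • res h s) :
      c V h a = r := (hs.res h).eq_of_smul ((hc V h a).symm.trans e)
  let l : dualSections L U := ⟨fun V a => c V.1 V.2 a • one V.1, by
    refine ⟨fun V a b => ?_, fun V r a => ?_, fun V W h h' a => ?_⟩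
    · beta_reduce
      rw [← add_smul, huniq V.1 V.2 (a + b) (c V.1 V.2 a + c V.1 V.2 b) ?_]
      rw [add_smul, ← hc, ← hc]
    · beta_reduce
      rw [smul_smul, huniq V.1 V.2 (r • a) (r * c V.1 V.2 a) ?_]
      rw [mul_smul, ← hc]
    · simp only
      rw [res_smul, res_one, huniq W (h'.trans h) (res h' a) (resR h' (c V h a)) ?_]
      conv_lhs => rw [hc V h a, res_smul, res_res]⟩
  obtain ⟨l', hl'⟩ : ∃ l' : Γ(dual L, U), l' = l := ⟨l, rfl⟩
  have hl (V : X.Opens) (h : V ≤ U) : dualEv (res h l') (res h s) = one V := by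
    subst hl'
    change c V h (res h s) • one V = one V
    rw [huniq V h (res h s) 1 (one_smul _ _).symm, one_smul]
  refine ⟨l', fun V h => ⟨fun r r' e => ?_, fun m => ?_⟩, ?_⟩
  · have := congrArg (fun m => dualEv m (res h s)) e
    simp only [dualEv_smul_left, hl] at this
    exact (isGen_one V).eq_of_smul this
  · obtain ⟨r, hr⟩ := (isGen_one V).exists_smul (dualEv m (res h s))
    refine ⟨r, dual_ext _ _ fun W hW a => ?_⟩
    obtain ⟨q, rfl⟩ := (hs.res (hW.trans h)).exists_smul a
    rw [dualEv_smul_right, dualEv_smul_right, res_smul, dualEv_smul_left, res_res, hl,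
      ← res_res h hW, ← res_dualEv, hr, res_smul, res_one]
  · have := hl U le_rfl
    rwa [res_self, res_self] at this

/-- The evaluation pairing. -/
def evMap (L : X.Modules) : tensor L (dual L) ⟶ unitM X :=
  tensorLift (fun U => LinearMap.mk₂ Γ(X, U) (fun a l => dualEv l a)
    (fun _ _ _ => dualEv_add_right _ _ _) (fun _ _ _ => dualEv_smul_right _ _ _)
    (fun _ _ _ => dualEv_add_left _ _ _) (fun _ _ _ => dualEv_smul_left _ _ _))
    (fun _ _ h a l => res_dualEv h l a)

lemma evMap_tmul (a : Γ(L, U)) (l : Γ(dual L, U)) : (evMap L).app U (tmul a l) = dualEv l a :=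
  tensorLift_tmul _ _ a l

lemma IsLineBundle.dual (hL : IsLineBundle L) : IsLineBundle (dual L) := by
  intro x
  obtain ⟨U, s, hx, hs⟩ := hL x
  obtain ⟨l, hl, -⟩ := exists_dual_gen hs
  exact ⟨U, l, hx, hl⟩

lemma evMap_isIso (hL : IsLineBundle L) : IsIso (evMap L) := by
  refine isIso_of_isGen _ fun x => ?_
  obtain ⟨U, s, hx, hs⟩ := hL x
  obtain ⟨l, hl, e⟩ := exists_dual_gen hs
  exact ⟨U, _, hx, hs.tmul hl, by rw [evMap_tmul, e]; exact isGen_one U⟩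
end
end
end SimplicialPic

namespace SimplicialPic
noncomputable section
open Scheme.Modules (pullback pushforward pullbackPushforwardAdjunction pullbackComp)

section
variable {W X Y Z : Scheme.{u}}

lemma pb_hom_ext₂ (f : X ⟶ Y) (g : Y ⟶ Z) {M : Z.Modules} {N : X.Modules}
    (φ ψ : (pullback f).obj ((pullback g).obj M) ⟶ N)
    (H : ∀ (U : Z.Opens) (s : Γ(M, U)), φ.app _ (pb f (pb g s)) = ψ.app _ (pb f (pb g s))) :
    φ = ψ := by
  apply ((pullbackPushforwardAdjunction f).homEquiv _ _).injective
  rw [Adjunction.homEquiv_unit, Adjunction.homEquiv_unit]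
  exact pb_hom_ext g _ _ H

lemma pb_hom_ext₃ (f' : W ⟶ X) (f : X ⟶ Y) (g : Y ⟶ Z) {M : Z.Modules} {N : W.Modules}
    (φ ψ : (pullback f').obj ((pullback f).obj ((pullback g).obj M)) ⟶ N)
    (H : ∀ (U : Z.Opens) (s : Γ(M, U)),
      φ.app _ (pb f' (pb f (pb g s))) = ψ.app _ (pb f' (pb f (pb g s)))) :
    φ = ψ := by
  apply ((pullbackPushforwardAdjunction f').homEquiv _ _).injective
  rw [Adjunction.homEquiv_unit, Adjunction.homEquiv_unit]
  exact pb_hom_ext₂ f g _ _ H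

lemma pc_naturality {f : X ⟶ Y} {g : Y ⟶ Z} {h : X ⟶ Z} (e : f ≫ g = h) {M N : Z.Modules}
    (φ : M ⟶ N) :
    (pullback f).map ((pullback g).map φ) ≫ (pc e N).hom =
      (pc e M).hom ≫ (pullback h).map φ := by
  subst e
  simpa [pc, Scheme.Modules.pullbackCongr] using (pullbackComp f g).hom.naturality φ

lemma pc_rfl_pb (f : X ⟶ Y) (g : Y ⟶ Z) {M : Z.Modules} {U : Z.Opens} (s : Γ(M, U)) :
    (pc (f := f) (g := g) rfl M).hom.app (f ⁻¹ᵁ g ⁻¹ᵁ U) (pb f (pb g s)) = pb (f ≫ g) s := by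
  have := pc_pb (f := f) (g := g) rfl (V := f ⁻¹ᵁ g ⁻¹ᵁ U) le_rfl
    (show f ⁻¹ᵁ g ⁻¹ᵁ U ≤ (f ≫ g) ⁻¹ᵁ U from le_rfl) s
  rw [res_self] at this
  exact this.trans (res_self _ _)

lemma pc_assoc {f' : W ⟶ X} {f : X ⟶ Y} {g : Y ⟶ Z} {h : X ⟶ Z} {m : W ⟶ Y} {k : W ⟶ Z}
    (e : f ≫ g = h) (E : f' ≫ h = k) (e2 : f' ≫ f = m) (E2 : m ≫ g = k) (M : Z.Modules) :
    (pullback f').map (pc e M).hom ≫ (pc E M).hom = (pc e2 ((pullback g).obj M)).hom ≫ (pc E2 M).hom := by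
  subst e e2 E
  refine pb_hom_ext₃ f' f g _ _ fun U s => ?_
  rw [comp_app_apply, comp_app_apply]
  have h1 := map_pb f' (pc (f := f) (g := g) rfl M).hom (pb f (pb g s))
  rw [pc_rfl_pb] at h1
  have h2 := pc_rfl_pb f' (f ≫ g) s
  have h3 := pc_rfl_pb f' f (pb g s)
  have h4 := pc_rfl_pb (f' ≫ f) g s
  exact ((congrArg _ h1).trans h2).trans ((congrArg _ h3).trans h4).symm

/-- The pull-back along `f` of an isomorphism `g^* L ≅ g'^* L'`, as an isomorphism between the
pull-backs along the composites `h = f ≫ g` and `h' = f ≫ g'`. -/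
def pull (f : X ⟶ Y) {Z' : Scheme.{u}} {g : Y ⟶ Z} {g' : Y ⟶ Z'} {h : X ⟶ Z} {h' : X ⟶ Z'}
    {L : Z.Modules} {L' : Z'.Modules}
    (α : (pullback g).obj L ≅ (pullback g').obj L') (e : f ≫ g = h) (e' : f ≫ g' = h') :
    (pullback h).obj L ≅ (pullback h').obj L' :=
  (pc e L).symm ≪≫ (pullback f).mapIso α ≪≫ pc e' L'

section
variable {Z' Z'' : Scheme.{u}} {f : X ⟶ Y} {g : Y ⟶ Z} {g' : Y ⟶ Z'} {g'' : Y ⟶ Z''}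
  {h : X ⟶ Z} {h' : X ⟶ Z'} {h'' : X ⟶ Z''}
  {L M : Z.Modules} {L' M' : Z'.Modules} {L'' M'' : Z''.Modules}

lemma pull_trans (α : (pullback g).obj L ≅ (pullback g').obj L')
    (β : (pullback g').obj L' ≅ (pullback g'').obj L'')
    (e : f ≫ g = h) (e' : f ≫ g' = h') (e'' : f ≫ g'' = h'') :
    pull f (α ≪≫ β) e e'' = pull f α e e' ≪≫ pull f β e' e'' := by
  ext1; simp [pull]

lemma pull_symm (α : (pullback g).obj L ≅ (pullback g').obj L')
    (e : f ≫ g = h) (e' : f ≫ g' = h') :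
    pull f α.symm e' e = (pull f α e e').symm := by
  ext1; simp [pull]

lemma pull_map (φ : L ≅ M) (e : f ≫ g = h) :
    pull f ((pullback g).mapIso φ) e e = (pullback h).mapIso φ := by
  ext1
  simp [pull, pc_naturality]

lemma pull_pull {f' : W ⟶ X} {m : W ⟶ Y} {k : W ⟶ Z} {k' : W ⟶ Z'}
    (α : (pullback g).obj L ≅ (pullback g').obj L')
    (e : f ≫ g = h) (e' : f ≫ g' = h') (E : f' ≫ h = k) (E' : f' ≫ h' = k')
    (e2 : f' ≫ f = m) (E2 : m ≫ g = k) (E2' : m ≫ g' = k') :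
    pull f' (pull f α e e') E E' = pull m α E2 E2' := by
  ext1
  have h1 := pc_assoc e E e2 E2 L
  have h2 := pc_assoc e' E' e2 E2' L'
  have h3 := pc_naturality e2 α.hom
  simp only [pull, Iso.trans_hom, Iso.symm_hom, Functor.mapIso_hom, Functor.map_comp,
    Category.assoc]
  rw [Iso.inv_comp_eq, h2, reassoc_of% h3]
  have h4 : (pullback f').map (pc e L).inv = (pc E L).hom ≫ (pc E2 L).inv ≫ (pc e2 _).inv := by
    rw [← cancel_epi ((pullback f').map (pc e L).hom), ← Functor.map_comp, Iso.hom_inv_id,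
      reassoc_of% h1]
    simp
  rw [h4]
  simp

/-- Tensor product of isomorphisms `g^* L ≅ g'^* L'` and `g^* M ≅ g'^* M'`. -/
def ten (hL : IsLineBundle L) (hM : IsLineBundle M) (hL' : IsLineBundle L') (hM' : IsLineBundle M')
    (α : (pullback g).obj L ≅ (pullback g').obj L')
    (β : (pullback g).obj M ≅ (pullback g').obj M') :
    (pullback g).obj (tensor L M) ≅ (pullback g').obj (tensor L' M') :=
  pbTIso g hL hM ≪≫ tensorIso α β ≪≫ (pbTIso g' hL' hM').symm

lemma ten_hom (hL : IsLineBundle L) (hM : IsLineBundle M) (hL' : IsLineBundle L')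
    (hM' : IsLineBundle M')
    (α : (pullback g).obj L ≅ (pullback g').obj L')
    (β : (pullback g).obj M ≅ (pullback g').obj M') :
    (ten hL hM hL' hM' α β).hom ≫ pbT g' L' M' = pbT g L M ≫ tensorMap α.hom β.hom := by
  have h : (pbTIso g' hL' hM').inv ≫ pbT g' L' M' = 𝟙 _ := (pbTIso g' hL' hM').inv_hom_id
  simp [ten, tensorIso, h]

lemma eq_ten (hL : IsLineBundle L) (hM : IsLineBundle M) (hL' : IsLineBundle L')
    (hM' : IsLineBundle M')
    (α : (pullback g).obj L ≅ (pullback g').obj L')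
    (β : (pullback g).obj M ≅ (pullback g').obj M')
    (T : (pullback g).obj (tensor L M) ≅ (pullback g').obj (tensor L' M'))
    (H : T.hom ≫ pbT g' L' M' = pbT g L M ≫ tensorMap α.hom β.hom) :
    T = ten hL hM hL' hM' α β := by
  ext1
  rw [← cancel_mono (pbTIso g' hL' hM').hom, pbTIso_hom, H, ten_hom]

lemma pull_ten (hL : IsLineBundle L) (hM : IsLineBundle M) (hL' : IsLineBundle L')
    (hM' : IsLineBundle M')
    (α : (pullback g).obj L ≅ (pullback g').obj L')
    (β : (pullback g).obj M ≅ (pullback g').obj M') (e : f ≫ g = h) (e' : f ≫ g' = h') :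
    pull f (ten hL hM hL' hM' α β) e e' =
      ten hL hM hL' hM' (pull f α e e') (pull f β e e') := by
  apply eq_ten
  rw [← cancel_epi (pc e _).hom, reassoc_of% (pbT_pc e), ← tensorMap_comp]
  simp only [pull, Iso.trans_hom, Iso.symm_hom, Functor.mapIso_hom,
    Category.assoc, Iso.hom_inv_id_assoc]
  rw [pbT_pc e', ← Functor.map_comp_assoc, ten_hom, Functor.map_comp_assoc,
    reassoc_of% (pbT_naturality f), ← tensorMap_comp]

lemma ten_trans (hL : IsLineBundle L) (hM : IsLineBundle M) (hL' : IsLineBundle L')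
    (hM' : IsLineBundle M') (hL'' : IsLineBundle L'') (hM'' : IsLineBundle M'')
    (α : (pullback g).obj L ≅ (pullback g').obj L')
    (β : (pullback g).obj M ≅ (pullback g').obj M')
    (α' : (pullback g').obj L' ≅ (pullback g'').obj L'')
    (β' : (pullback g').obj M' ≅ (pullback g'').obj M'') :
    ten hL hM hL'' hM'' (α ≪≫ α') (β ≪≫ β') =
      ten hL hM hL' hM' α β ≪≫ ten hL' hM' hL'' hM'' α' β' := by
  symm
  apply eq_ten
  simp only [Iso.trans_hom, Category.assoc, ten_hom, tensorMap_comp]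
  rw [reassoc_of% (ten_hom hL hM hL' hM' α β)]

lemma ten_map {N K : Z.Modules} (hL : IsLineBundle L) (hM : IsLineBundle M) (hN : IsLineBundle N)
    (hK : IsLineBundle K) (φ : L ≅ N) (ψ : M ≅ K) :
    (pullback g).mapIso (tensorIso φ ψ) =
      ten hL hM hN hK ((pullback g).mapIso φ) ((pullback g).mapIso ψ) := by
  apply eq_ten
  exact pbT_naturality g φ.hom ψ.hom

/-- The canonical isomorphism `g^* 𝒪 ≅ g'^* 𝒪`. -/
def uni (g : Y ⟶ Z) (g' : Y ⟶ Z') :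
    (pullback g).obj (unitM Z) ≅ (pullback g').obj (unitM Z') :=
  asIso (pbUnit g) ≪≫ (asIso (pbUnit g')).symm

lemma eq_uni (T : (pullback g).obj (unitM Z) ≅ (pullback g').obj (unitM Z'))
    (H : T.hom ≫ pbUnit g' = pbUnit g) : T = uni g g' := by
  ext1
  rw [← cancel_mono (pbUnit g'), H]
  simp [uni]

lemma uni_hom (g : Y ⟶ Z) (g' : Y ⟶ Z') : (uni g g').hom ≫ pbUnit g' = pbUnit g := by
  simp [uni]

lemma pbUnit_pc (e : f ≫ g = h) :
    (pc e (unitM Z)).hom ≫ pbUnit h = (pullback f).map (pbUnit g) ≫ pbUnit f := by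
  subst e
  refine pb_hom_ext₂ f g _ _ fun U s => ?_
  obtain ⟨r, rfl⟩ := (isGen_one U).exists_smul s
  rw [pb_smul, pb_smul, Scheme.Modules.Hom.app_smul, Scheme.Modules.Hom.app_smul]
  congr 1
  rw [comp_app_apply, comp_app_apply]
  have h1 := map_pb f (pbUnit g) (pb g (one U))
  rw [pbUnit_pb] at h1
  exact ((congrArg _ (pc_rfl_pb f g (one U))).trans (pbUnit_pb (f ≫ g) U)).trans
    ((congrArg _ h1).trans (pbUnit_pb f _)).symm

lemma pull_uni (e : f ≫ g = h) (e' : f ≫ g' = h') : pull f (uni g g') e e' = uni h h' := by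
  apply eq_uni
  rw [← cancel_epi (pc e _).hom]
  simp only [pull, Iso.trans_hom, Iso.symm_hom, Functor.mapIso_hom,
    Category.assoc, Iso.hom_inv_id_assoc, pbUnit_pc]
  rw [← Functor.map_comp_assoc, uni_hom]

lemma uni_trans (g : Y ⟶ Z) (g' : Y ⟶ Z') (g'' : Y ⟶ Z'') :
    uni g g' ≪≫ uni g' g'' = uni g g'' := by
  apply eq_uni
  simp [uni_hom]
end

/-- An isomorphism between pull-backs of `L`, `L'` regarded as an isomorphism between iterated
pull-backs. -/
def base {Y' : Scheme.{u}} {Z' : Scheme.{u}} {p : X ⟶ Y} {p' : X ⟶ Y'} {q : Y ⟶ Z} {q' : Y' ⟶ Z'}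
    {h : X ⟶ Z} {h' : X ⟶ Z'}
    {L : Z.Modules} {L' : Z'.Modules} (α : (pullback h).obj L ≅ (pullback h').obj L')
    (e : p ≫ q = h) (e' : p' ≫ q' = h') :
    (pullback p).obj ((pullback q).obj L) ≅ (pullback p').obj ((pullback q').obj L') :=
  pc e L ≪≫ α ≪≫ (pc e' L').symm

section
variable {Y' Y'' Z' Z'' : Scheme.{u}} {p : X ⟶ Y} {p' : X ⟶ Y'} {p'' : X ⟶ Y''}
  {q : Y ⟶ Z} {q' : Y' ⟶ Z'} {q'' : Y'' ⟶ Z''} {h : X ⟶ Z} {h' : X ⟶ Z'} {h'' : X ⟶ Z''}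
  {L M : Z.Modules} {L' M' : Z'.Modules} {L'' : Z''.Modules}

lemma base_trans (α : (pullback h).obj L ≅ (pullback h').obj L')
    (β : (pullback h').obj L' ≅ (pullback h'').obj L'')
    (e : p ≫ q = h) (e' : p' ≫ q' = h') (e'' : p'' ≫ q'' = h'') :
    base (α ≪≫ β) e e'' = base α e e' ≪≫ base β e' e'' := by
  ext1; simp [base]

lemma base_map (φ : L ≅ M) (e : p ≫ q = h) :
    base ((pullback h).mapIso φ) e e = (pullback p).mapIso ((pullback q).mapIso φ) := by
  ext1
  simp only [base, Iso.trans_hom, Iso.symm_hom, Functor.mapIso_hom]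
  rw [← reassoc_of% (pc_naturality e φ.hom)]
  simp

lemma pull_base {f : W ⟶ X} {m : W ⟶ Y} {m' : W ⟶ Y'} {k : W ⟶ Z} {k' : W ⟶ Z'}
    (α : (pullback h).obj L ≅ (pullback h').obj L')
    (e : p ≫ q = h) (e' : p' ≫ q' = h') (em : f ≫ p = m) (em' : f ≫ p' = m')
    (E : m ≫ q = k) (E' : m' ≫ q' = k') (ek : f ≫ h = k) (ek' : f ≫ h' = k') :
    pull f (base α e e') em em' = base (pull f α ek ek') E E' := by
  ext1
  have h1 := pc_assoc e ek em E L
  have h2 := pc_assoc e' ek' em' E' L'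
  rw [← cancel_mono (pc E' L').hom, ← cancel_epi (pc em _).hom]
  simp only [pull, base, Iso.trans_hom, Iso.symm_hom, Functor.mapIso_hom, Functor.map_comp,
    Category.assoc, Iso.hom_inv_id_assoc, Iso.inv_hom_id, Category.comp_id]
  rw [← h2, ← reassoc_of% h1, ← Functor.map_comp_assoc (pullback f) (pc e' L').inv]
  simp

lemma base_ten (hL : IsLineBundle L) (hM : IsLineBundle M) (hL' : IsLineBundle L')
    (hM' : IsLineBundle M')
    (α : (pullback h).obj L ≅ (pullback h').obj L')
    (β : (pullback h).obj M ≅ (pullback h').obj M') (e : p ≫ q = h) (e' : p' ≫ q' = h') :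
    base (ten hL hM hL' hM' α β) e e' ≪≫ (pullback p').mapIso (pbTIso q' hL' hM') =
      (pullback p).mapIso (pbTIso q hL hM) ≪≫
        ten (hL.pullback q) (hM.pullback q) (hL'.pullback q') (hM'.pullback q')
          (base α e e') (base β e e') := by
  ext1
  rw [← cancel_mono (pbTIso p' (hL'.pullback q') (hM'.pullback q')).hom, pbTIso_hom,
    ← cancel_mono (tensorIso (pc e' L') (pc e' M')).hom]
  have h1 := pbT_pc e L M
  have h2 := pbT_pc e' L' M'
  simp only [Iso.trans_hom, Category.assoc, Functor.mapIso_hom, pbTIso_hom]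
  rw [reassoc_of% (ten_hom (hL.pullback q) (hM.pullback q) (hL'.pullback q') (hM'.pullback q')
          (base α e e') (base β e e'))]
  simp only [tensorIso]
  rw [← h2]
  simp only [base, Iso.trans_hom, Category.assoc, Iso.symm_hom, Iso.inv_hom_id_assoc]
  rw [ten_hom, reassoc_of% h1]
  simp only [← tensorMap_comp, Category.assoc, Iso.inv_hom_id, Category.comp_id]

lemma base_uni (e : p ≫ q = h) (e' : p' ≫ q' = h') :
    base (uni h h') e e' ≪≫ (pullback p').mapIso (asIso (pbUnit q')) =
      (pullback p).mapIso (asIso (pbUnit q)) ≪≫ uni p p' := by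
  ext1
  rw [← cancel_mono (pbUnit p')]
  simp only [base, Iso.trans_hom, Category.assoc, Iso.symm_hom, Functor.mapIso_hom, asIso_hom,
    ← pbUnit_pc e', Iso.inv_hom_id_assoc, uni_hom, ← pbUnit_pc e]
end
end
end
end SimplicialPic

namespace SimplicialPic
noncomputable section
open Scheme.Modules (pullback pushforward pullbackPushforwardAdjunction pullbackComp)

section
variable {X Y Z Z' : Scheme.{u}} {g : Y ⟶ Z} {g' : Y ⟶ Z'}
  {L M N : Z.Modules} {L' M' N' : Z'.Modules}

lemma tensorSwap_naturality {A B A' B' : X.Modules} (φ : A ⟶ A') (ψ : B ⟶ B') :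
    tensorMap φ ψ ≫ tensorSwap A' B' = tensorSwap A B ≫ tensorMap ψ φ := by
  refine tensor_hom_ext _ _ fun U s t => ?_
  simp only [comp_app_apply, tensorMap_app, tensorSwap_tmul]

lemma pbT_swap (g : Y ⟶ Z) (L M : Z.Modules) :
    (pullback g).map (tensorSwap L M) ≫ pbT g M L = pbT g L M ≫ tensorSwap _ _ := by
  refine pbT_hom_ext g _ _ fun U s t => ?_
  simp only [comp_app_apply, map_pb, tensorSwap_tmul, pbT_pb]

lemma ten_comm (hL : IsLineBundle L) (hM : IsLineBundle M) (hL' : IsLineBundle L')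
    (hM' : IsLineBundle M')
    (α : (pullback g).obj L ≅ (pullback g').obj L')
    (β : (pullback g).obj M ≅ (pullback g').obj M') :
    ten hL hM hL' hM' α β ≪≫ (pullback g').mapIso (tensorComm L' M') =
      (pullback g).mapIso (tensorComm L M) ≪≫ ten hM hL hM' hL' β α := by
  ext1
  rw [← cancel_mono (pbTIso g' hM' hL').hom]
  simp only [Iso.trans_hom, Category.assoc, Functor.mapIso_hom, pbTIso_hom, tensorComm,
    pbT_swap, ten_hom]
  rw [reassoc_of% (ten_hom hL hM hL' hM' α β), tensorSwap_naturality, reassoc_of% (pbT_swap g)]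

lemma assoc_naturality {A B C A' B' C' : X.Modules} (hA : IsLineBundle A) (hB : IsLineBundle B)
    (hC : IsLineBundle C) (hA' : IsLineBundle A') (hB' : IsLineBundle B') (hC' : IsLineBundle C')
    (φ : A ⟶ A') (ψ : B ⟶ B') (χ : C ⟶ C') :
    tensorMap (tensorMap φ ψ) χ ≫ assoc hA' hB' hC' =
      assoc hA hB hC ≫ tensorMap φ (tensorMap ψ χ) := by
  refine tensor₃_hom_ext hA hB hC _ _ fun U s t r => ?_
  simp only [comp_app_apply, tensorMap_app, assoc_tmul]

lemma pbT_assoc (g : Y ⟶ Z) (hL : IsLineBundle L) (hM : IsLineBundle M) (hN : IsLineBundle N) :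
    (pullback g).map (assoc hL hM hN) ≫ pbT g L (tensor M N) ≫ tensorMap (𝟙 _) (pbT g M N) =
      pbT g (tensor L M) N ≫ tensorMap (pbT g L M) (𝟙 _) ≫
        assoc (hL.pullback g) (hM.pullback g) (hN.pullback g) := by
  apply ((pullbackPushforwardAdjunction g).homEquiv _ _).injective
  rw [Adjunction.homEquiv_unit, Adjunction.homEquiv_unit]
  refine tensor₃_hom_ext hL hM hN _ _ fun U s t r => ?_
  have h1 := map_pb g (assoc hL hM hN) (tmul (tmul s t) r)
  rw [assoc_tmul] at h1
  have h2 : (pbT g L (tensor M N)).app _ (pb g (tmul s (tmul t r))) = _ := pbT_pb g s (tmul t r)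
  have h3 : (pbT g (tensor L M) N).app _ (pb g (tmul (tmul s t) r)) = _ := pbT_pb g (tmul s t) r
  have hl : ((pullback g).map (assoc hL hM hN) ≫ pbT g L (tensor M N) ≫
      tensorMap (𝟙 _) (pbT g M N)).app _ (pb g (tmul (tmul s t) r)) =
      tmul (pb g s) (tmul (pb g t) (pb g r)) := by
    rw [comp_app_apply, comp_app_apply, h1, h2, tensorMap_app, pbT_pb]; rfl
  have hr : (pbT g (tensor L M) N ≫ tensorMap (pbT g L M) (𝟙 _) ≫
        assoc (hL.pullback g) (hM.pullback g) (hN.pullback g)).app _ (pb g (tmul (tmul s t) r)) =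
      tmul (pb g s) (tmul (pb g t) (pb g r)) := by
    rw [comp_app_apply, comp_app_apply, h3, tensorMap_app, pbT_pb]
    exact assoc_tmul _ _ _ _ _ _
  exact hl.trans hr.symm

/-- The associativity isomorphism for line bundles. -/
def assocIso (hL : IsLineBundle L) (hM : IsLineBundle M) (hN : IsLineBundle N) :
    tensor (tensor L M) N ≅ tensor L (tensor M N) :=
  haveI := assoc_isIso hL hM hN
  asIso (assoc hL hM hN)

lemma ten_assoc (hL : IsLineBundle L) (hM : IsLineBundle M) (hN : IsLineBundle N)
    (hL' : IsLineBundle L') (hM' : IsLineBundle M') (hN' : IsLineBundle N')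
    (α : (pullback g).obj L ≅ (pullback g').obj L')
    (β : (pullback g).obj M ≅ (pullback g').obj M')
    (γ : (pullback g).obj N ≅ (pullback g').obj N') :
    ten (hL.tensor hM) hN (hL'.tensor hM') hN' (ten hL hM hL' hM' α β) γ ≪≫
        (pullback g').mapIso (assocIso hL' hM' hN') =
      (pullback g).mapIso (assocIso hL hM hN) ≪≫
        ten hL (hM.tensor hN) hL' (hM'.tensor hN') α (ten hM hN hM' hN' β γ) := by
  ext1
  rw [← cancel_mono (pbTIso g' hL' (hM'.tensor hN')).hom,
    ← cancel_mono (tensorIso (Iso.refl _) (pbTIso g' hM' hN')).hom]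
  have h1 := pbT_assoc g hL hM hN
  have h2 := pbT_assoc g' hL' hM' hN'
  have t1 := ten_hom (hL.tensor hM) hN (hL'.tensor hM') hN' (ten hL hM hL' hM' α β) γ
  have t2 := ten_hom hL (hM.tensor hN) hL' (hM'.tensor hN') α (ten hM hN hM' hN' β γ)
  simp only [Iso.trans_hom, Category.assoc, Functor.mapIso_hom, pbTIso_hom, assocIso, asIso_hom,
    tensorIso, Iso.refl_hom]
  have a1 : tensorMap (ten hL hM hL' hM' α β).hom γ.hom ≫ tensorMap (pbT g' L' M') (𝟙 _) =
      tensorMap (pbT g L M) (𝟙 _) ≫ tensorMap (tensorMap α.hom β.hom) γ.hom := by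
    rw [← tensorMap_comp, ← tensorMap_comp, ten_hom, Category.comp_id, Category.id_comp]
  have a2 : tensorMap α.hom (ten hM hN hM' hN' β γ).hom ≫ tensorMap (𝟙 _) (pbT g' M' N') =
      tensorMap (𝟙 _) (pbT g M N) ≫ tensorMap α.hom (tensorMap β.hom γ.hom) := by
    rw [← tensorMap_comp, ← tensorMap_comp, ten_hom, Category.comp_id, Category.id_comp]
  rw [h2, reassoc_of% t1, reassoc_of% t2, reassoc_of% a1, a2, reassoc_of% h1,
    assoc_naturality (hL.pullback g) (hM.pullback g) (hN.pullback g)]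

lemma unitTensor_naturality {A A' : X.Modules} (φ : A ⟶ A') :
    tensorMap (𝟙 _) φ ≫ unitTensor A' = unitTensor A ≫ φ := by
  refine unitTensor_hom_ext _ _ fun U t => ?_
  rw [comp_app_apply, comp_app_apply, tensorMap_app, unitTensor_one]
  exact unitTensor_one _

lemma pbT_unitTensor (g : Y ⟶ Z) (L : Z.Modules) :
    (pullback g).map (unitTensor L) =
      pbT g (unitM Z) L ≫ tensorMap (pbUnit g) (𝟙 _) ≫ unitTensor _ := by
  apply ((pullbackPushforwardAdjunction g).homEquiv _ _).injective
  rw [Adjunction.homEquiv_unit, Adjunction.homEquiv_unit]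
  refine unitTensor_hom_ext _ _ fun U t => ?_
  have h1 := map_pb g (unitTensor L) (tmul (one U) t)
  rw [unitTensor_one] at h1
  have hr : (pbT g (unitM Z) L ≫ tensorMap (pbUnit g) (𝟙 _) ≫ unitTensor _).app _
      (pb g (tmul (one U) t)) = pb g t := by
    rw [comp_app_apply, comp_app_apply, pbT_pb, tensorMap_app, pbUnit_pb]
    exact unitTensor_one _
  exact h1.trans hr.symm

/-- The isomorphism `𝒪 ⊗ L ≅ L`. -/
def unitTensorIso (hL : IsLineBundle L) : tensor (unitM Z) L ≅ L :=
  haveI := unitTensor_isIso hL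
  asIso (unitTensor L)

lemma ten_unit (hL : IsLineBundle L) (hL' : IsLineBundle L')
    (α : (pullback g).obj L ≅ (pullback g').obj L') :
    ten (isLineBundle_unitM _) hL (isLineBundle_unitM _) hL' (uni g g') α ≪≫
        (pullback g').mapIso (unitTensorIso hL') =
      (pullback g).mapIso (unitTensorIso hL) ≪≫ α := by
  ext1
  simp only [Iso.trans_hom, Category.assoc, Functor.mapIso_hom, unitTensorIso, asIso_hom,
    pbT_unitTensor]
  rw [reassoc_of% (ten_hom (isLineBundle_unitM _) hL (isLineBundle_unitM _) hL' (uni g g') α),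
    ← unitTensor_naturality α.hom]
  have a : tensorMap (uni g g').hom α.hom ≫ tensorMap (pbUnit g') (𝟙 _) =
      tensorMap (pbUnit g) (𝟙 _) ≫ tensorMap (𝟙 _) α.hom := by
    rw [← tensorMap_comp, ← tensorMap_comp, uni_hom, Category.comp_id, Category.id_comp,
      Category.comp_id]
  rw [reassoc_of% a]

lemma ten_left_cancel (hL : IsLineBundle L) (hM : IsLineBundle M) (hL' : IsLineBundle L')
    (hM' : IsLineBundle M') (α : (pullback g).obj L ≅ (pullback g').obj L')
    (β β' : (pullback g).obj M ≅ (pullback g').obj M')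
    (h : ten hL hM hL' hM' α β = ten hL hM hL' hM' α β') : β = β' := by
  refine tensorMap_left_cancel (hL.pullback g) (hM.pullback g) α β β' ?_
  rw [← cancel_epi (pbTIso g hL hM).hom, pbTIso_hom, ← ten_hom hL hM hL' hM', h, ten_hom]

lemma exists_ten_eq (hL : IsLineBundle L) (hM : IsLineBundle M) (hL' : IsLineBundle L')
    (hM' : IsLineBundle M') (α : (pullback g).obj L ≅ (pullback g').obj L')
    (T : (pullback g).obj (tensor L M) ≅ (pullback g').obj (tensor L' M')) :
    ∃ β, ten hL hM hL' hM' α β = T := by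
  obtain ⟨β, h⟩ := exists_tensorMap_eq (hL.pullback g) (hM.pullback g) (hM'.pullback g') α
    ((pbTIso g hL hM).symm ≪≫ T ≪≫ pbTIso g' hL' hM')
  refine ⟨β, (eq_ten hL hM hL' hM' α β T ?_).symm⟩
  rw [h]
  exact ((pbTIso g hL hM).hom_inv_id_assoc _).symm

/-- The isomorphism `g^* L ≅ g'^* L'` induced by trivializations of `L` and `L'`. -/
def triUni (g : Y ⟶ Z) (g' : Y ⟶ Z') (e : L ≅ unitM Z) (e' : L' ≅ unitM Z') :
    (pullback g).obj L ≅ (pullback g').obj L' :=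
  (pullback g).mapIso e ≪≫ uni g g' ≪≫ ((pullback g').mapIso e').symm

lemma pull_triUni {f : X ⟶ Y} {h : X ⟶ Z} {h' : X ⟶ Z'} (e : L ≅ unitM Z) (e' : L' ≅ unitM Z')
    (E : f ≫ g = h) (E' : f ≫ g' = h') :
    pull f (triUni g g' e e') E E' = triUni h h' e e' := by
  rw [triUni, pull_trans _ _ E E E', pull_trans _ _ E E' E', pull_symm, pull_map, pull_map,
    pull_uni, triUni]

lemma triUni_trans {Z'' : Scheme.{u}} {L'' : Z''.Modules} (g : Y ⟶ Z) (g' : Y ⟶ Z') (g'' : Y ⟶ Z'')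
    (e : L ≅ unitM Z) (e' : L' ≅ unitM Z') (e'' : L'' ≅ unitM Z'') :
    triUni g g' e e' ≪≫ triUni g' g'' e' e'' = triUni g g'' e e'' := by
  ext1
  simp only [triUni, ← uni_trans g g' g'', Iso.trans_hom, Iso.symm_hom, Category.assoc,
    Iso.inv_hom_id_assoc]

lemma triUni_map (g : Y ⟶ Z) (g' : Y ⟶ Z') (e : L ≅ unitM Z) (e' : L' ≅ unitM Z') :
    triUni g g' e e' ≪≫ (pullback g').mapIso e' = (pullback g).mapIso e ≪≫ uni g g' := by
  ext1
  simp only [triUni, Iso.trans_hom, Iso.symm_hom, Category.assoc, Iso.inv_hom_id,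
    Category.comp_id]
end

section
variable {U₀ U₁ U₂ X₀ X₁ X₂ : Scheme.{u}} {j₀ : U₀ ⟶ X₀} {j₁ : U₁ ⟶ X₁} {j₂ : U₂ ⟶ X₂}
  {c₀ c₁ : X₁ ⟶ X₀} {v₀ v₁ : U₁ ⟶ U₀} {d₀ d₁ d₂ : X₂ ⟶ X₁} {u₀ u₁ u₂ : U₂ ⟶ U₁}
  {L M : X₀.Modules}

lemma pull_base_pull {d : X₂ ⟶ X₁} {w : U₂ ⟶ U₁} {a b : X₂ ⟶ X₀} {r t : U₂ ⟶ U₀}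
    (α : (pullback c₀).obj L ≅ (pullback c₁).obj L) (m₀ : v₀ ≫ j₀ = j₁ ≫ c₀)
    (m₁ : v₁ ≫ j₀ = j₁ ≫ c₁) (n : w ≫ j₁ = j₂ ≫ d) (ha : d ≫ c₀ = a) (hb : d ≫ c₁ = b)
    (hr : w ≫ v₀ = r) (ht : w ≫ v₁ = t) (er : r ≫ j₀ = j₂ ≫ a) (et : t ≫ j₀ = j₂ ≫ b) :
    pull w (base (pull j₁ α rfl rfl) m₀ m₁) hr ht = base (pull j₂ (pull d α ha hb) rfl rfl) er et := by
  subst ha hb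
  rw [pull_base _ m₀ m₁ hr ht er et (by rw [← Category.assoc, n, Category.assoc])
    (by rw [← Category.assoc, n, Category.assoc])]
  congr 1
  rw [pull_pull α _ _ _ _ n (by simp) (by simp), pull_pull α _ _ _ _ rfl (by simp) (by simp)]

lemma base_pull_cocycle (α : (pullback c₀).obj L ≅ (pullback c₁).obj L)
    (m₀ : v₀ ≫ j₀ = j₁ ≫ c₀) (m₁ : v₁ ≫ j₀ = j₁ ≫ c₁) (n₀ : u₀ ≫ j₁ = j₂ ≫ d₀)
    (n₁ : u₁ ≫ j₁ = j₂ ≫ d₁) (n₂ : u₂ ≫ j₁ = j₂ ≫ d₂)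
    (e₂₀ : d₂ ≫ c₀ = d₀ ≫ c₁) (e₁₀ : d₁ ≫ c₀ = d₀ ≫ c₀) (e₁₁ : d₁ ≫ c₁ = d₂ ≫ c₁)
    (f₂₀ : u₂ ≫ v₀ = u₀ ≫ v₁) (f₁₀ : u₁ ≫ v₀ = u₀ ≫ v₀) (f₁₁ : u₁ ≫ v₁ = u₂ ≫ v₁)
    (H : pull d₀ α rfl rfl ≪≫ pull d₂ α e₂₀ rfl = pull d₁ α e₁₀ e₁₁) :
    pull u₀ (base (pull j₁ α rfl rfl) m₀ m₁) rfl rfl ≪≫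
        pull u₂ (base (pull j₁ α rfl rfl) m₀ m₁) f₂₀ rfl =
      pull u₁ (base (pull j₁ α rfl rfl) m₀ m₁) f₁₀ f₁₁ := by
  have x₀₀ : (u₀ ≫ v₀) ≫ j₀ = j₂ ≫ d₀ ≫ c₀ := by
    rw [Category.assoc, m₀, ← Category.assoc, n₀, Category.assoc]
  have x₀₁ : (u₀ ≫ v₁) ≫ j₀ = j₂ ≫ d₀ ≫ c₁ := by
    rw [Category.assoc, m₁, ← Category.assoc, n₀, Category.assoc]
  have x₂₁ : (u₂ ≫ v₁) ≫ j₀ = j₂ ≫ d₂ ≫ c₁ := by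
    rw [Category.assoc, m₁, ← Category.assoc, n₂, Category.assoc]
  rw [pull_base_pull α m₀ m₁ n₀ rfl rfl rfl rfl x₀₀ x₀₁,
    pull_base_pull α m₀ m₁ n₂ e₂₀ rfl f₂₀ rfl x₀₁ x₂₁,
    pull_base_pull α m₀ m₁ n₁ e₁₀ e₁₁ f₁₀ f₁₁ x₀₀ x₂₁, ← H, ← base_trans, ← pull_trans]

lemma base_pull_congr (α : (pullback c₀).obj L ≅ (pullback c₁).obj L)
    (β : (pullback c₀).obj M ≅ (pullback c₁).obj M) (φ : L ≅ M)
    (m₀ : v₀ ≫ j₀ = j₁ ≫ c₀) (m₁ : v₁ ≫ j₀ = j₁ ≫ c₁)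
    (H : α ≪≫ (pullback c₁).mapIso φ = (pullback c₀).mapIso φ ≪≫ β) :
    base (pull j₁ α rfl rfl) m₀ m₁ ≪≫ (pullback v₁).mapIso ((pullback j₀).mapIso φ) =
      (pullback v₀).mapIso ((pullback j₀).mapIso φ) ≪≫ base (pull j₁ β rfl rfl) m₀ m₁ := by
  rw [← base_map φ m₀, ← base_map φ m₁, ← pull_map φ rfl, ← pull_map φ rfl, ← base_trans,
    ← base_trans, ← pull_trans, ← pull_trans, H]

lemma base_pull_ten (hL : IsLineBundle L) (hM : IsLineBundle M)
    (α : (pullback c₀).obj L ≅ (pullback c₁).obj L)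
    (β : (pullback c₀).obj M ≅ (pullback c₁).obj M)
    (m₀ : v₀ ≫ j₀ = j₁ ≫ c₀) (m₁ : v₁ ≫ j₀ = j₁ ≫ c₁) :
    base (pull j₁ (ten hL hM hL hM α β) rfl rfl) m₀ m₁ ≪≫
        (pullback v₁).mapIso (pbTIso j₀ hL hM) =
      (pullback v₀).mapIso (pbTIso j₀ hL hM) ≪≫
        ten (hL.pullback j₀) (hM.pullback j₀) (hL.pullback j₀) (hM.pullback j₀)
          (base (pull j₁ α rfl rfl) m₀ m₁) (base (pull j₁ β rfl rfl) m₀ m₁) := by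
  rw [pull_ten, base_ten]
end

/-! ### Line bundles on simplicial schemes -/

section
variable (X : SimplicialObject Scheme.{u})

lemma δ₂₀ : X.δ (2 : Fin 3) ≫ X.δ (0 : Fin 2) = X.δ (0 : Fin 3) ≫ X.δ (1 : Fin 2) :=
  X.δ_comp_δ (n := 0) (i := 0) (j := 1) (by decide)
lemma δ₁₀ : X.δ (1 : Fin 3) ≫ X.δ (0 : Fin 2) = X.δ (0 : Fin 3) ≫ X.δ (0 : Fin 2) :=
  X.δ_comp_δ (n := 0) (i := 0) (j := 0) (by decide)
lemma δ₁₁ : X.δ (1 : Fin 3) ≫ X.δ (1 : Fin 2) = X.δ (2 : Fin 3) ≫ X.δ (1 : Fin 2) :=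
  (X.δ_comp_δ (n := 0) (i := 1) (j := 1) (by decide)).symm

/-- A line bundle on a simplicial scheme: a line bundle `L` on `X₀` together with an isomorphism
`α : δ₀^* L ≅ δ₁^* L` on `X₁` such that `δ₂^* α ∘ δ₀^* α = δ₁^* α` on `X₂`. The canonical
identifications `δᵢ^* δⱼ^* L ≅ (δᵢ ≫ δⱼ)^* L` are part of `pull`. -/
structure SLineBundle where
  L : (X _⦋0⦌).Modules
  isLineBundle : IsLineBundle L
  α : (pullback (X.δ (0 : Fin 2))).obj L ≅ (pullback (X.δ (1 : Fin 2))).obj L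
  cocycle : pull (X.δ (0 : Fin 3)) α rfl rfl ≪≫ pull (X.δ (2 : Fin 3)) α (δ₂₀ X) rfl =
    pull (X.δ (1 : Fin 3)) α (δ₁₀ X) (δ₁₁ X)

variable {X}

/-- Isomorphism of line bundles on a simplicial scheme: an isomorphism of the line bundles on `X₀`
compatible with the isomorphisms on `X₁`. -/
def SLineBundle.Iso (A B : SLineBundle X) : Prop :=
  ∃ φ : A.L ≅ B.L, A.α ≪≫ (pullback (X.δ (1 : Fin 2))).mapIso φ =
    (pullback (X.δ (0 : Fin 2))).mapIso φ ≪≫ B.α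

variable (X) in
instance SLineBundle.setoid : Setoid (SLineBundle X) where
  r := SLineBundle.Iso
  iseqv :=
    { refl A := ⟨Iso.refl _, by ext1; simp⟩
      symm := by
        rintro A B ⟨φ, h⟩
        refine ⟨φ.symm, ?_⟩
        ext1
        have h1 := congr(($h).hom)
        simp only [Iso.trans_hom, Functor.mapIso_hom, Iso.symm_hom] at h1 ⊢
        rw [← cancel_epi ((pullback (X.δ (0 : Fin 2))).map φ.hom), ← reassoc_of% h1,
          ← Functor.map_comp, ← Functor.map_comp_assoc]
        simp
      trans := by
        rintro A B C ⟨φ, h⟩ ⟨ψ, k⟩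
        refine ⟨φ ≪≫ ψ, ?_⟩
        ext1
        have h1 := congr(($h).hom)
        have k1 := congr(($k).hom)
        simp only [Iso.trans_hom, Functor.mapIso_hom] at h1 k1 ⊢
        rw [Functor.map_comp, Functor.map_comp, reassoc_of% h1, k1, Category.assoc] }

namespace SLineBundle

/-- The tensor product. -/
def mul (A B : SLineBundle X) : SLineBundle X where
  L := tensor A.L B.L
  isLineBundle := A.isLineBundle.tensor B.isLineBundle
  α := ten A.isLineBundle B.isLineBundle A.isLineBundle B.isLineBundle A.α B.α
  cocycle := by
    simp only [pull_ten, ← ten_trans, A.cocycle, B.cocycle]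

variable (X) in
/-- The trivial line bundle. -/
def triv : SLineBundle X where
  L := unitM _
  isLineBundle := isLineBundle_unitM _
  α := uni _ _
  cocycle := by
    simp only [pull_uni, uni_trans]

lemma mul_congr {A A' B B' : SLineBundle X} (h : A ≈ A') (k : B ≈ B') : A.mul B ≈ A'.mul B' := by
  obtain ⟨φ, h⟩ := h
  obtain ⟨ψ, k⟩ := k
  refine ⟨tensorIso φ ψ, ?_⟩
  have t (i : Fin 2) := ten_map (g := X.δ i) A.isLineBundle B.isLineBundle A'.isLineBundle
    B'.isLineBundle φ ψ
  refine ((congrArg (_ ≪≫ ·) (t 1)).trans ?_).trans (congrArg (· ≪≫ _) (t 0)).symm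
  simp only [mul, ← ten_trans, h, k]

lemma mul_comm' (A B : SLineBundle X) : A.mul B ≈ B.mul A :=
  ⟨tensorComm _ _, ten_comm _ _ _ _ _ _⟩

lemma mul_assoc' (A B C : SLineBundle X) : (A.mul B).mul C ≈ A.mul (B.mul C) :=
  ⟨assocIso A.isLineBundle B.isLineBundle C.isLineBundle, ten_assoc _ _ _ _ _ _ _ _ _⟩

lemma triv_mul (A : SLineBundle X) : (triv X).mul A ≈ A :=
  ⟨unitTensorIso A.isLineBundle, ten_unit _ _ _⟩

lemma exists_inv (A : SLineBundle X) : ∃ B : SLineBundle X, A.mul B ≈ triv X := by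
  have hL := A.isLineBundle
  have hD := hL.dual
  have := evMap_isIso hL
  let e : tensor A.L (dual A.L) ≅ unitM _ := asIso (evMap A.L)
  obtain ⟨β, hβ⟩ := exists_ten_eq hL hD hL hD A.α (triUni (X.δ (0 : Fin 2)) (X.δ (1 : Fin 2)) e e)
  refine ⟨⟨dual A.L, hD, β, ?_⟩, e, ?_⟩
  · refine ten_left_cancel hL hD hL hD (pull (X.δ (1 : Fin 3)) A.α (δ₁₀ X) (δ₁₁ X)) _ _ ?_
    rw [← pull_ten, hβ, ← A.cocycle, ten_trans hL hD hL hD hL hD, ← pull_ten, ← pull_ten, hβ,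
      pull_triUni, pull_triUni, pull_triUni, triUni_trans]
  · exact (congrArg (· ≪≫ _) hβ).trans (triUni_map _ _ e e)
end SLineBundle

variable (X) in
/-- The Picard group of a simplicial scheme: isomorphism classes of line bundles. -/
def Pic : Type _ := Quotient (SLineBundle.setoid X)

namespace Pic

/-- The class of a line bundle. -/
def mk (A : SLineBundle X) : Pic X := Quotient.mk _ A

lemma mk_eq {A B : SLineBundle X} : mk A = mk B ↔ A.Iso B := Quotient.eq

instance : Mul (Pic X) :=
  ⟨Quotient.map₂ SLineBundle.mul fun _ _ h _ _ k => SLineBundle.mul_congr h k⟩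

instance : One (Pic X) := ⟨mk (SLineBundle.triv X)⟩

lemma mk_mul (A B : SLineBundle X) : mk A * mk B = mk (A.mul B) := rfl

lemma exists_inv (a : Pic X) : ∃ b : Pic X, a * b = 1 := by
  induction a using Quotient.inductionOn with | h A => ?_
  obtain ⟨B, h⟩ := A.exists_inv
  exact ⟨mk B, Quotient.sound h⟩

instance : CommMonoid (Pic X) where
  mul_assoc a b c := by
    induction a, b, c using Quotient.inductionOn₃ with | h A B C => ?_
    exact Quotient.sound (A.mul_assoc' B C)
  mul_comm a b := by
    induction a, b using Quotient.inductionOn₂ with | h A B => ?_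
    exact Quotient.sound (A.mul_comm' B)
  one_mul a := by
    induction a using Quotient.inductionOn with | h A => ?_
    exact Quotient.sound A.triv_mul
  mul_one a := by
    induction a using Quotient.inductionOn with | h A => ?_
    exact Quotient.sound (Setoid.trans (A.mul_comm' _) A.triv_mul)

/-- Tensor product of line bundles makes the Picard group of a simplicial scheme a group. -/
instance : CommGroup (Pic X) where
  inv a := (exists_inv a).choose
  inv_mul_cancel a := (mul_comm _ _).trans (exists_inv a).choose_spec

end Pic

variable {U : SimplicialObject Scheme.{u}} (j : U ⟶ X)

/-- The pull-back of a line bundle along a morphism of simplicial schemes. -/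
def SLineBundle.pb (A : SLineBundle X) : SLineBundle U where
  L := (pullback (j.app (op ⦋0⦌))).obj A.L
  isLineBundle := A.isLineBundle.pullback _
  α := base (pull (j.app (op ⦋1⦌)) A.α rfl rfl) (SimplicialObject.δ_naturality j 0)
    (SimplicialObject.δ_naturality j 1)
  cocycle := by
    exact base_pull_cocycle A.α _ _ (SimplicialObject.δ_naturality j (0 : Fin 3))
      (SimplicialObject.δ_naturality j (1 : Fin 3)) (SimplicialObject.δ_naturality j (2 : Fin 3))
      (δ₂₀ X) (δ₁₀ X) (δ₁₁ X) (δ₂₀ U) (δ₁₀ U) (δ₁₁ U) A.cocycle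

lemma SLineBundle.pb_congr {A B : SLineBundle X} (h : A ≈ B) : A.pb j ≈ B.pb j := by
  obtain ⟨φ, h⟩ := h
  exact ⟨(pullback (j.app (op ⦋0⦌))).mapIso φ, base_pull_congr A.α B.α φ
    (SimplicialObject.δ_naturality j (0 : Fin 2)) (SimplicialObject.δ_naturality j (1 : Fin 2)) h⟩

attribute [local irreducible] base pull ten pbTIso tensor

lemma SLineBundle.pb_mul (A B : SLineBundle X) : (A.mul B).pb j ≈ (A.pb j).mul (B.pb j) := by
  have h := base_pull_ten A.isLineBundle B.isLineBundle A.α B.α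
      (SimplicialObject.δ_naturality j (0 : Fin 2)) (SimplicialObject.δ_naturality j (1 : Fin 2))
  exact ⟨pbTIso (j.app (op ⦋0⦌)) A.isLineBundle B.isLineBundle, h⟩

/-- The homomorphism `j^* : Pic X → Pic U` induced by a morphism of simplicial schemes. -/
def picMap : Pic X →* Pic U :=
  MonoidHom.mk' (Quotient.map (SLineBundle.pb j) fun _ _ h => SLineBundle.pb_congr j h) fun a b => by
    induction a, b using Quotient.inductionOn₂ with | h A B => ?_
    exact Quotient.sound (A.pb_mul j B)

lemma picMap_mk (A : SLineBundle X) : picMap j (Pic.mk A) = Pic.mk (A.pb j) := rfl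
end
end
end SimplicialPic

/-! Properness makes every X_p noetherian, and only the simplicial degrees 0, 1 and 2 matter. Let
(L, α) be a line bundle on U. As X_0 is regular and noetherian, L is the restriction of a line
bundle M on X_0 (`exists_extension`). Then α becomes an isomorphism over U_1 between the
restrictions of the two pull-backs of M to X_1, so it has an integral order at each point of the set
E of height-one points of X_1 outside U_1. E is finite (`finite_boundaryPoints`).

If all orders vanish, α extends to an isomorphism over X_1 (`exists_mapIso_eq`). The extension
satisfies the cocycle condition on X_2, because it does so on the dense open U_2 and restriction to
U_2 is faithful on maps of line bundles (`pullback_map_injective`). So (L, α) comes from X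
(`ExtRel.exists_pb`). Orders add up under tensor products (`ExtRel.mul`) and change sign under duals
(`ExtRel.exists_inv`). The vector of orders depends on the choice of M, so it is a relation between
Pic(U) and ℤ^E and not a map. The vectors that occur form a subgroup of ℤ^E, and this subgroup
surjects onto the cokernel of j^* (`group_fg_quotient_of_rel`).

Both extension results rest on one local fact (`exists_isUniformizer`): a rational function that is
not a unit at a point is already not a unit at some height-one generization, where powers of a
single prime element account for all orders. This holds because the stalks are factorial. To extend
L, one takes a maximal family of local sections of j_*L that differ pairwise by units and contains
the local generators of L. Factoriality gives one coefficient h that serves all members of the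
family near a given point (`exists_common_coef`), so a maximal family covers X_0. Its members
generate the desired line bundle.

Factoriality is the theorem of Auslander and Buchsbaum. Let x belong to a minimal system of
generators of the maximal ideal. Then x is prime, and by Nagata's argument it is enough to show that
a height-one prime p not containing x becomes principal after inverting x. There p is locally
principal by induction on the dimension, hence projective, and it inherits a finite free resolution
from R. So it is stably free of rank one, and a determinant produces a generator
(`isPrincipal_of_equiv`). -/

namespace SimplicialPic

/-! ### Regular local rings are domains -/

section RegularLocalRing
open IsLocalRing

lemma ringKrullDim_le_quotient_span_singleton {R : Type u} [CommRing R] [IsLocalRing R]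
    [IsNoetherianRing R] {x : R} (hx : x ∈ maximalIdeal R) :
    ringKrullDim R ≤ ringKrullDim (R ⧸ Ideal.span {x}) + 1 := by
  simpa using ringKrullDim_le_ringKrullDim_quotient_add_encard ({x} : Set R)
    (by simpa [IsLocalRing.ringJacobson_eq_maximalIdeal] using hx)

/-- Cutting a regular local ring by a member of a minimal system of generators of the maximal
ideal. -/
lemma isRegularLocalRing_quotient {R : Type u} [CommRing R] [IsRegularLocalRing R] {d : ℕ}
    {s : Finset R} (hs : Ideal.span (s : Set R) = maximalIdeal R) (hcard : s.card = d + 1)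
    (hd : ringKrullDim R = (d + 1 : ℕ)) {x : R} (hx : x ∈ s) :
    IsRegularLocalRing (R ⧸ Ideal.span {x}) ∧ ringKrullDim (R ⧸ Ideal.span {x}) = d := by
  classical
  have hxm : x ∈ maximalIdeal R := hs ▸ Ideal.subset_span hx
  have hnt : Nontrivial (R ⧸ Ideal.span {x}) := Ideal.Quotient.nontrivial_iff.mpr
    fun h => by
      have := (Ideal.span_singleton_le_iff_mem (maximalIdeal R)).mpr hxm
      exact (maximalIdeal.isMaximal R).ne_top (top_le_iff.mp (h ▸ this))
  have hloc : IsLocalRing (R ⧸ Ideal.span {x}) :=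
    IsLocalRing.of_surjective' _ Ideal.Quotient.mk_surjective
  have hmax : maximalIdeal (R ⧸ Ideal.span {x}) =
      Ideal.span (Ideal.Quotient.mk (Ideal.span {x}) '' ((s.erase x : Finset R) : Set R)) := by
    rw [← map_maximalIdeal_of_surjective _ Ideal.Quotient.mk_surjective, ← hs, Ideal.map_span]
    apply le_antisymm
    · rw [Ideal.span_le]
      rintro _ ⟨y, hy, rfl⟩
      by_cases h : y = x
      · subst h
        have : Ideal.Quotient.mk (Ideal.span {y}) y = 0 :=
          Ideal.Quotient.eq_zero_iff_mem.mpr (Ideal.mem_span_singleton_self y)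
        rw [this]; exact zero_mem _
      · exact Ideal.subset_span ⟨y, by simpa [h] using hy, rfl⟩
    · exact Ideal.span_mono (Set.image_mono (by simp))
  have hle : (maximalIdeal (R ⧸ Ideal.span {x})).spanFinrank ≤ d := by
    rw [hmax]
    refine (Submodule.spanFinrank_span_le_ncard_of_finite
      ((s.erase x).finite_toSet.image _)).trans ?_
    refine (Set.ncard_image_le (s.erase x).finite_toSet).trans ?_
    rw [Set.ncard_coe_finset, Finset.card_erase_of_mem hx, hcard]
    simp
  have hdim : (d : WithBot ℕ∞) ≤ ringKrullDim (R ⧸ Ideal.span {x}) := by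
    have h1 := ringKrullDim_le_quotient_span_singleton hxm
    rw [hd, Nat.cast_add, Nat.cast_one] at h1
    exact (ENat.WithBot.add_le_add_one_right_iff).mp h1
  -- The d elements other than x generate the maximal ideal of the quotient, and cutting by one
  -- element lowers the dimension by at most one.
  have hreg := IsRegularLocalRing.of_spanFinrank_maximalIdeal_le (R ⧸ Ideal.span {x})
    ((Nat.cast_le.mpr hle).trans hdim)
  refine ⟨hreg, le_antisymm ?_ hdim⟩
  rw [← hreg.spanFinrank_maximalIdeal]
  exact Nat.cast_le.mpr hle

lemma ne_zero_of_ringKrullDim_quotient {R : Type u} [CommRing R] {d : ℕ} {x : R}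
    (hd : ringKrullDim R = (d + 1 : ℕ)) (hdx : ringKrullDim (R ⧸ Ideal.span {x}) = d) : x ≠ 0 := by
  rintro rfl
  have h1 := ringKrullDim_eq_of_ringEquiv
    (RingEquiv.trans (Ideal.quotEquivOfEq (by simp)) (RingEquiv.quotientBot R) :
      R ⧸ Ideal.span {(0 : R)} ≃+* R)
  rw [hdx, hd] at h1
  have : d = d + 1 := by exact_mod_cast h1
  omega

/-- P is the bottom of a chain of primes of length d; the whole chain survives in the quotient by P.
-/
lemma exists_isPrime_ringKrullDim_quotient {R : Type u} [CommRing R] [Nontrivial R] {d : ℕ}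
    (hd : ringKrullDim R = d) : ∃ P : Ideal R, P.IsPrime ∧ (d : WithBot ℕ∞) ≤ ringKrullDim (R ⧸ P) := by
  have : Nonempty (PrimeSpectrum R) := inferInstance
  obtain ⟨l, hl⟩ := (Order.le_krullDim_iff (α := PrimeSpectrum R) (n := d)).mp hd.ge
  refine ⟨l.head.asIdeal, l.head.isPrime, ?_⟩
  rw [ringKrullDim_quotient, Order.le_krullDim_iff]
  refine ⟨⟨l.length, fun i => ⟨l i, ?_⟩, fun i => l.step i⟩, hl⟩
  exact l.monotone (Fin.zero_le i)

lemma exists_finset_span_maximalIdeal (R : Type u) [CommRing R] [h : IsRegularLocalRing R] {d : ℕ}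
    (hd : ringKrullDim R = d) : ∃ s : Finset R, Ideal.span (s : Set R) = maximalIdeal R ∧
      s.card = d := by
  obtain ⟨s, h1, h2⟩ := Submodule.FG.exists_span_finset_card_eq_spanFinrank
    (maximalIdeal R).fg_of_isNoetherianRing
  refine ⟨s, h2, ?_⟩
  have := h.spanFinrank_maximalIdeal
  rw [hd, ← h1] at this
  exact_mod_cast this

lemma isField_of_ringKrullDim_eq_zero {R : Type u} [CommRing R] [IsRegularLocalRing R]
    (hd : ringKrullDim R = 0) : IsField R := by
  obtain ⟨s, hs, hcard⟩ := exists_finset_span_maximalIdeal R (d := 0) (by simpa using hd)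
  rw [Finset.card_eq_zero] at hcard
  rw [isField_iff_maximalIdeal_eq, ← hs, hcard]
  simp

/-- A regular local ring is a domain. -/
theorem isDomain_of_ringKrullDim_eq (d : ℕ) : ∀ (R : Type u) [CommRing R] [IsRegularLocalRing R],
    ringKrullDim R = d → IsDomain R := by
  induction d with
  | zero =>
    intro R _ _ hd
    exact (isField_of_ringKrullDim_eq_zero (by simpa using hd)).isDomain
  | succ d ih =>
    intro R _ _ hd
    obtain ⟨s, hs, hcard⟩ := exists_finset_span_maximalIdeal R hd
    obtain ⟨P, hP, hPd⟩ := exists_isPrime_ringKrullDim_quotient hd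
    -- Otherwise P is the maximal ideal and R ⧸ P is a field, of dimension zero and not at least d +
    -- 1.
    obtain ⟨x, hxs, hxP⟩ : ∃ x ∈ s, x ∉ P := by
      by_contra! h
      have h1 : maximalIdeal R ≤ P := hs ▸ Ideal.span_le.mpr h
      have h2 : P = maximalIdeal R := le_antisymm (le_maximalIdeal hP.ne_top) h1
      subst h2
      have := ringKrullDim_eq_zero_of_isField
        ((Ideal.Quotient.maximal_ideal_iff_isField_quotient _).mp (maximalIdeal.isMaximal R))
      rw [this] at hPd
      have : d + 1 ≤ 0 := by exact_mod_cast hPd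
      omega
    obtain ⟨hreg, hdx⟩ := isRegularLocalRing_quotient hs hcard hd hxs
    have hdom := ih _ hdx
    have hxm : x ∈ maximalIdeal R := hs ▸ Ideal.subset_span hxs
    -- R ⧸ (x) is a domain of dimension d by induction. If a ∈ P were nonzero in it, its further
    -- quotient (R ⧸ P) ⧸ (x) would have dimension less than d. But R ⧸ P has dimension at least d +
    -- 1, and dividing by x costs at most one.
    have hle : P ≤ Ideal.span {x} := by
      intro a ha
      by_contra hax
      have hPloc : IsLocalRing (R ⧸ P) := IsLocalRing.of_surjective' _ Ideal.Quotient.mk_surjective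
      let y := Ideal.Quotient.mk P x
      have hy : y ∈ maximalIdeal (R ⧸ P) := by
        rw [← map_maximalIdeal_of_surjective _ Ideal.Quotient.mk_surjective]
        exact Ideal.mem_map_of_mem _ hxm
      have h1 := ringKrullDim_le_quotient_span_singleton hy
      let f : R ⧸ Ideal.span {x} →+* (R ⧸ P) ⧸ Ideal.span {y} :=
        Ideal.Quotient.lift _ ((Ideal.Quotient.mk _).comp (Ideal.Quotient.mk P)) (by
          intro b hb
          obtain ⟨c, rfl⟩ := Ideal.mem_span_singleton'.mp hb
          simp only [RingHom.comp_apply, map_mul]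
          refine mul_eq_zero_of_right _ ?_
          exact Ideal.Quotient.eq_zero_iff_mem.mpr (Ideal.mem_span_singleton_self y))
      have hf : Function.Surjective f := Ideal.Quotient.lift_surjective_of_surjective _ _
        (Ideal.Quotient.mk_surjective.comp Ideal.Quotient.mk_surjective)
      have h2 := ringKrullDim_succ_le_of_surjective f hf (r := Ideal.Quotient.mk _ a)
        (mem_nonZeroDivisors_of_ne_zero fun h => hax (Ideal.Quotient.eq_zero_iff_mem.mp h))
        (by simp [f, Ideal.Quotient.eq_zero_iff_mem.mpr ha])
      have h3 := (hPd.trans h1).trans h2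
      rw [hdx] at h3
      have : d + 1 ≤ d := by exact_mod_cast h3
      omega
    -- An element of P has the form c x with x ∉ P, so c ∈ P. Hence P = xP, and Nakayama's lemma
    -- applies.
    have hbot : P = ⊥ := by
      refine Submodule.eq_bot_of_le_smul_of_le_jacobson_bot (Ideal.span {x}) P
        P.fg_of_isNoetherianRing ?_ ?_
      · intro a ha
        obtain ⟨c, rfl⟩ := Ideal.mem_span_singleton'.mp (hle ha)
        have hc : c ∈ P := (hP.mem_or_mem ha).resolve_right hxP
        rw [mul_comm]
        exact Submodule.smul_mem_smul (Ideal.mem_span_singleton_self x) hc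
      · rw [Ideal.span_singleton_le_iff_mem, IsLocalRing.jacobson_eq_maximalIdeal _ bot_ne_top]
        exact hxm
    subst hbot
    exact IsDomain.of_bot_isPrime R

lemma exists_ringKrullDim_eq (R : Type u) [CommRing R] [h : IsRegularLocalRing R] :
    ∃ d : ℕ, ringKrullDim R = d := ⟨_, h.spanFinrank_maximalIdeal.symm⟩

theorem isDomain_of_isRegularLocalRing (R : Type u) [CommRing R] [IsRegularLocalRing R] :
    IsDomain R := by
  obtain ⟨d, hd⟩ := exists_ringKrullDim_eq R
  exact isDomain_of_ringKrullDim_eq d R hd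

end RegularLocalRing
-- Finite free resolutions and stably free ideals
section FiniteFreeResolution
open IsLocalRing

/-- `M` has a resolution of length `n` by finite free modules. -/
def HasFiniteFreeResolution (R : Type u) [CommRing R] (n : ℕ) :
    ∀ (M : Type u) [AddCommGroup M] [Module R M], Prop :=
  Nat.rec (fun M _ _ => Module.Free R M ∧ Module.Finite R M)
    (fun _ H M _ _ => ∃ (k : ℕ) (f : (Fin k → R) →ₗ[R] M), Function.Surjective f ∧
      H (LinearMap.ker f)) n

lemma HasFiniteFreeResolution.of_equiv {R : Type u} [CommRing R] {n : ℕ} {M M' : Type u}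
    [AddCommGroup M] [Module R M] [AddCommGroup M'] [Module R M']
    (h : HasFiniteFreeResolution R n M) (e : M ≃ₗ[R] M') : HasFiniteFreeResolution R n M' := by
  cases n with
  | zero =>
    obtain ⟨h1, h2⟩ := h
    exact ⟨Module.Free.of_equiv e, Module.Finite.equiv e⟩
  | succ n =>
    obtain ⟨k, f, hf, h⟩ := h
    refine ⟨k, e.toLinearMap ∘ₗ f, e.surjective.comp hf, ?_⟩
    rwa [LinearEquiv.ker_comp]

open Pointwise in
/-- Finite free resolutions lift along `R → R ⧸ (x)` when `x` is regular. -/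
lemma HasFiniteFreeResolution.of_quotSMulTop {R : Type u} [CommRing R] [IsLocalRing R]
    [IsNoetherianRing R] {x : R} (hx : x ∈ maximalIdeal R) (hreg : IsSMulRegular R x) (n : ℕ) :
    ∀ (N : Type u) [AddCommGroup N] [Module R N] [Module.Finite R N], IsSMulRegular N x →
      HasFiniteFreeResolution (R ⧸ Ideal.span {x}) n (QuotSMulTop x N) →
        HasFiniteFreeResolution R n N := by
  have hjac : x ∈ (⊥ : Ideal R).jacobson := by
    rwa [IsLocalRing.jacobson_eq_maximalIdeal _ bot_ne_top]
  induction n with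
  | zero =>
    intro N _ _ _ hN h
    have : Module.FinitePresentation R N := Module.finitePresentation_of_finite R N
    exact ⟨(Module.free_quotSMulTop_iff_free R N hjac hN).mp h.1, inferInstance⟩
  | succ n ih =>
    intro N _ _ _ hN h
    obtain ⟨k, f', hf', h⟩ := h
    let q : N →ₗ[R] QuotSMulTop x N := Submodule.mkQ _
    have hq : Function.Surjective q := Submodule.mkQ_surjective _
    let c : (Fin k → R) →ₗ[R] (Fin k → R ⧸ Ideal.span {x}) :=
      (Ideal.Quotient.mkₐ R (Ideal.span {x})).toLinearMap.compLeft (Fin k)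
    have hc : Function.Surjective c := fun w => by
      choose v hv using fun i => Ideal.Quotient.mk_surjective (w i)
      exact ⟨v, funext hv⟩
    obtain ⟨f, hf⟩ := Module.projective_lifting_property q (f'.restrictScalars R ∘ₗ c) hq
    have hf (v) : q (f v) = f' (c v) := LinearMap.congr_fun hf v
    have hqx (m : N) : q m = 0 ↔ ∃ m', m = x • m' := by
      rw [Submodule.mkQ_apply, Submodule.Quotient.mk_eq_zero,
        Submodule.mem_smul_pointwise_iff_exists]
      exact ⟨fun ⟨a, _, h⟩ => ⟨a, h.symm⟩, fun ⟨a, h⟩ => ⟨a, trivial, h.symm⟩⟩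
    have hcx (v : Fin k → R) : c v = 0 ↔ ∃ v', v = x • v' := by
      refine ⟨fun h => ?_, ?_⟩
      · have hv (i : Fin k) : ∃ a, v i = x * a := by
          have hi : Ideal.Quotient.mk (Ideal.span {x}) (v i) = 0 := congr_fun h i
          exact Ideal.mem_span_singleton.mp (Ideal.Quotient.eq_zero_iff_mem.mp hi)
        choose v' hv' using hv
        exact ⟨v', funext hv'⟩
      · rintro ⟨v', rfl⟩
        funext i
        exact Ideal.Quotient.eq_zero_iff_mem.mpr
          (Ideal.mul_mem_right _ _ (Ideal.mem_span_singleton_self x))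
    -- By Nakayama's lemma: modulo x the lift f becomes the given surjection f'.
    have hfs : Function.Surjective f := by
      apply f.surjective_of_surjective_comp_mkQ (Ideal.span {x})
        ((Ideal.span_singleton_le_iff_mem _).mpr hjac)
      rw [Submodule.ideal_span_singleton_smul x ⊤]
      have : q ∘ₗ f = f'.restrictScalars R ∘ₗ c := LinearMap.ext hf
      change Function.Surjective (q ∘ₗ f)
      rw [this]
      exact hf'.comp hc
    refine ⟨k, f, hfs, ih _ ?_ ?_⟩
    · intro a b hab
      refine Subtype.ext (funext fun i => hreg ?_)
      exact congr_fun (congrArg Subtype.val hab) i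
    · let g : LinearMap.ker f →ₗ[R] LinearMap.ker f' :=
        { toFun v := ⟨c v.1, by rw [LinearMap.mem_ker, ← hf, LinearMap.mem_ker.mp v.2, map_zero]⟩
          map_add' v w := Subtype.ext (map_add c v.1 w.1)
          map_smul' r v := Subtype.ext (map_smul c r v.1) }
      have hg : Function.Surjective g := by
        rintro ⟨w, hw⟩
        obtain ⟨v, rfl⟩ := hc w
        rw [LinearMap.mem_ker, ← hf, hqx] at hw
        obtain ⟨m, hm⟩ := hw
        obtain ⟨v', rfl⟩ := hfs m
        refine ⟨⟨v - x • v', by rw [LinearMap.mem_ker, map_sub, map_smul, hm, sub_self]⟩,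
          Subtype.ext ?_⟩
        change c (v - x • v') = c v
        rw [map_sub, (hcx _).mpr ⟨v', rfl⟩, sub_zero]
      -- If v = x v' is killed by f, then x kills f v', and x is regular on N, so v' is itself in
      -- the kernel. Thus reduction modulo x commutes with taking the kernel, and the induction
      -- hypothesis applies to `ker f`.
      have hker : LinearMap.ker g = x • (⊤ : Submodule R (LinearMap.ker f)) := by
        ext v
        rw [LinearMap.mem_ker, Submodule.mem_smul_pointwise_iff_exists]
        have h1 : g v = 0 ↔ c v.1 = 0 := Subtype.ext_iff
        rw [h1, hcx]
        constructor
        · rintro ⟨v', hv'⟩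
          refine ⟨⟨v', ?_⟩, trivial, Subtype.ext hv'.symm⟩
          have := LinearMap.mem_ker.mp v.2
          rw [hv', map_smul] at this
          exact LinearMap.mem_ker.mpr (hN.right_eq_zero_of_smul this)
        · rintro ⟨v', -, rfl⟩
          exact ⟨v'.1, rfl⟩
      let e : QuotSMulTop x (LinearMap.ker f) ≃ₗ[R] LinearMap.ker f' :=
        (Submodule.quotEquivOfEq _ _ hker.symm).trans (g.quotKerEquivOfSurjective hg)
      exact HasFiniteFreeResolution.of_equiv (n := n) h (e.extendScalarsOfSurjective Ideal.Quotient.mk_surjective).symm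

/-- Finite modules over a regular local ring have finite free resolutions. -/
theorem exists_hasFiniteFreeResolution_of_ringKrullDim_eq (d : ℕ) :
    ∀ (R : Type u) [CommRing R] [IsRegularLocalRing R], ringKrullDim R = d →
      ∀ (M : Type u) [AddCommGroup M] [Module R M] [Module.Finite R M],
        ∃ n, HasFiniteFreeResolution R n M := by
  induction d with
  | zero =>
    intro R _ _ hd M _ _ _
    let := (isField_of_ringKrullDim_eq_zero (R := R) (by simpa using hd)).toField
    exact ⟨0, inferInstance, inferInstance⟩
  | succ d ih =>
    intro R _ _ hd M _ _ _
    have := isDomain_of_isRegularLocalRing R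
    obtain ⟨s, hs, hcard⟩ := exists_finset_span_maximalIdeal R hd
    obtain ⟨x, hxs⟩ : s.Nonempty := Finset.card_pos.mp (by omega)
    obtain ⟨hreg, hdx⟩ := isRegularLocalRing_quotient hs hcard hd hxs
    have hxm : x ∈ maximalIdeal R := hs ▸ Ideal.subset_span hxs
    have hx0 : x ≠ 0 := ne_zero_of_ringKrullDim_quotient hd hdx
    have hxr : IsSMulRegular R x := fun a b h => mul_left_cancel₀ hx0 h
    -- Multiplication by x need not be injective on M, but it is on the first syzygy, which lies in
    -- a free module. Passing to the syzygy costs the extra step in n + 1.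
    obtain ⟨k, f, hf⟩ := Module.Finite.exists_fin' R M
    have hN : IsSMulRegular (LinearMap.ker f) x := fun a b h =>
      Subtype.ext (funext fun i => hxr (congr_fun (congrArg Subtype.val h) i))
    have : Module.Finite (R ⧸ Ideal.span {x}) (QuotSMulTop x (LinearMap.ker f)) :=
      Module.Finite.of_restrictScalars_finite R _ _
    obtain ⟨n, h⟩ := ih (R ⧸ Ideal.span {x}) hdx (QuotSMulTop x (LinearMap.ker f))
    exact ⟨n + 1, k, f, hf, HasFiniteFreeResolution.of_quotSMulTop hxm hxr n _ hN h⟩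

/-- Finite free resolutions localize. -/
lemma HasFiniteFreeResolution.of_isLocalizedModule {R S : Type u} [CommRing R] [CommRing S]
    [Algebra R S] (T : Submonoid R) [IsLocalization T S] (n : ℕ) :
    ∀ (M M' : Type u) [AddCommGroup M] [Module R M] [AddCommGroup M'] [Module R M'] [Module S M']
      [IsScalarTower R S M'] (φ : M →ₗ[R] M') [IsLocalizedModule T φ],
      HasFiniteFreeResolution R n M → HasFiniteFreeResolution S n M' := by
  induction n with
  | zero =>
    intro M M' _ _ _ _ _ _ φ _ h
    obtain ⟨h1, h2⟩ := h
    exact ⟨Module.free_of_isLocalizedModule T φ, Module.Finite.of_isLocalizedModule T φ⟩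
  | succ n ih =>
    intro M M' _ _ _ _ _ _ φ _ h
    obtain ⟨k, f, hf, h⟩ := h
    let c : (Fin k → R) →ₗ[R] (Fin k → S) := 
      LinearMap.pi fun i => Algebra.linearMap R S ∘ₗ LinearMap.proj i
    have : IsLocalizedModule T c := IsLocalizedModule.pi T fun _ : Fin k => Algebra.linearMap R S
    let f' := (IsLocalizedModule.map T c φ f).extendScalarsOfIsLocalization T S
    refine ⟨k, f', IsLocalizedModule.map_surjective T c φ f hf, ?_⟩
    let ψ : LinearMap.ker f →ₗ[R] LinearMap.ker f' := LinearMap.toKerIsLocalized T c φ f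
    have : IsLocalizedModule T ψ := LinearMap.toKerLocalized_isLocalizedModule S T c φ f
    exact ih _ _ ψ h

/-- A projective module with a finite free resolution is stably free. -/
lemma HasFiniteFreeResolution.exists_stablyFree {S : Type u} [CommRing S] (n : ℕ) :
    ∀ (P : Type u) [AddCommGroup P] [Module S P] [Module.Projective S P],
      HasFiniteFreeResolution S n P → ∃ a b : ℕ, Nonempty ((P × (Fin a → S)) ≃ₗ[S] (Fin b → S)) := by
  induction n with
  | zero =>
    intro P _ _ _ h
    obtain ⟨h1, h2⟩ := h
    let b := (Module.Free.chooseBasis S P).reindex (Fintype.equivFin _)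
    exact ⟨0, _, ⟨LinearEquiv.prodUnique.trans b.equivFun⟩⟩
  | succ n ih =>
    intro P _ _ _ h
    obtain ⟨k, f, hf, h⟩ := h
    obtain ⟨g, hg⟩ := Module.projective_lifting_property f LinearMap.id hf
    have hg (p) : f (g p) = p := LinearMap.congr_fun hg p
    let r : (Fin k → S) →ₗ[S] LinearMap.ker f :=
      (LinearMap.id - g ∘ₗ f).codRestrict _ fun v => by simp [hg]
    have hr (v) : (r v : Fin k → S) = v - g (f v) := rfl
    have hrK (v : LinearMap.ker f) : r v = v := Subtype.ext (by simp [hr])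
    have : Module.Projective S (LinearMap.ker f) :=
      Module.Projective.of_split (LinearMap.ker f).subtype r (LinearMap.ext hrK)
    obtain ⟨a, b, ⟨e⟩⟩ := ih _ h
    let e₁ : (P × LinearMap.ker f) ≃ₗ[S] (Fin k → S) := LinearEquiv.ofLinearMap
      (g.coprod (LinearMap.ker f).subtype) (f.prod r)
      (LinearMap.ext fun v => by simp [hr])
      (LinearMap.ext fun ⟨p, v⟩ => by
        refine Prod.ext ?_ (Subtype.ext ?_)
        · simp [hg]
        · simp [hr, hg])
    -- With K the kernel and K ⊕ Sᵃ ≅ Sᵇ, the splitting gives P ⊕ Sᵇ ≅ P ⊕ K ⊕ Sᵃ ≅ Sᵏ ⊕ Sᵃ.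
    refine ⟨b, k + a, ⟨?_⟩⟩
    exact ((LinearEquiv.refl S P).prodCongr e.symm).trans <|
      (LinearEquiv.prodAssoc S P _ _).symm.trans <|
      (e₁.prodCongr (LinearEquiv.refl S (Fin a → S))).trans <|
      (LinearEquiv.sumArrowLequivProdArrow (Fin k) (Fin a) S S).symm.trans
      (LinearEquiv.funCongrLeft S S finSumFinEquiv.symm)

/-- The inclusion `I × Sⁿ → Sⁿ⁺¹`. -/
def idealProdIncl {S : Type u} [CommRing S] (I : Ideal S) (n : ℕ) :
    (I × (Fin n → S)) →ₗ[S] (Fin (n + 1) → S) :=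
  LinearMap.pi (Fin.cons (I.subtype ∘ₗ LinearMap.fst S I (Fin n → S))
    fun i => LinearMap.proj i ∘ₗ LinearMap.snd S I (Fin n → S))

/-- The map `Sⁿ⁺¹ → I × Sⁿ` given by multiplication by `a ∈ I` on the first component. -/
def idealProdMul {S : Type u} [CommRing S] (I : Ideal S) (n : ℕ) (a : I) :
    (Fin (n + 1) → S) →ₗ[S] (I × (Fin n → S)) :=
  ((LinearMap.toSpanSingleton S I a) ∘ₗ LinearMap.proj 0).prod
    (LinearMap.pi fun i => LinearMap.proj i.succ)

/-- An ideal which is stably free of rank one is principal. -/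
lemma isPrincipal_of_equiv {S : Type u} [CommRing S] (I : Ideal S) {n : ℕ}
    (e : (I × (Fin n → S)) ≃ₗ[S] (Fin (n + 1) → S)) : I.IsPrincipal := by
  let ι := idealProdIncl I n
  -- The generator will be det B. The first row of B has entries in I, so expansion along it puts
  -- the determinant in I.
  let B : Matrix (Fin (n + 1)) (Fin (n + 1)) S := LinearMap.toMatrix' (ι ∘ₗ e.symm.toLinearMap)
  have hB : B.det ∈ I := by
    rw [Matrix.det_succ_row_zero]
    refine Ideal.sum_mem _ fun i _ => Ideal.mul_mem_right _ _ (Ideal.mul_mem_left _ _ ?_)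
    simp [B, LinearMap.toMatrix'_apply, ι, idealProdIncl]
  refine ⟨B.det, le_antisymm (fun a ha => ?_) ((Ideal.span_singleton_le_iff_mem I).mpr hB)⟩
  let δ := idealProdMul I n ⟨a, ha⟩
  let A : Matrix (Fin (n + 1)) (Fin (n + 1)) S := LinearMap.toMatrix' (e.toLinearMap ∘ₗ δ)
  -- The isomorphism e cancels, which leaves multiplication by a on the first coordinate. Taking
  -- determinants gives a = det B · det A.
  have hBA : B * A = Matrix.diagonal (Fin.cons a fun _ => 1) := by
    rw [← LinearMap.toMatrix'_comp]
    ext i j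
    refine Fin.cases ?_ (fun i => ?_) i
    · by_cases h : (0 : Fin (n + 1)) = j
      · subst h; simp [LinearMap.toMatrix'_apply, ι, δ, idealProdIncl, idealProdMul]
      · simp [LinearMap.toMatrix'_apply, ι, δ, idealProdIncl, idealProdMul, h]
    · by_cases h : i.succ = j
      · subst h; simp [LinearMap.toMatrix'_apply, ι, δ, idealProdIncl, idealProdMul]
      · simp [LinearMap.toMatrix'_apply, ι, δ, idealProdIncl, idealProdMul, h]
  have h := congrArg Matrix.det hBA
  rw [Matrix.det_mul, Matrix.det_diagonal, Fin.prod_univ_succ] at h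
  refine Ideal.mem_span_singleton.mpr ⟨A.det, ?_⟩
  simpa using h.symm

/-- A nonzero projective ideal of a domain with a finite free resolution is principal. -/
lemma isPrincipal_of_hasFiniteFreeResolution {S : Type u} [CommRing S] [IsDomain S] (I : Ideal S)
    (hI : I ≠ ⊥) [Module.Projective S I] {n : ℕ} (h : HasFiniteFreeResolution S n I) :
    I.IsPrincipal := by
  obtain ⟨a, b, ⟨e⟩⟩ := h.exists_stablyFree n I
  obtain ⟨c, hc, hc0⟩ := Submodule.exists_mem_ne_zero_of_ne_bot hI
  have hι : Function.Injective (idealProdIncl I a) := by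
    rintro ⟨p, v⟩ ⟨p', v'⟩ h
    refine Prod.ext (Subtype.ext (congr_fun h 0)) (funext fun i => congr_fun h i.succ)
  have hδ : Function.Injective (idealProdMul I a ⟨c, hc⟩) := by
    intro v v' h
    funext i
    refine Fin.cases ?_ (fun i => ?_) i
    · have : v 0 * c = v' 0 * c := congrArg (fun p => (p.1 : S)) h
      exact mul_right_cancel₀ hc0 this
    · exact congrArg (fun p => p.2 i) h
  -- The rank is forced by two injections: I × Sᵃ lies in Sᵃ⁺¹, and multiplication by a nonzero c ∈
  -- I embeds Sᵃ⁺¹ into I × Sᵃ.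
  obtain rfl : b = a + 1 := le_antisymm
    (le_of_fin_injective S (idealProdIncl I a ∘ₗ e.symm.toLinearMap) (hι.comp e.symm.injective))
    (le_of_fin_injective S (e.toLinearMap ∘ₗ idealProdMul I a ⟨c, hc⟩) (e.injective.comp hδ))
  exact isPrincipal_of_equiv I e
end FiniteFreeResolution

/-! ### Factoriality of regular local rings -/

section Factorial
open IsLocalRing

lemma isRegularRing_of_isLocalization {R S : Type u} [CommRing R] [CommRing S] [Algebra R S]
    (T : Submonoid R) [IsLocalization T S] [IsRegularRing R] : IsRegularRing S := by
  have : IsNoetherianRing S := IsLocalization.isNoetherianRing T S inferInstance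
  refine isRegularRing_iff.mpr fun P _ => ?_
  have := IsLocalization.isLocalization_isLocalization_atPrime_isLocalization T
    (Localization.AtPrime P) P
  exact IsRegularLocalRing.of_ringEquiv (IsLocalization.algEquiv
    (P.comap (algebraMap R S)).primeCompl (Localization.AtPrime (P.comap (algebraMap R S)))
    (Localization.AtPrime P)).toRingEquiv

lemma projective_of_isPrincipal {S : Type u} [CommRing S] [IsDomain S] (J : Ideal S)
    (hJ : J.IsPrincipal) : Module.Projective S J := by
  obtain ⟨g, rfl⟩ := hJ
  by_cases hg : g = 0
  · subst hg
    rw [Submodule.span_zero_singleton]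
    infer_instance
  · exact Module.Projective.of_equiv (LinearEquiv.toSpanNonzeroSingleton S S g hg)

/-- If p lies in q, its extension is a height-one prime of a factorial ring; otherwise p contains an
element that becomes a unit, and the extension is the whole ring. -/
lemma isPrincipal_map_of_height_eq_one {R A : Type u} [CommRing R] [IsDomain R] [CommRing A]
    [IsDomain A] [Algebra R A] [UniqueFactorizationMonoid A] (q : Ideal R) [q.IsPrime]
    [IsLocalization.AtPrime A q] {p : Ideal R} [hp : p.IsPrime] (h1 : p.height = 1) :
    (p.map (algebraMap R A)).IsPrincipal := by
  by_cases hpq : p ≤ q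
  · have hd : Disjoint (q.primeCompl : Set R) (p : Set R) :=
      Set.disjoint_left.mpr fun a ha hap => ha (hpq hap)
    have := IsLocalization.isPrime_of_isPrime_disjoint q.primeCompl A p hp hd
    refine UniqueFactorizationMonoid.isPrincipal_of_height_eq_one ?_
    rw [← IsLocalization.height_under q.primeCompl,
      IsLocalization.under_map_of_isPrime_disjoint q.primeCompl A hp hd, h1]
  · obtain ⟨a, hap, haq⟩ := Set.not_subset.mp hpq
    have : p.map (algebraMap R A) = ⊤ := Ideal.eq_top_of_isUnit_mem _
      (Ideal.mem_map_of_mem _ hap) (IsLocalization.map_units A (⟨a, haq⟩ : q.primeCompl))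
    rw [this]
    exact ⟨1, by simp⟩

/-- The theorem of Auslander and Buchsbaum, for local rings all of whose localizations are
regular. -/
theorem uniqueFactorizationMonoid_of_ringKrullDim_le (d : ℕ) :
    ∀ (R : Type u) [CommRing R] [IsDomain R] [IsLocalRing R] [IsRegularRing R],
      ringKrullDim R ≤ d → UniqueFactorizationMonoid R := by
  induction d with
  | zero =>
    intro R _ _ _ _ hd
    have := IsRegularLocalRing.of_isRegularRing_of_isLocalRing R
    obtain ⟨n, hn⟩ := exists_ringKrullDim_eq R
    have hn0 : n = 0 := by
      rw [hn] at hd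
      exact Nat.le_zero.mp (by exact_mod_cast hd)
    let := (isField_of_ringKrullDim_eq_zero (R := R) (by simpa [hn0] using hn)).toField
    infer_instance
  | succ d ih =>
    intro R _ _ _ _ hd
    have := IsRegularLocalRing.of_isRegularRing_of_isLocalRing R
    obtain ⟨n, hn⟩ := exists_ringKrullDim_eq R
    by_cases hnd : n ≤ d
    · exact ih R (by rw [hn]; exact_mod_cast hnd)
    have hn' : n = d + 1 := by
      rw [hn] at hd
      have : n ≤ d + 1 := by exact_mod_cast hd
      omega
    subst hn'
    obtain ⟨s, hs, hcard⟩ := exists_finset_span_maximalIdeal R hn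
    obtain ⟨x, hxs⟩ : s.Nonempty := Finset.card_pos.mp (by omega)
    obtain ⟨hreg, hdx⟩ := isRegularLocalRing_quotient hs hcard hn hxs
    have hxm : x ∈ maximalIdeal R := hs ▸ Ideal.subset_span hxs
    have hx0 : x ≠ 0 := ne_zero_of_ringKrullDim_quotient hn hdx
    -- The quotient by x is again regular local, hence a domain.
    have hxp : Prime x := by
      have := isDomain_of_isRegularLocalRing (R ⧸ Ideal.span {x})
      exact (Ideal.span_singleton_prime hx0).mp ((Ideal.Quotient.isDomain_iff_prime _).mp this)
    refine UniqueFactorizationMonoid.of_forall_isPrincipal_of_height_eq_one fun p hp h1 => ?_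
    by_cases hxp' : x ∈ p
    · exact ⟨x, p.eq_span_singleton_of_height_eq_one h1 hxp' hxp⟩
    -- Nagata's argument: x is prime and not in p, so p is principal as soon as its extension I to S
    -- is. Now I has a finite free resolution because p has one, and it is projective because it is
    -- principal over each local ring of S.
    let S := Localization.Away x
    have : IsDomain S := IsLocalization.Away.isDomain S hx0
    have hinj : Function.Injective (algebraMap R S) :=
      IsLocalization.injective S (powers_le_nonZeroDivisors_of_noZeroDivisors hx0)
    -- Regularity is assumed at all primes of R so that it passes to S and to the local rings of S,
    -- where the induction hypothesis is used.
    have hSreg : IsRegularRing S := isRegularRing_of_isLocalization (Submonoid.powers x)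
    let I := p.map (algebraMap R S)
    have hI : I ≠ ⊥ := by
      rw [Ne, Ideal.map_eq_bot_iff_of_injective hinj]
      exact p.ne_bot_of_height_eq_one h1
    obtain ⟨n, hffr⟩ := exists_hasFiniteFreeResolution_of_ringKrullDim_eq _ R hn p
    have hffr' : HasFiniteFreeResolution S n I :=
      HasFiniteFreeResolution.of_isLocalizedModule (Submonoid.powers x) n p I
        (Algebra.idealMap S p) hffr
    have hproj : Module.Projective S I := by
      have : Module.FinitePresentation S I := Module.finitePresentation_of_finite S I
      refine Module.projective_of_localization_maximal' (R := S) (M := I)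
        (fun P _ => Localization.AtPrime P)
        (fun P _ => I.map (algebraMap S (Localization.AtPrime P)))
        (fun P _ => Algebra.idealMap (Localization.AtPrime P) I) fun P hP => ?_
      let A := Localization.AtPrime P
      have := IsLocalization.isDomain_localization (P.primeCompl_le_nonZeroDivisors)
      let q := P.comap (algebraMap R S)
      have hA : IsLocalization.AtPrime A q :=
        IsLocalization.isLocalization_isLocalization_atPrime_isLocalization
          (Submonoid.powers x) A P
      have : IsRegularRing A := isRegularRing_of_isLocalization P.primeCompl
      -- The maximal ideal contains x, which is invertible in S. So the local rings of S have
      -- smaller dimension than R.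
      have hq : q < maximalIdeal R := by
        refine lt_of_le_of_ne (le_maximalIdeal (Ideal.IsPrime.ne_top inferInstance)) fun h => ?_
        have hxq : x ∈ q := h ▸ hxm
        exact (Ideal.IsPrime.ne_top inferInstance) (Ideal.eq_top_of_isUnit_mem P hxq
          (IsLocalization.Away.algebraMap_isUnit x))
      have hdim : ringKrullDim A ≤ d := by
        rw [IsLocalization.AtPrime.ringKrullDim_eq_height q A]
        have h2 := Ideal.height_add_one_le_of_lt_of_isPrime hq
        have h3 : (maximalIdeal R).height = (d + 1 : ℕ) := by
          rw [← WithBot.coe_inj, maximalIdeal_height_eq_ringKrullDim, hn]; rfl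
        rw [h3, Nat.cast_add, Nat.cast_one] at h2
        have h4 := (ENat.add_le_add_iff_right ENat.one_ne_top).mp h2
        exact_mod_cast h4
      have := ih A hdim
      refine projective_of_isPrincipal _ ?_
      rw [Ideal.map_map, ← IsScalarTower.algebraMap_eq]
      exact isPrincipal_map_of_height_eq_one q h1
    exact p.isPrincipal_of_isPrincipal_localizationAway_of_prime hxp hxp'
      (isPrincipal_of_hasFiniteFreeResolution I hI hffr')

theorem uniqueFactorizationMonoid_of_isRegularRing (R : Type u) [CommRing R] [IsDomain R]
    [IsLocalRing R] [IsRegularRing R] : UniqueFactorizationMonoid R := by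
  have := IsRegularLocalRing.of_isRegularRing_of_isLocalRing R
  obtain ⟨d, hd⟩ := exists_ringKrullDim_eq R
  exact uniqueFactorizationMonoid_of_ringKrullDim_le d R hd.le

end Factorial
end SimplicialPic

/-! ### Stalks, generizations and height-one points on a regular scheme -/

namespace SimplicialPic
noncomputable section
variable {X : Scheme.{u}}

/-- The map of stalks attached to a specialization. -/
def sp {y x : X} (h : y ⤳ x) : X.presheaf.stalk x →+* X.presheaf.stalk y :=
  (X.presheaf.stalkSpecializes h).hom

/-- The germ of a function at a point. -/
def germ {U : X.Opens} {x : X} (hx : x ∈ U) : Γ(X, U) →+* X.presheaf.stalk x :=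
  (X.presheaf.germ U x hx).hom

section
variable {x y z : X} {U V : X.Opens}

lemma sp_germ (h : y ⤳ x) (hx : x ∈ U) (r : Γ(X, U)) :
    sp h (germ hx r) = germ (h.mem_open U.2 hx) r :=
  TopCat.Presheaf.germ_stalkSpecializes_apply _ _ _ _

lemma germ_resR (h : V ≤ U) (hx : x ∈ V) (r : Γ(X, U)) : germ hx (resR h r) = germ (h hx) r :=
  TopCat.Presheaf.germ_res_apply _ _ _ _ _

lemma exists_germ_eq (a : X.presheaf.stalk x) (hx : x ∈ U) :
    ∃ (V : X.Opens) (_ : V ≤ U) (hV : x ∈ V) (r : Γ(X, V)), germ hV r = a := by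
  obtain ⟨V, hV, r, hr⟩ := TopCat.Presheaf.exists_germ_eq X.presheaf a
  exact ⟨V ⊓ U, inf_le_right, ⟨hV, hx⟩, resR inf_le_left r, (germ_resR inf_le_left _ r).trans hr⟩

lemma exists_resR_eq (hx : x ∈ U) (r r' : Γ(X, U)) (e : germ hx r = germ hx r') :
    ∃ (V : X.Opens) (h : V ≤ U), x ∈ V ∧ resR h r = resR h r' := by
  obtain ⟨W, hW, i, i', e⟩ := TopCat.Presheaf.germ_eq X.presheaf x hx hx r r' e
  exact ⟨W, i.le, hW, e⟩

lemma sp_sp (h : y ⤳ x) (h' : z ⤳ y) (a : X.presheaf.stalk x) :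
    sp h' (sp h a) = sp (h'.trans h) a := by
  obtain ⟨V, _, hV, r, rfl⟩ := exists_germ_eq a (U := ⊤) trivial
  simp only [sp_germ]

lemma exists_isUnit_resR (hx : x ∈ U) (r : Γ(X, U)) (hr : IsUnit (germ hx r)) :
    ∃ (V : X.Opens) (h : V ≤ U), x ∈ V ∧ IsUnit (resR h r) := by
  obtain ⟨V, i, hV, h⟩ := RingedSpace.isUnit_res_of_isUnit_germ X.toRingedSpace U r x hx hr
  exact ⟨V, i.le, hV, h⟩

/-- The prime of the local ring at `x` attached to a generization of `x`. -/
def spIdeal (h : y ⤳ x) : Ideal (X.presheaf.stalk x) :=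
  (IsLocalRing.maximalIdeal (X.presheaf.stalk y)).comap (sp h)

instance (h : y ⤳ x) : (spIdeal h).IsPrime := by
  unfold spIdeal; infer_instance

lemma notMem_spIdeal {h : y ⤳ x} {a : X.presheaf.stalk x} : a ∉ spIdeal h ↔ IsUnit (sp h a) := by
  rw [spIdeal, Ideal.mem_comap, IsLocalRing.mem_maximalIdeal, mem_nonunits_iff, not_not]

/-- Both stalks are localizations of the functions on one affine neighbourhood of x, which contains
y as well; fractions and equalities are compared there. -/
lemma isLocalization_sp (h : y ⤳ x) :
    @IsLocalization _ _ (spIdeal h).primeCompl (X.presheaf.stalk y) _ (sp h).toAlgebra := by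
  let _ := (sp h).toAlgebra
  obtain ⟨U, hU, hxU, -⟩ := exists_isAffineOpen_mem_and_subset (U := (⊤ : X.Opens)) (x := x) trivial
  have hyU : y ∈ U := h.mem_open U.2 hxU
  let _ : Algebra Γ(X, U) (X.presheaf.stalk x) := (germ hxU).toAlgebra
  let _ : Algebra Γ(X, U) (X.presheaf.stalk y) := (germ hyU).toAlgebra
  have hx : IsLocalization.AtPrime (X.presheaf.stalk x) (hU.primeIdealOf ⟨x, hxU⟩).asIdeal :=
    hU.isLocalization_stalk ⟨x, hxU⟩
  have hy : IsLocalization.AtPrime (X.presheaf.stalk y) (hU.primeIdealOf ⟨y, hyU⟩).asIdeal :=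
    hU.isLocalization_stalk ⟨y, hyU⟩
  have key (s : Γ(X, U)) : sp h (germ hxU s) = germ hyU s := sp_germ h hxU s
  have unitx (s : (hU.primeIdealOf ⟨x, hxU⟩).asIdeal.primeCompl) : IsUnit (germ hxU (s : Γ(X, U))) :=
    IsLocalization.map_units (X.presheaf.stalk x) s
  have unity (s : (hU.primeIdealOf ⟨y, hyU⟩).asIdeal.primeCompl) : IsUnit (germ hyU (s : Γ(X, U))) :=
    IsLocalization.map_units (X.presheaf.stalk y) s
  rw [isLocalization_iff]
  refine ⟨?_, ?_, ?_⟩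
  · rintro ⟨a, ha⟩
    exact notMem_spIdeal.1 ha
  · intro b
    obtain ⟨a, s, e⟩ := IsLocalization.exists_mk'_eq (hU.primeIdealOf ⟨y, hyU⟩).asIdeal.primeCompl b
    refine ⟨⟨germ hxU a, ⟨germ hxU s, notMem_spIdeal.2 (by rw [key]; exact unity s)⟩⟩, ?_⟩
    change b * sp h (germ hxU s) = sp h (germ hxU a)
    rw [key, key, ← e]
    exact IsLocalization.mk'_spec _ _ _
  · intro a b e
    change sp h a = sp h b at e
    obtain ⟨⟨a', s⟩, ha⟩ := IsLocalization.surj (hU.primeIdealOf ⟨x, hxU⟩).asIdeal.primeCompl a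
    obtain ⟨⟨b', t⟩, hb⟩ := IsLocalization.surj (hU.primeIdealOf ⟨x, hxU⟩).asIdeal.primeCompl b
    change a * germ hxU s = germ hxU a' at ha
    change b * germ hxU t = germ hxU b' at hb
    have e' : germ hyU (a' * t) = germ hyU (b' * s) := by
      rw [map_mul, map_mul, ← key, ← key, ← key, ← key, ← ha, ← hb, map_mul, map_mul, e]
      ring
    obtain ⟨c, hc⟩ := (IsLocalization.eq_iff_exists (hU.primeIdealOf ⟨y, hyU⟩).asIdeal.primeCompl
      (X.presheaf.stalk y)).1 e'
    refine ⟨⟨germ hxU c, notMem_spIdeal.2 (by rw [key]; exact unity c)⟩, ?_⟩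
    change germ hxU c * a = germ hxU c * b
    rw [← (unitx s).mul_left_inj, ← (unitx t).mul_left_inj]
    have := congr(germ hxU $hc)
    simp only [map_mul, ← ha, ← hb] at this
    linear_combination this

/-- `spIdeal` as a point of the spectrum of the local ring. -/
def spPoint (h : y ⤳ x) : Spec (X.presheaf.stalk x) :=
  (⟨spIdeal h, inferInstance⟩ : PrimeSpectrum (X.presheaf.stalk x))

lemma fromSpecStalk_spPoint (h : y ⤳ x) : X.fromSpecStalk x (spPoint h) = y := by
  have e := congr($(Scheme.SpecMap_stalkSpecializes_fromSpecStalk h).base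
    (IsLocalRing.closedPoint (X.presheaf.stalk y)))
  exact Eq.trans e Scheme.fromSpecStalk_closedPoint

/-- The spectrum of the local ring at x embeds in X with image the generizations of x. Together with
`spIdeal_le_iff` this translates questions about generizations into questions about primes of one
ring. -/
lemma exists_spIdeal_eq (x : X) (p : Ideal (X.presheaf.stalk x)) [hp : p.IsPrime] :
    ∃ (y : X) (h : y ⤳ x), spIdeal h = p := by
  let P : Spec (X.presheaf.stalk x) := (⟨p, hp⟩ : PrimeSpectrum _)
  have h : X.fromSpecStalk x P ⤳ x :=
    (Scheme.range_fromSpecStalk (X := X) (x := x)).le ⟨P, rfl⟩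
  refine ⟨_, h, ?_⟩
  have e := fromSpecStalk_spPoint h
  have e' := (X.fromSpecStalk x).isEmbedding.injective e
  exact congr(PrimeSpectrum.asIdeal $e')

lemma spIdeal_le_iff (h : y ⤳ x) (h' : z ⤳ x) : spIdeal h ≤ spIdeal h' ↔ y ⤳ z := by
  constructor
  · intro le
    rw [← fromSpecStalk_spPoint h, ← fromSpecStalk_spPoint h']
    refine Specializes.map ?_ (X.fromSpecStalk x).continuous
    exact (PrimeSpectrum.le_iff_specializes _ _).1 le
  · intro hyz a ha
    by_contra hn
    rw [notMem_spIdeal] at hn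
    have := hn.map (sp hyz)
    rw [sp_sp, ← notMem_spIdeal] at this
    exact this ha

variable {ξ : X}

/-- `ξ` is the generic point of the irreducible component through `x`. -/
structure IsGenericFor (ξ x : X) : Prop where
  specializes : ξ ⤳ x
  of_specializes : ∀ y, y ⤳ x → ξ ⤳ y

lemma IsGenericFor.of_le (h : IsGenericFor ξ x) (hy : y ⤳ x) : IsGenericFor ξ y :=
  ⟨h.of_specializes y hy, fun z hz => h.of_specializes z (hz.trans hy)⟩

lemma IsGenericFor.eq_of_specializes (h : IsGenericFor ξ x) (hy : y ⤳ ξ) : y = ξ :=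
  (hy.antisymm (h.of_specializes y (hy.trans h.specializes))).eq

/-- The units at `ξ` which come from units at a specialization `y`. -/
def unitsAt (h : ξ ⤳ y) : Subgroup (X.presheaf.stalk ξ)ˣ :=
  (Units.map (sp h : X.presheaf.stalk y →* X.presheaf.stalk ξ)).range

lemma mem_unitsAt_of_isUnit (h : ξ ⤳ y) {u : (X.presheaf.stalk ξ)ˣ} (a : X.presheaf.stalk y)
    (ha : IsUnit a) (e : sp h a = u) : u ∈ unitsAt h := by
  obtain ⟨a, rfl⟩ := ha
  exact ⟨a, Units.ext e⟩

lemma unitsAt_mono {z : X} (h : ξ ⤳ y) (h' : ξ ⤳ z) (hzy : z ⤳ y) : unitsAt h ≤ unitsAt h' := by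
  rintro _ ⟨a, rfl⟩
  exact mem_unitsAt_of_isUnit h' (sp hzy a) (a.isUnit.map _) (sp_sp _ _ _)

/-- `y` is a point of height one, `ξ` its generic generization, and `π` a uniformizer at `y`. -/
structure IsUniformizer (h : ξ ⤳ y) (π : (X.presheaf.stalk ξ)ˣ) : Prop where
  exists_zpow : ∀ u : (X.presheaf.stalk ξ)ˣ, ∃ n : ℤ, u * π ^ n ∈ unitsAt h
  eq_or_eq : ∀ z : X, z ⤳ y → z = y ∨ z = ξ

lemma mem_unitsAt_of_fraction (h : IsGenericFor ξ x) (hy : y ⤳ x) (u : (X.presheaf.stalk ξ)ˣ)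
    {a b : X.presheaf.stalk x} (ha : a ∉ spIdeal hy) (hb : b ∉ spIdeal hy)
    (e : (u : X.presheaf.stalk ξ) * sp h.specializes b = sp h.specializes a) :
    u ∈ unitsAt (h.of_specializes y hy) := by
  rw [notMem_spIdeal] at ha hb
  obtain ⟨a', ha'⟩ := ha
  obtain ⟨b', hb'⟩ := hb
  refine ⟨a' / b', Units.ext ?_⟩
  refine (b'.isUnit.map (sp (h.of_specializes y hy))).mul_right_cancel ?_
  have e1 : sp (h.of_specializes y hy) (b' : X.presheaf.stalk y) = sp h.specializes b := by
    rw [hb', sp_sp]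
  have e2 : sp (h.of_specializes y hy) (a' : X.presheaf.stalk y) = sp h.specializes a := by
    rw [ha', sp_sp]
  rw [e1, e, ← e2, ← e1, Units.coe_map]
  change sp _ _ * sp _ _ = _
  rw [← map_mul, ← Units.val_mul, div_mul_cancel]
end

section
variable [hreg : ∀ x : X, IsRegularLocalRing (X.presheaf.stalk x)] {x y ξ : X}

instance (x : X) : IsDomain (X.presheaf.stalk x) := isDomain_of_isRegularLocalRing _

/-- The localizations of a stalk at its primes are the stalks at the generizations of x, whose
regularity is part of the hypothesis. -/
instance (x : X) : IsRegularRing (X.presheaf.stalk x) where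
  isRegularLocalRing_localization p hp := by
    obtain ⟨y, h, rfl⟩ := exists_spIdeal_eq x p
    let _ := (sp h).toAlgebra
    have := isLocalization_sp h
    exact IsRegularLocalRing.of_ringEquiv (IsLocalization.algEquiv (spIdeal h).primeCompl
      (X.presheaf.stalk y) (Localization.AtPrime (spIdeal h))).toRingEquiv

instance (x : X) : UniqueFactorizationMonoid (X.presheaf.stalk x) :=
  uniqueFactorizationMonoid_of_isRegularRing _

lemma sp_injective (h : y ⤳ x) : Function.Injective (sp h) := by
  let _ := (sp h).toAlgebra
  have := isLocalization_sp h
  exact IsLocalization.injective (X.presheaf.stalk y) (M := (spIdeal h).primeCompl)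
    (Ideal.primeCompl_le_nonZeroDivisors _)

/-- The stalk is a domain, so its zero ideal is a prime, and it lies below all the others; the
corresponding point specializes to every generization of x. -/
lemma exists_isGenericFor (x : X) : ∃ ξ : X, IsGenericFor ξ x := by
  obtain ⟨ξ, h, e⟩ := exists_spIdeal_eq x ⊥
  exact ⟨ξ, h, fun y hy => (spIdeal_le_iff h hy).1 (by rw [e]; exact bot_le)⟩

lemma IsGenericFor.spIdeal_eq (h : IsGenericFor ξ x) : spIdeal h.specializes = ⊥ := by
  obtain ⟨y, hy, e⟩ := exists_spIdeal_eq x ⊥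
  exact le_bot_iff.1 (e ▸ (spIdeal_le_iff h.specializes hy).2 (h.of_specializes y hy))

lemma IsGenericFor.isUnit_sp (h : IsGenericFor ξ x) {a : X.presheaf.stalk x} (ha : a ≠ 0) :
    IsUnit (sp h.specializes a) := by
  rw [← notMem_spIdeal, h.spIdeal_eq]
  simpa using ha

/-- The stalk at ξ is the fraction field of a factorial ring, so a fraction can be reduced to lowest
terms. -/
lemma IsGenericFor.exists_fraction (h : IsGenericFor ξ x) (u : (X.presheaf.stalk ξ)ˣ) :
    ∃ a b : X.presheaf.stalk x, a ≠ 0 ∧ b ≠ 0 ∧ IsRelPrime a b ∧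
      (u : X.presheaf.stalk ξ) * sp h.specializes b = sp h.specializes a := by
  let _ := (sp h.specializes).toAlgebra
  have := isLocalization_sp h.specializes
  obtain ⟨⟨a, b⟩, e⟩ := IsLocalization.surj (spIdeal h.specializes).primeCompl
    (u : X.presheaf.stalk ξ)
  change (u : X.presheaf.stalk ξ) * sp h.specializes b = sp h.specializes a at e
  have hb : (b : X.presheaf.stalk x) ≠ 0 := by
    rintro hb
    exact b.2 (hb ▸ zero_mem _)
  have ha : a ≠ 0 := by
    rintro rfl
    rw [map_zero, u.isUnit.mul_right_eq_zero, map_eq_zero_iff _ (sp_injective _)] at e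
    exact hb e
  obtain ⟨a', b', c, hr, rfl, hb'⟩ := UniqueFactorizationMonoid.exists_reduced_factors a ha b
  rw [← hb'] at hb e
  have hc := left_ne_zero_of_mul ha
  refine ⟨a', b', right_ne_zero_of_mul ha, right_ne_zero_of_mul hb, hr, ?_⟩
  rw [map_mul, map_mul] at e
  refine (h.isUnit_sp hc).mul_left_cancel ?_
  linear_combination e

lemma exists_prime_mem {R : Type*} [CommRing R] [IsDomain R] [UniqueFactorizationMonoid R]
    (p : Ideal R) [p.IsPrime] {a : R} (ha : a ≠ 0) (hap : a ∈ p) : ∃ π, Prime π ∧ π ∣ a ∧ π ∈ p := by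
  obtain ⟨f, hf, hfa⟩ := UniqueFactorizationMonoid.exists_prime_factors a ha
  have : f.prod ∈ p := by
    obtain ⟨v, rfl⟩ := hfa
    exact (Ideal.IsPrime.mem_or_mem ‹_› hap).resolve_right
      fun h => Ideal.IsPrime.ne_top ‹_› (Ideal.eq_top_of_isUnit_mem _ h v.isUnit)
  obtain ⟨π, hπ, hm⟩ := (Ideal.IsPrime.multiset_prod_mem_iff_exists_mem ‹_› f).1 this
  exact ⟨π, hf π hπ, (Multiset.dvd_prod hπ).trans hfa.dvd, hm⟩

/-- Write u = a/b in lowest terms in the stalk at x. If u is not a unit at y, some prime factor p of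
a or of b vanishes at y. The point η is the one with ideal (p), and π is p itself. As p is chosen in
the stalk at x, π is a unit at every generization of x that is not a specialization of η; this
control away from η lets h be corrected at η in `exists_common_coef` without damage elsewhere. -/
lemma exists_isUniformizer (h : IsGenericFor ξ x) (hy : y ⤳ x) (u : (X.presheaf.stalk ξ)ˣ)
    (hu : u ∉ unitsAt (h.of_specializes y hy)) :
    ∃ (η : X) (hη : η ⤳ y) (π : (X.presheaf.stalk ξ)ˣ),
      (∀ z (hz : z ⤳ x), ¬ η ⤳ z → π ∈ unitsAt (h.of_specializes z hz)) ∧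
      IsUniformizer (h.of_specializes η (hη.trans hy)) π ∧
      u ∉ unitsAt (h.of_specializes η (hη.trans hy)) := by
  obtain ⟨a, b, ha, hb, hab, e⟩ := h.exists_fraction u
  have key : ∃ p, Prime p ∧ p ∈ spIdeal hy ∧ (p ∣ a ∨ p ∣ b) := by
    by_contra hn
    push Not at hn
    refine hu (mem_unitsAt_of_fraction h hy u (a := a) (b := b) (fun hay => ?_) (fun hby => ?_) e)
    · obtain ⟨p, hp, hpa, hpy⟩ := exists_prime_mem _ ha hay
      exact (hn p hp hpy).1 hpa
    · obtain ⟨p, hp, hpa, hpy⟩ := exists_prime_mem _ hb hby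
      exact (hn p hp hpy).2 hpa
  obtain ⟨p, hp, hpy, hpab⟩ := key
  have : (Ideal.span {p}).IsPrime := (Ideal.span_singleton_prime hp.ne_zero).2 hp
  obtain ⟨η, hηx, hη⟩ := exists_spIdeal_eq x (Ideal.span {p})
  have hmem (c) : c ∈ spIdeal hηx ↔ p ∣ c := by rw [hη, Ideal.mem_span_singleton]
  have hηy : η ⤳ y := (spIdeal_le_iff hηx hy).1 (by
    rw [hη, Ideal.span_singleton_le_iff_mem]; exact hpy)
  obtain ⟨π, hπ⟩ := h.isUnit_sp hp.ne_zero
  refine ⟨η, hηy, π, fun z hz hn => ?_, ⟨fun v => ?_, fun z hz => ?_⟩, ?_⟩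
  · rw [← spIdeal_le_iff hηx hz, hη, Ideal.span_singleton_le_iff_mem, notMem_spIdeal] at hn
    exact mem_unitsAt_of_isUnit _ _ hn (by rw [sp_sp, hπ])
  · obtain ⟨c, d, hc, hd, -, e⟩ := h.exists_fraction v
    obtain ⟨c', hce, hc'⟩ :=
      (FiniteMultiplicity.of_prime_left hp hc).exists_eq_pow_mul_and_not_dvd
    set m := multiplicity p c
    obtain ⟨d', hde, hd'⟩ :=
      (FiniteMultiplicity.of_prime_left hp hd).exists_eq_pow_mul_and_not_dvd
    set n := multiplicity p d
    -- With v = pᵐc' / (pⁿd') and p dividing neither c' nor d', the product of v with the power n -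
    -- m of π is c'/d', a unit at η.
    refine ⟨n - m, mem_unitsAt_of_fraction h hηx _ (a := c') (b := d') ?_ ?_ ?_⟩
    · rwa [hmem]
    · rwa [hmem]
    · rw [hce, hde, map_mul, map_mul, map_pow, map_pow, ← hπ] at e
      have : ((v * π ^ (n - m : ℤ) * π ^ m : (X.presheaf.stalk ξ)ˣ) : X.presheaf.stalk ξ) =
          v * π ^ n := by
        rw [← zpow_natCast π m, mul_assoc, ← zpow_add, sub_add_cancel, zpow_natCast]
        simp
      refine (π.isUnit.pow m).mul_left_cancel ?_
      rw [← e, ← mul_assoc v.1, ← this]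
      push_cast
      ring
  -- The ideal (p) has height one: a nonzero prime ideal inside it contains a prime element, which
  -- is divisible by p and hence associated to p.
  · by_cases hz0 : spIdeal (hz.trans hηx) = ⊥
    · right
      exact ((spIdeal_le_iff (hz.trans hηx) h.specializes).1 (by rw [hz0]; exact bot_le)).antisymm
        (h.of_specializes z (hz.trans hηx)) |>.eq
    · left
      refine Inseparable.eq <| hz.antisymm ((spIdeal_le_iff hηx (hz.trans hηx)).1 ?_)
      obtain ⟨c, hc, hc0⟩ := Submodule.exists_mem_ne_zero_of_ne_bot hz0
      obtain ⟨p', hp', -, hm⟩ := exists_prime_mem _ hc0 hc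
      have := (spIdeal_le_iff (hz.trans hηx) hηx).2 hz hm
      rw [hmem] at this
      rw [hη, Ideal.span_singleton_le_iff_mem]
      exact ((spIdeal (hz.trans hηx)).mem_of_dvd (hp.associated_of_dvd hp' this).symm.dvd hm)
  -- If u were a unit at η, then p would divide a exactly when it divides b. It divides one of them,
  -- hence both, against coprimality.
  · rintro ⟨w, rfl⟩
    have e' : (w : X.presheaf.stalk η) * sp hηx b = sp hηx a := by
      apply sp_injective (h.of_specializes η hηx)
      rw [map_mul, sp_sp, sp_sp]
      exact e
    have iff : a ∈ spIdeal hηx ↔ b ∈ spIdeal hηx := by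
      rw [← not_iff_not, notMem_spIdeal, notMem_spIdeal, ← e', Units.isUnit_units_mul]
    rw [hmem, hmem] at iff
    have hpa : p ∣ a := hpab.elim id iff.2
    exact hp.not_isUnit (hab hpa (iff.1 hpa))
end
end
end SimplicialPic

/-! ### Noetherian topology: from generizations to neighbourhoods -/

namespace SimplicialPic
noncomputable section

section
variable {T : Type*} [TopologicalSpace T] [NoetherianSpace T] [QuasiSober T]

lemma exists_finite_specializes {Z : Set T} (hZ : IsClosed Z) :
    ∃ S : Set T, S.Finite ∧ S ⊆ Z ∧ ∀ z ∈ Z, ∃ s ∈ S, s ⤳ z := by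
  obtain ⟨C, hC, hcl, hirr, rfl⟩ := NoetherianSpace.exists_finite_set_isClosed_irreducible hZ
  obtain hT | hT := isEmpty_or_nonempty T
  · exact ⟨∅, Set.finite_empty, Set.empty_subset _, fun z => hT.elim z⟩
  have hg (t : Set T) (ht : t ∈ C) : ∃ s, IsGenericPoint s t :=
    QuasiSober.sober (hirr t ht) (hcl t ht)
  choose! g hg using hg
  refine ⟨g '' C, hC.image g, ?_, ?_⟩
  · rintro _ ⟨t, ht, rfl⟩
    exact ⟨t, ht, (hg t ht).mem⟩
  · rintro z ⟨t, ht, hzt⟩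
    exact ⟨g t, ⟨t, ht, rfl⟩, (hg t ht).specializes hzt⟩

/-- Z has finitely many generic points. W is the complement of the closures of those that do not
specialize to x. -/
lemma exists_open_forall_specializes {Z : Set T} (hZ : IsClosed Z) (x : T) :
    ∃ W : Opens T, x ∈ W ∧ ∀ y ∈ W, y ∈ Z → ∃ s ∈ Z, s ⤳ x ∧ s ⤳ y := by
  obtain ⟨S, hS, hSZ, H⟩ := exists_finite_specializes hZ
  let B : Set T := ⋃ s ∈ (S ∩ Set.ofPred fun s => ¬ s ⤳ x), closure {s}
  have hB : IsClosed B := (hS.subset Set.inter_subset_left).isClosed_biUnion fun _ _ => isClosed_closure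
  refine ⟨⟨Bᶜ, hB.isOpen_compl⟩, fun hx => ?_, fun y hy hyZ => ?_⟩
  · obtain ⟨s, hs, hxs⟩ := Set.mem_iUnion₂.1 hx
    exact hs.2 (specializes_iff_mem_closure.2 hxs)
  · obtain ⟨s, hs, hsy⟩ := H y hyZ
    refine ⟨s, hSZ hs, ?_, hsy⟩
    by_contra hn
    exact hy (Set.mem_biUnion (show s ∈ S ∩ Set.ofPred fun s => ¬ s ⤳ x from ⟨hs, hn⟩)
      (specializes_iff_mem_closure.1 hsy))

/-- This spreads out to a neighbourhood of x a condition checked only at the generizations of x, by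
applying `exists_open_forall_specializes` to the complement of O. -/
lemma exists_inf_le_of_specializes {O V : Opens T} (x : T) (H : ∀ y ∈ V, y ⤳ x → y ∈ O) :
    ∃ W : Opens T, x ∈ W ∧ W ⊓ V ≤ O := by
  obtain ⟨W, hx, hW⟩ := exists_open_forall_specializes O.2.isClosed_compl x
  refine ⟨W, hx, fun y hy => ?_⟩
  by_contra hn
  obtain ⟨s, hs, hsx, hsy⟩ := hW y hy.1 hn
  exact hs (H s (hsy.mem_open V.2 hy.2) hsx)
end

variable {X : Scheme.{u}}

lemma exists_isUnit_germ_eq {ξ y : X} (h : ξ ⤳ y) {u : (X.presheaf.stalk ξ)ˣ} (hu : u ∈ unitsAt h)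
    {V : X.Opens} (hy : y ∈ V) : ∃ (T : X.Opens) (hT : y ∈ T) (_ : T ≤ V) (r : Γ(X, T)),
      IsUnit r ∧ germ (h.mem_open T.2 hT) r = u := by
  obtain ⟨a, rfl⟩ := hu
  obtain ⟨T, hTV, hT, r, hr⟩ := exists_germ_eq (a : X.presheaf.stalk y) hy
  obtain ⟨T', h', hT', hu⟩ := exists_isUnit_resR hT r (by rw [hr]; exact a.isUnit)
  refine ⟨T', hT', h'.trans hTV, _, hu, ?_⟩
  rw [germ_resR, ← sp_germ h hT, hr]
  rfl

variable [hreg : ∀ x : X, IsRegularLocalRing (X.presheaf.stalk x)]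

/-- Only one irreducible component passes through x, and the finitely many others can be removed. So
near x functions are determined by their germs at ξ. -/
lemma exists_open_isGenericFor [NoetherianSpace X] {ξ x : X} (h : IsGenericFor ξ x) :
    ∃ W : X.Opens, x ∈ W ∧ ∀ y ∈ W, IsGenericFor ξ y := by
  obtain ⟨W, hx, hW⟩ := exists_open_forall_specializes (Z := (Set.univ : Set X)) isClosed_univ x
  refine ⟨W, hx, fun y hy => ?_⟩
  obtain ⟨s, -, hsx, hsy⟩ := hW y hy trivial
  obtain ⟨ξ', h'⟩ := exists_isGenericFor y
  rwa [← h.eq_of_specializes (h'.of_specializes ξ ((h.of_specializes s hsx).trans hsy))]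

lemma IsGenericFor.mem_of_dense [NoetherianSpace X] {ξ x : X} (h : IsGenericFor ξ x) {U : X.Opens}
    (hU : Dense (U : Set X)) : ξ ∈ U := by
  obtain ⟨W, hx, hW⟩ := exists_open_isGenericFor h
  obtain ⟨y, hy, hyU⟩ := hU.inter_open_nonempty W W.2 ⟨x, hx⟩
  exact (hW y hy).specializes.mem_open U.2 hyU

lemma germ_eq_of_specializes {ξ y : X} (h : ξ ⤳ y) {T : X.Opens} (hy : y ∈ T) {r r' : Γ(X, T)}
    (e : germ (h.mem_open T.2 hy) r = germ (h.mem_open T.2 hy) r') : germ hy r = germ hy r' :=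
  sp_injective h (by rw [sp_germ, sp_germ, e])

lemma eq_of_germ_generic_eq {ξ : X} {T : X.Opens} (hT : ∀ y ∈ T, ξ ⤳ y) {r r' : Γ(X, T)}
    (H : ∀ hξ : ξ ∈ T, germ hξ r = germ hξ r') : r = r' :=
  resR_ext _ _ fun y hy =>
    exists_resR_eq hy r r' (germ_eq_of_specializes (hT y hy) hy (H _))

/-- The smaller open set contains the generic point of every component that meets T, and each stalk
embeds in the stalk at its generic point. -/
lemma resR_injective_of_dense [NoetherianSpace X] {U : X.Opens} (hU : Dense (U : Set X))
    {T T' : X.Opens} (hT : T ⊓ U ≤ T') (h : T' ≤ T) {r r' : Γ(X, T)} (e : resR h r = resR h r') :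
    r = r' := by
  refine resR_ext _ _ fun y hy => exists_resR_eq hy r r' ?_
  obtain ⟨ξ, hξ⟩ := exists_isGenericFor y
  refine germ_eq_of_specializes hξ.specializes hy ?_
  have hξT' : ξ ∈ T' := hT ⟨hξ.specializes.mem_open T.2 hy, hξ.mem_of_dense hU⟩
  rw [← germ_resR h hξT', ← germ_resR h hξT', e]

/-- The height one points in the complement of an open subset. -/
def boundaryPoints (U : X.Opens) : Set X :=
  {η | η ∉ U ∧ ∃ (ξ : X) (h : IsGenericFor ξ η) (π : (X.presheaf.stalk ξ)ˣ),
    IsUniformizer h.specializes π}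

/-- A height-one point outside U has only itself and ξ as generizations, and ξ lies in U by density.
So it is a generic point of the complement, and there are finitely many of these. -/
lemma finite_boundaryPoints [NoetherianSpace X] {U : X.Opens} (hU : Dense (U : Set X)) :
    (boundaryPoints U).Finite := by
  obtain ⟨S, hS, hSZ, H⟩ := exists_finite_specializes U.2.isClosed_compl
  refine hS.subset ?_
  rintro η ⟨hη, ξ, h, π, hπ⟩
  obtain ⟨s, hs, hsη⟩ := H η hη
  obtain rfl | rfl := hπ.eq_or_eq s hsη
  · exact hs
  · exact absurd (h.mem_of_dense hU) (hSZ hs)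
end
end SimplicialPic

/-! ### Compatible families of local sections -/

namespace SimplicialPic
noncomputable section
variable {X : Scheme.{u}} {N : X.Modules}

lemma isUnit_resR {U V : X.Opens} (h : V ≤ U) {r : Γ(X, U)} (hr : IsUnit r) : IsUnit (resR h r) :=
  hr.map (X.presheaf.map (homOfLE h).op).hom

lemma IsGen.exists_isUnit_smul {U : X.Opens} {s t : Γ(N, U)} (hs : IsGen s) (ht : IsGen t) :
    ∃ r : Γ(X, U), IsUnit r ∧ t = r • s := by
  obtain ⟨r, hr⟩ := hs.exists_smul t
  obtain ⟨r', hr'⟩ := ht.exists_smul s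
  refine ⟨r, IsUnit.of_mul_eq_one r' (hs.eq_of_smul ?_), hr⟩
  rw [mul_comm, mul_smul, ← hr, ← hr', one_smul]

lemma IsGen.smul_isUnit {U : X.Opens} {s : Γ(N, U)} (hs : IsGen s) {r : Γ(X, U)} (hr : IsUnit r) :
    IsGen (r • s) := by
  intro V h
  have hb := hs V h
  obtain ⟨v, hv⟩ := isUnit_resR h hr
  have e : (fun r' : Γ(X, V) => r' • SimplicialPic.res h (r • s)) =
      (fun r' : Γ(X, V) => r' • SimplicialPic.res h s) ∘ (fun r' => r' * (v : Γ(X, V))) := by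
    ext r'
    simp only [Function.comp_apply, res_smul, smul_smul, hv]
  rw [e]
  exact hb.comp v.mulRight_bijective

/-- Two local sections are compatible if locally they differ by a unit. -/
def Compat (a b : Σ T : X.Opens, Γ(N, T)) : Prop :=
  ∀ z ∈ a.1, z ∈ b.1 → ∃ (W : X.Opens) (h : W ≤ a.1) (h' : W ≤ b.1) (r : Γ(X, W)),
    z ∈ W ∧ IsUnit r ∧ res h' b.2 = r • res h a.2

lemma Compat.refl (a : Σ T : X.Opens, Γ(N, T)) : Compat a a := fun _ hz _ =>
  ⟨a.1, le_rfl, le_rfl, 1, hz, isUnit_one, (one_smul _ _).symm⟩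

lemma Compat.symm {a b : Σ T : X.Opens, Γ(N, T)} (h : Compat a b) : Compat b a := by
  intro z hb ha
  obtain ⟨W, h1, h2, r, hz, hr, e⟩ := h z ha hb
  obtain ⟨r, rfl⟩ := hr
  refine ⟨W, h2, h1, (r⁻¹ : Γ(X, W)ˣ), hz, Units.isUnit _, ?_⟩
  rw [e, smul_smul, Units.inv_mul, one_smul]

section
variable {ξ : X} {T₀ : X.Opens} {σ : Γ(N, T₀)} {a b : Σ T : X.Opens, Γ(N, T)}

/-- The germ of `a` at `ξ` is `f σ`. -/
def Coef (ξ : X) (σ : Γ(N, T₀)) (a : Σ T : X.Opens, Γ(N, T)) (f : (X.presheaf.stalk ξ)ˣ) : Prop :=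
  ∃ (W : X.Opens) (h : W ≤ a.1) (h' : W ≤ T₀) (hξ : ξ ∈ W) (r : Γ(X, W)),
    germ hξ r = f ∧ res h a.2 = r • res h' σ

lemma Compat.exists_coef (h : Compat ⟨T₀, σ⟩ a) (h₀ : ξ ∈ T₀) (ha : ξ ∈ a.1) : ∃ f, Coef ξ σ a f := by
  obtain ⟨W, h1, h2, r, hz, hr, e⟩ := h ξ h₀ ha
  exact ⟨(hr.map (germ hz)).unit, W, h2, h1, hz, r, rfl, e⟩

lemma Coef.smul {f : (X.presheaf.stalk ξ)ˣ} (hf : Coef ξ σ a f) {W : X.Opens} (h : W ≤ a.1)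
    (h' : W ≤ b.1) {r : Γ(X, W)} (hr : IsUnit r) (hξ : ξ ∈ W) (e : res h' b.2 = r • res h a.2) :
    Coef ξ σ b ((hr.map (germ hξ)).unit * f) := by
  obtain ⟨W', k, k', hξ', r', hr', e'⟩ := hf
  refine ⟨W ⊓ W', inf_le_left.trans h', inf_le_right.trans k', ⟨hξ, hξ'⟩,
    resR inf_le_left r * resR inf_le_right r', ?_, ?_⟩
  · rw [map_mul]
    erw [germ_resR, germ_resR]
    rw [hr']
    rfl
  · rw [← res_res h' inf_le_left, e, res_smul, res_res, ← res_res k inf_le_right, e', res_smul,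
      res_res, smul_smul]

lemma Coef.unique (hσ : IsGen σ) {f f' : (X.presheaf.stalk ξ)ˣ} (hf : Coef ξ σ a f)
    (hf' : Coef ξ σ a f') : f = f' := by
  obtain ⟨W, h1, h2, hξ, r, hr, e⟩ := hf
  obtain ⟨W', h1', h2', hξ', r', hr', e'⟩ := hf'
  have : resR inf_le_left r = resR inf_le_right r' := by
    refine (hσ.res ((inf_le_left : W ⊓ W' ≤ W).trans h2)).eq_of_smul ?_
    rw [← res_res h2 inf_le_left, ← res_smul, ← e, res_res, res_res,
      ← res_res h2' inf_le_right, ← res_smul, ← e', res_res]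
  have hm : ξ ∈ W ⊓ W' := ⟨hξ, hξ'⟩
  ext
  rw [← hr, ← hr', ← germ_resR inf_le_left hm, this, germ_resR]
end

section
variable [NoetherianSpace X] [hreg : ∀ x : X, IsRegularLocalRing (X.presheaf.stalk x)]

/-- A family of compatible local sections which contains a generator `σ` at the generic point `ξ`
is generated by one multiple of `σ` at all generizations of a given point. -/
lemma exists_common_coef {ξ x : X} (hξ : IsGenericFor ξ x) {T₀ : X.Opens} {σ : Γ(N, T₀)}
    (hσ : IsGen σ) (hξT : ξ ∈ T₀) (G : Set (Σ T : X.Opens, Γ(N, T)))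
    (hG : ∀ a ∈ G, ∀ b ∈ G, Compat a b) (hσG : ⟨T₀, σ⟩ ∈ G) :
    ∃ h : (X.presheaf.stalk ξ)ˣ, ∀ y (hy : y ⤳ x), ∀ a ∈ G, y ∈ a.1 → ∃ f, Coef ξ σ a f ∧
      f / h ∈ unitsAt (hξ.of_specializes y hy) := by
  let A (h : (X.presheaf.stalk ξ)ˣ) (y : X) : Prop := ∃ hy : y ⤳ x, ∃ a ∈ G, y ∈ a.1 ∧
    ∃ f, Coef ξ σ a f ∧ f / h ∈ unitsAt (hξ.of_specializes y hy)
  have hex {y : X} (hy : y ⤳ x) {a} (ha : a ∈ G) (hya : y ∈ a.1) : ∃ f, Coef ξ σ a f :=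
    (hG _ hσG _ ha).exists_coef hξT ((hξ.of_specializes y hy).mem_open a.1.2 hya)
  have hind {h : (X.presheaf.stalk ξ)ˣ} {y : X} (hyA : A h y) (hy : y ⤳ x) {b} (hb : b ∈ G)
      (hyb : y ∈ b.1) {f'} (hf' : Coef ξ σ b f') :
      f' / h ∈ unitsAt (hξ.of_specializes y hy) := by
    obtain ⟨_, a, ha, hya, f, hf, hm⟩ := hyA
    obtain ⟨W, h1, h2, r, hyW, hr, e⟩ := hG a ha b hb y hya hyb
    have := hf.smul h1 h2 hr ((hξ.of_specializes y hy).mem_open W.2 hyW) e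
    rw [hf'.unique hσ this, mul_div_assoc]
    refine mul_mem ?_ hm
    exact mem_unitsAt_of_isUnit _ (germ hyW r) (hr.map _) (sp_germ _ _ _)
  -- `O h` is the largest open set such that h works at each generization of x in it covered by G.
  -- Working at y is an open condition by `hAO`, so O records all good points, and noetherianity
  -- provides an h with `O h` maximal.
  let S (h : (X.presheaf.stalk ξ)ˣ) : Set (Opens X) :=
    {T | ∀ y ∈ T, y ⤳ x → (∃ a ∈ G, y ∈ a.1) → A h y}
  let O (h : (X.presheaf.stalk ξ)ˣ) : Opens X := sSup (S h)
  have hOA {h y} (hyO : y ∈ O h) (hy : y ⤳ x) (hV : ∃ a ∈ G, y ∈ a.1) : A h y := by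
    obtain ⟨T, hT, hyT⟩ := Opens.mem_sSup.1 hyO
    exact hT y hyT hy hV
  have hAO {h y} (hyA : A h y) : y ∈ O h := by
    obtain ⟨hy, a, ha, hya, f, hf, hm⟩ := hyA
    obtain ⟨T, hyT, hTa, r, hr, e⟩ := exists_isUnit_germ_eq _ hm hya
    refine Opens.mem_sSup.2 ⟨T, fun z hzT hz _ => ⟨hz, a, ha, hTa hzT, f, hf, ?_⟩, hyT⟩
    exact mem_unitsAt_of_isUnit _ (germ hzT r) (hr.map _) (by rw [sp_germ, e])
  obtain ⟨_, ⟨h, rfl⟩, hmax⟩ := (wellFounded_gt (α := Opens X)).has_min (Set.range O) ⟨_, 1, rfl⟩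
  refine ⟨h, fun y hy a ha hya => ?_⟩
  obtain ⟨f, hf⟩ := hex hy ha hya
  refine ⟨f, hf, ?_⟩
  by_contra hn
  obtain ⟨η, hη, π, h1, h2, h3⟩ := exists_isUniformizer hξ hy _ hn
  obtain ⟨n, hn⟩ := h2.exists_zpow (f / h)
  have hηa : η ∈ a.1 := hη.mem_open a.1.2 hya
  have hηA : ¬ A h η := fun hA => h3 (hind hA (hη.trans hy) ha hηa hf)
  -- The correction cancels the order at η: dividing f by the new h gives (f / h) πⁿ, a unit at η by
  -- the choice of n.
  have hηA' : A (h * π ^ (-n)) η := by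
    refine ⟨hη.trans hy, a, ha, hηa, f, hf, ?_⟩
    convert hn using 1
    rw [zpow_neg, ← div_eq_mul_inv, div_div_eq_mul_div, div_mul_eq_mul_div]
  -- A point z where h works is not a specialization of η, since a unit at z is a unit at its
  -- generizations and h fails at η. So π is a unit at z and the correction does no harm.
  have hle (z) (hz : A h z) : A (h * π ^ (-n)) z := by
    obtain ⟨hzx, b, hb, hzb, f', hf', hm⟩ := id hz
    refine ⟨hzx, b, hb, hzb, f', hf', ?_⟩
    have : ¬ η ⤳ z := fun hηz => hηA ⟨hη.trans hy, b, hb, hηz.mem_open b.1.2 hzb, f', hf',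
      unitsAt_mono _ _ hηz hm⟩
    have := zpow_mem (h1 z hzx this) n
    convert mul_mem hm this using 1
    rw [zpow_neg, ← div_eq_mul_inv, div_div_eq_mul_div, div_mul_eq_mul_div]
  refine hmax _ ⟨h * π ^ (-n), rfl⟩ (lt_of_le_of_ne ?_ ?_)
  · refine sSup_le_sSup fun T hT y hyT hyx hyV => hle y (hT y hyT hyx hyV)
  · intro e
    refine hηA (hOA ?_ (hη.trans hy) ⟨a, ha, hηa⟩)
    rw [e]
    exact hAO hηA'

/-- The new section is hσ, with h from `exists_common_coef`. It differs by a unit from each member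
of G at the generizations of x covered by G, hence on W ⊓ V for some neighbourhood W of x. The
hypothesis `hext`, satisfied by a push-forward from U, carries it across the remaining part of W. -/
lemma exists_extend {U : X.Opens} (hU : Dense (U : Set X))
    (hgen : ∀ y ∈ U, ∃ (T : X.Opens) (s : Γ(N, T)), y ∈ T ∧ T ≤ U ∧ IsGen s)
    (hext : ∀ (W V : X.Opens), U ≤ V → ∀ s : Γ(N, W ⊓ V), ∃ t : Γ(N, W), res inf_le_left t = s)
    (G : Set (Σ T : X.Opens, Γ(N, T))) (hG : ∀ a ∈ G, ∀ b ∈ G, Compat a b)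
    (hUG : ∀ (T : X.Opens) (s : Γ(N, T)), T ≤ U → IsGen s → ⟨T, s⟩ ∈ G) (x : X) :
    ∃ b : Σ T : X.Opens, Γ(N, T), x ∈ b.1 ∧ ∀ a ∈ G, Compat b a := by
  obtain ⟨ξ, hξ⟩ := exists_isGenericFor x
  obtain ⟨T₀, σ, hξT, hT₀, hσ⟩ := hgen ξ (hξ.mem_of_dense hU)
  obtain ⟨h, hh⟩ := exists_common_coef hξ hσ hξT G hG (hUG T₀ σ hT₀ hσ)
  obtain ⟨W₀, hxW₀, hW₀⟩ := exists_open_isGenericFor hξ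
  let V : X.Opens := ⨆ a : G, a.1.1
  have hUV : U ≤ V := by
    intro y hy
    obtain ⟨T, s, hyT, hT, hs⟩ := hgen y hy
    exact Opens.mem_iSup.2 ⟨⟨_, hUG T s hT hs⟩, hyT⟩
  -- This expresses s = hσ by way of a member a of G: generically a = fσ, so a = (f / h) s, with f /
  -- h represented by a unit r on T. The bound by W₀ makes every comparison of functions a
  -- comparison of germs at ξ.
  let P (T : X.Opens) (s : Γ(N, T)) : Prop := T ≤ W₀ ∧ ∃ a ∈ G, ∃ (hT : T ≤ a.1) (f : _) (r : Γ(X, T)),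
    Coef ξ σ a f ∧ IsUnit r ∧ (∀ hξ : ξ ∈ T, germ hξ r = (f / h : (X.presheaf.stalk ξ)ˣ)) ∧
      res hT a.2 = r • s
  have hPres (T T' : X.Opens) (hT : T' ≤ T) (s) (hs : P T s) : P T' (res hT s) := by
    obtain ⟨hTW, a, ha, hTa, f, r, hf, hr, hrf, e⟩ := hs
    exact ⟨hT.trans hTW, a, ha, hT.trans hTa, f, resR hT r, hf, isUnit_resR hT hr,
      fun hξ => by rw [germ_resR, hrf], by rw [← res_res hTa hT, e, res_smul]⟩
  have hPuniq (T : X.Opens) (s s') (hs : P T s) (hs' : P T s') : s = s' := by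
    obtain ⟨hTW, a, ha, hTa, f, r, hf, hr, hrf, e⟩ := hs
    obtain ⟨-, b, hb, hTb, f', r', hf', hr', hrf', e'⟩ := hs'
    refine res_ext _ _ fun z hz => ?_
    obtain ⟨W, h1, h2, u, hzW, hu, eab⟩ := hG a ha b hb z (hTa hz) (hTb hz)
    refine ⟨W ⊓ T, inf_le_right, ⟨hzW, hz⟩, ?_⟩
    have hr'' : resR inf_le_right r' = resR (inf_le_left : W ⊓ T ≤ W) u * resR inf_le_right r := by
      refine eq_of_germ_generic_eq (ξ := ξ) (T := W ⊓ T) (fun y hy => (hW₀ y (hTW hy.2)).specializes) ?_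
      intro hm
      rw [map_mul, germ_resR, germ_resR, germ_resR, hrf, hrf',
        hf'.unique hσ (hf.smul h1 h2 hu hm.1 eab), mul_div_assoc, Units.val_mul]
      rfl
    refine (isUnit_resR (inf_le_right : W ⊓ T ≤ T) hr').smul_left_cancel.1 (Eq.symm ?_)
    rw [← res_smul, ← e', res_res, ← res_res h2 inf_le_left, eab, res_smul, res_res,
      ← res_res hTa inf_le_right, e, res_smul, smul_smul, hr'']
  let O : X.Opens := sSup {T | ∃ s, P T s}
  -- The open set O, where hσ exists locally, contains all generizations of x that lie in V, hence
  -- all points of V close to x.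
  obtain ⟨W, hxW, hWO⟩ := exists_inf_le_of_specializes (O := O) (V := V) x (by
    intro y hyV hyx
    obtain ⟨⟨a, ha⟩, hya⟩ := Opens.mem_iSup.1 hyV
    obtain ⟨f, hf, hm⟩ := hh y hyx a ha hya
    obtain ⟨T, hyT, hT, r, hr, e⟩ := exists_isUnit_germ_eq _ hm
      (V := a.1 ⊓ W₀) ⟨hya, hyx.mem_open W₀.2 hxW₀⟩
    obtain ⟨r, rfl⟩ := hr
    refine Opens.mem_sSup.2 ⟨T, ⟨(r⁻¹ : Γ(X, T)ˣ).1 • res (hT.trans inf_le_left) a.2,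
      hT.trans inf_le_right, a, ha, hT.trans inf_le_left, f, r, hf, r.isUnit, fun _ => e, ?_⟩, hyT⟩
    rw [smul_smul, Units.mul_inv, one_smul])
  have hPex : ∀ z ∈ W ⊓ V, ∃ T : X.Opens, T ≤ W ⊓ V ∧ z ∈ T ∧ ∃ s, P T s := by
    intro z hz
    obtain ⟨T, ⟨s, hs⟩, hzT⟩ := Opens.mem_sSup.1 (hWO hz)
    exact ⟨T ⊓ (W ⊓ V), inf_le_right, ⟨hzT, hz⟩, _, hPres _ _ inf_le_left _ hs⟩
  obtain ⟨s, hs⟩ := res_glue (M := N) (U := W ⊓ V) P hPres hPuniq hPex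
  -- Nothing is asserted about t outside V; compatibility with G is tested only where members of G
  -- are defined, which is inside V.
  obtain ⟨t, rfl⟩ := hext W V hUV s
  refine ⟨⟨W, t⟩, hxW, fun b hb z hzW hzb => ?_⟩
  have hzV : z ∈ V := Opens.mem_iSup.2 ⟨⟨b, hb⟩, hzb⟩
  obtain ⟨T, hT, hzT, s, hPs⟩ := hPex z ⟨hzW, hzV⟩
  have hst := hs T hT s hPs
  obtain ⟨-, a, ha, hTa, f, r, hf, hr, hrf, e⟩ := hPs
  obtain ⟨W', h1, h2, u, hzW', hu, eab⟩ := hG a ha b hb z (hTa hzT) hzb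
  refine ⟨W' ⊓ T, (inf_le_right.trans hT).trans inf_le_left, inf_le_left.trans h2,
    resR inf_le_left u * resR inf_le_right r, ⟨hzW', hzT⟩,
    (isUnit_resR _ hu).mul (isUnit_resR _ hr), ?_⟩
  rw [← res_res h2 inf_le_left, eab, res_smul, res_res, ← res_res hTa inf_le_right, e, res_smul,
    ← hst, res_res, res_res, smul_smul]

/-- Zorn's lemma, starting from all generators over open subsets of U; any two of these differ by a
unit where both are defined. A maximal family covers every x, as `exists_extend` would otherwise
enlarge it. -/
lemma exists_compat_cover {U : X.Opens} (hU : Dense (U : Set X))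
    (hgen : ∀ y ∈ U, ∃ (T : X.Opens) (s : Γ(N, T)), y ∈ T ∧ T ≤ U ∧ IsGen s)
    (hext : ∀ (W V : X.Opens), U ≤ V → ∀ s : Γ(N, W ⊓ V), ∃ t : Γ(N, W), res inf_le_left t = s) :
    ∃ G : Set (Σ T : X.Opens, Γ(N, T)), (∀ a ∈ G, ∀ b ∈ G, Compat a b) ∧
      (∀ (T : X.Opens) (s : Γ(N, T)), T ≤ U → IsGen s → ⟨T, s⟩ ∈ G) ∧
      ∀ x : X, ∃ a ∈ G, x ∈ a.1 := by
  let G₀ : Set (Σ T : X.Opens, Γ(N, T)) := Set.ofPred fun a => a.1 ≤ U ∧ IsGen a.2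
  obtain ⟨G, hG₀, hmax⟩ := zorn_subset_nonempty
    (Set.ofPred fun G : Set (Σ T : X.Opens, Γ(N, T)) => ∀ a ∈ G, ∀ b ∈ G, Compat a b) (by
      intro c hc hchain hne
      refine ⟨⋃₀ c, ?_, fun s hs => Set.subset_sUnion_of_mem hs⟩
      rintro a ⟨s, hs, ha⟩ b ⟨t, ht, hb⟩
      obtain h | h := hchain.total hs ht
      · exact hc ht a (h ha) b hb
      · exact hc hs a ha b (h hb)) G₀ (by
      rintro a ⟨-, ha⟩ b ⟨-, hb⟩ z hza hzb
      obtain ⟨r, hr, e⟩ := (ha.res (inf_le_left : a.1 ⊓ b.1 ≤ a.1)).exists_isUnit_smul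
        (hb.res inf_le_right)
      exact ⟨a.1 ⊓ b.1, inf_le_left, inf_le_right, r, ⟨hza, hzb⟩, hr, e⟩)
  have hUG (T : X.Opens) (s : Γ(N, T)) (hT : T ≤ U) (hs : IsGen s) :
      (⟨T, s⟩ : Σ T : X.Opens, Γ(N, T)) ∈ G := hG₀ ⟨hT, hs⟩
  refine ⟨G, hmax.1, hUG, fun x => ?_⟩
  obtain ⟨b, hxb, hb⟩ := exists_extend hU hgen hext G hmax.1 hUG x
  refine ⟨b, hmax.2 (y := insert b G) ?_ (Set.subset_insert _ _) (Set.mem_insert _ _), hxb⟩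
  rintro a (rfl | ha) c (rfl | hc)
  · exact Compat.refl _
  · exact hb c hc
  · exact (hb a ha).symm
  · exact hmax.1 a ha c hc
end
end
end SimplicialPic

/-! ### Sheaves spanned by compatible families and extension of line bundles -/

namespace SimplicialPic
noncomputable section
open Scheme.Modules (pullback pushforward pullbackPushforwardAdjunction pullbackComp)

section
variable {X : Scheme.{u}} {N : X.Modules}

/-- A subsheaf of modules, given by its sections. -/
structure Subsheaf (N : X.Modules) where
  sec : ∀ T : X.Opens, Submodule Γ(X, T) Γ(N, T)
  res_mem : ∀ {U V : X.Opens} (h : V ≤ U) {s : Γ(N, U)}, s ∈ sec U → res h s ∈ sec V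
  mem_of_locally : ∀ {U : X.Opens} {s : Γ(N, U)}, (∀ x ∈ U, ∃ (V : X.Opens) (h : V ≤ U), x ∈ V ∧
    res h s ∈ sec V) → s ∈ sec U

namespace Subsheaf
variable (Q : Subsheaf N)

/-- Restriction of sections. -/
def resHom {U V : X.Opens} (h : V ≤ U) : Q.sec U →+ Q.sec V where
  toFun s := ⟨res h s.1, Q.res_mem h s.2⟩
  map_zero' := Subtype.ext (res_zero h)
  map_add' s t := Subtype.ext (res_add h s.1 t.1)

lemma resHom_id {U : X.Opens} (h : U ≤ U) (s : Q.sec U) : Q.resHom h s = s :=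
  Subtype.ext (res_self h s.1)

lemma resHom_comp {U V W : X.Opens} (h : V ≤ U) (h' : W ≤ V) (s : Q.sec U) :
    Q.resHom (h'.trans h) s = Q.resHom h' (Q.resHom h s) :=
  Subtype.ext (res_res h h' s.1).symm

/-- The underlying presheaf. -/
def presheaf : TopCat.Presheaf Ab.{u} X where
  obj U := AddCommGrpCat.of (Q.sec U.unop)
  map i := AddCommGrpCat.ofHom (Q.resHom i.unop.le)
  map_id U := by
    ext s
    exact congrArg Subtype.val (Q.resHom_id le_rfl s)
  map_comp i i' := by
    ext s
    exact congrArg Subtype.val (Q.resHom_comp i.unop.le i'.unop.le s)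

lemma presheaf_isSheaf : Q.presheaf.IsSheaf := by
  rw [TopCat.Presheaf.isSheaf_iff_isSheaf_comp (forget Ab)]
  apply TopCat.Presheaf.isSheaf_of_isSheafUniqueGluing_types
  intro ι B sf hsf
  change ∀ i, Q.sec (B i) at sf
  have compat (i j : ι) : res inf_le_left (sf i).1 = res (inf_le_right : B i ⊓ B j ≤ B j) (sf j).1 :=
    congrArg Subtype.val (hsf i j)
  obtain ⟨s, hs⟩ := res_glue (M := N) (U := iSup B)
    (fun W b => ∃ (i : ι) (hi : W ≤ B i), b = res hi (sf i).1)
    (by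
      rintro V W h _ ⟨i, hi, rfl⟩
      exact ⟨i, h.trans hi, res_res ..⟩)
    (by
      rintro W _ _ ⟨i, hi, rfl⟩ ⟨j, hj, rfl⟩
      rw [← res_res inf_le_left (le_inf hi hj), compat, res_res])
    (by
      intro x hx
      obtain ⟨i, hi⟩ := Opens.mem_iSup.1 hx
      exact ⟨B i, le_iSup B i, hi, _, i, le_rfl, rfl⟩)
  have hs' (i) : res (le_iSup B i) s = (sf i).1 :=
    hs (B i) (le_iSup B i) _ ⟨i, le_rfl, (res_self _ _).symm⟩
  refine ⟨(⟨s, Q.mem_of_locally fun x hx => ?_⟩ : Q.sec (iSup B)), fun i => ?_, fun s' hs'' => ?_⟩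
  · obtain ⟨i, hi⟩ := Opens.mem_iSup.1 hx
    exact ⟨B i, le_iSup B i, hi, by rw [hs' i]; exact (sf i).2⟩
  · exact Subtype.ext (hs' i)
  · change Q.sec (iSup B) at s'
    refine Subtype.ext (res_ext _ _ fun x hx => ?_)
    obtain ⟨i, hi⟩ := Opens.mem_iSup.1 hx
    refine ⟨B i, le_iSup B i, hi, ?_⟩
    rw [hs' i]
    exact congrArg Subtype.val (hs'' i)

/-- The sheaf of modules attached to a subsheaf. -/
def toModules : X.Modules where
  val :=
    { obj := fun U => ModuleCat.of Γ(X, U.unop) (Q.sec U.unop)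
      map := fun {U V} i => ModuleCat.ofHom (R := Γ(X, U.unop))
        (Y := (ModuleCat.restrictScalars (X.presheaf.map i).hom).obj
          (ModuleCat.of Γ(X, V.unop) (Q.sec V.unop)))
        { toFun := Q.resHom i.unop.le
          map_add' := map_add _
          map_smul' := fun r l => Subtype.ext (res_smul i.unop.le r l.1) }
      map_id := fun U => by
        ext s
        exact Q.resHom_id le_rfl s
      map_comp := fun i i' => by
        ext s
        exact Q.resHom_comp i.unop.le i'.unop.le s }
  isSheaf := Q.presheaf_isSheaf

/-- A section of `N` in the subsheaf as a section of the subsheaf. -/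
def mkSec {U : X.Opens} (s : Γ(N, U)) (hs : s ∈ Q.sec U) : Γ(Q.toModules, U) :=
  (⟨s, hs⟩ : Q.sec U)

/-- The underlying section of `N`. -/
def val {U : X.Opens} (s : Γ(Q.toModules, U)) : Γ(N, U) := (show Q.sec U from s).1

lemma val_mem {U : X.Opens} (s : Γ(Q.toModules, U)) : Q.val s ∈ Q.sec U :=
  (show Q.sec U from s).2

lemma val_injective {U : X.Opens} {s t : Γ(Q.toModules, U)} (h : Q.val s = Q.val t) : s = t :=
  Subtype.ext (a1 := (show Q.sec U from s)) h

/-- The inclusion. -/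
def incl : Q.toModules ⟶ N :=
  mkHom (fun _ s => Q.val s) (fun _ _ _ => rfl) (fun _ _ _ => rfl) (fun _ _ _ _ => rfl)

end Subsheaf

/-- The subsheaf of sections which are locally multiples of members of a compatible family. -/
def spanSubsheaf (G : Set (Σ T : X.Opens, Γ(N, T))) : Subsheaf N where
  sec T :=
    { carrier := {s | ∀ x ∈ T, ∀ a ∈ G, x ∈ a.1 → ∃ (W : X.Opens) (h : W ≤ T) (h' : W ≤ a.1)
        (r : Γ(X, W)), x ∈ W ∧ res h s = r • res h' a.2}
      add_mem' := by
        intro s t hs ht x hx a ha hxa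
        obtain ⟨W, h, h', r, hxW, e⟩ := hs x hx a ha hxa
        obtain ⟨W', k, k', r', hxW', e'⟩ := ht x hx a ha hxa
        refine ⟨W ⊓ W', inf_le_left.trans h, inf_le_left.trans h',
          resR inf_le_left r + resR inf_le_right r', ⟨hxW, hxW'⟩, ?_⟩
        rw [res_add, ← res_res h inf_le_left, e, ← res_res k inf_le_right, e', res_smul, res_smul,
          res_res, res_res, add_smul]
      zero_mem' := by
        intro x hx a ha hxa
        exact ⟨T ⊓ a.1, inf_le_left, inf_le_right, 0, ⟨hx, hxa⟩, by rw [res_zero, zero_smul]⟩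
      smul_mem' := by
        intro c s hs x hx a ha hxa
        obtain ⟨W, h, h', r, hxW, e⟩ := hs x hx a ha hxa
        exact ⟨W, h, h', resR h c * r, hxW, by rw [res_smul, e, smul_smul]⟩ }
  res_mem := by
    intro U V k s hs x hx a ha hxa
    obtain ⟨W, h, h', r, hxW, e⟩ := hs x (k hx) a ha hxa
    refine ⟨W ⊓ V, inf_le_right, inf_le_left.trans h', resR inf_le_left r, ⟨hxW, hx⟩, ?_⟩
    rw [res_res, ← res_res h inf_le_left, e, res_smul, res_res]
  mem_of_locally := by
    intro U s hs x hx a ha hxa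
    obtain ⟨V, hV, hxV, hs⟩ := hs x hx
    obtain ⟨W, h, h', r, hxW, e⟩ := hs x hxV a ha hxa
    exact ⟨W, h.trans hV, h', r, hxW, by rw [← res_res hV h, e]⟩

lemma mem_spanSubsheaf (G : Set (Σ T : X.Opens, Γ(N, T))) (hG : ∀ a ∈ G, ∀ b ∈ G, Compat a b)
    {a : Σ T : X.Opens, Γ(N, T)} (ha : a ∈ G) : a.2 ∈ (spanSubsheaf G).sec a.1 := by
  intro x hx b hb hxb
  obtain ⟨W, h, h', r, hxW, -, e⟩ := hG b hb a ha x hxb hx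
  exact ⟨W, h', h, r, hxW, e⟩

/-- That a generates is built into the subsheaf. That multiplication by a is injective is tested on
the dense open U, where a is locally a unit times a generator. -/
lemma isGen_spanSubsheaf [NoetherianSpace X] [∀ x : X, IsRegularLocalRing (X.presheaf.stalk x)]
    {U : X.Opens} (hU : Dense (U : Set X)) (G : Set (Σ T : X.Opens, Γ(N, T)))
    (hG : ∀ a ∈ G, ∀ b ∈ G, Compat a b) (hgen : ∀ y ∈ U, ∃ a ∈ G, y ∈ a.1 ∧ IsGen a.2)
    {a : Σ T : X.Opens, Γ(N, T)} (ha : a ∈ G) :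
    IsGen ((spanSubsheaf G).mkSec a.2 (mem_spanSubsheaf G hG ha)) := by
  refine isGen_of_locally (fun V h r r' e x hx => ⟨V, le_rfl, hx, ?_⟩) fun V h b x hx => ?_
  · have e : r • res h a.2 = r' • res h a.2 := congrArg (spanSubsheaf G).val e
    rw [resR_self, resR_self]
    refine resR_injective_of_dense hU le_rfl (inf_le_left : V ⊓ U ≤ V) (resR_ext _ _ fun y hy => ?_)
    obtain ⟨b, hb, hyb, hgb⟩ := hgen y hy.2
    obtain ⟨W, h1, h2, u, hyW, hu, eu⟩ := hG b hb a ha y hyb (h hy.1)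
    refine ⟨W ⊓ (V ⊓ U), inf_le_right, ⟨hyW, hy⟩, ?_⟩
    rw [resR_res, resR_res]
    have le : W ⊓ (V ⊓ U) ≤ V := inf_le_right.trans inf_le_left
    have e1 := congrArg (res le) e
    rw [res_smul, res_smul, res_res, ← res_res h2 inf_le_left, eu] at e1
    exact ((hgb.res h1).smul_isUnit hu |>.res inf_le_left).eq_of_smul e1
  · obtain ⟨W, k, k', r, hxW, e⟩ := (spanSubsheaf G).val_mem b x hx a ha (h hx)
    exact ⟨W, k, hxW, r, (spanSubsheaf G).val_injective e⟩
end

section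
variable {U X : Scheme.{u}} (j : U ⟶ X) [IsOpenImmersion j] {L : U.Modules}

lemma bijective_app_of_le_opensRange {V : X.Opens} (hV : V ≤ j.opensRange) :
    Function.Bijective (j.app V) :=
  (ConcreteCategory.isIso_iff_bijective (j.app V)).1 (j.isIso_app V hV)

lemma isGen_pushforward {T : X.Opens} (hT : T ≤ j.opensRange) (s : Γ(L, j ⁻¹ᵁ T)) (hs : IsGen s) :
    IsGen (show Γ((pushforward j).obj L, T) from s) := by
  intro V h
  exact (hs (j ⁻¹ᵁ V) (j.preimage_mono h)).comp
    (bijective_app_of_le_opensRange j (h.trans hT))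

/-- A line bundle on a dense open subscheme of a regular noetherian scheme extends. -/
theorem exists_extension [NoetherianSpace X] [∀ x : X, IsRegularLocalRing (X.presheaf.stalk x)]
    (hj : DenseRange j) (hL : IsLineBundle L) :
    ∃ M : X.Modules, IsLineBundle M ∧ Nonempty ((pullback j).obj M ≅ L) := by
  have hU : Dense (j.opensRange : Set X) := hj
  let N := (pushforward j).obj L
  have key (u : U) : ∃ (T : X.Opens) (hT : T ≤ j.opensRange) (s : Γ(L, j ⁻¹ᵁ T)), j u ∈ T ∧
      IsGen s := by
    obtain ⟨V, s, hu, hs⟩ := hL u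
    refine ⟨j ''ᵁ V, ?_, res (le_of_eq (j.preimage_image_eq V)) s, ⟨u, hu, rfl⟩, hs.res _⟩
    rintro _ ⟨v, -, rfl⟩
    exact ⟨v, rfl⟩
  have hgen : ∀ y ∈ j.opensRange, ∃ (T : X.Opens) (s : Γ(N, T)), y ∈ T ∧ T ≤ j.opensRange ∧
      IsGen s := by
    rintro _ ⟨u, rfl⟩
    obtain ⟨T, hT, s, hu, hs⟩ := key u
    exact ⟨T, s, hu, hT, isGen_pushforward j hT s hs⟩
  obtain ⟨G, hG, hUG, hcov⟩ := exists_compat_cover (N := N) hU hgen (by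
    intro W V hV s
    -- Since V contains the image of j, sections of the push-forward over W and over W ⊓ V are the
    -- same sections of L.
    have e : j ⁻¹ᵁ W ≤ j ⁻¹ᵁ (W ⊓ V) := fun u hu => ⟨hu, hV ⟨u, rfl⟩⟩
    refine ⟨res (M := L) e s, ?_⟩
    exact (res_res (M := L) e (j.preimage_mono inf_le_left) s).trans (res_self _ _))
  have hgenG : ∀ y ∈ j.opensRange, ∃ a ∈ G, y ∈ a.1 ∧ IsGen a.2 := by
    intro y hy
    obtain ⟨T, s, hyT, hT, hs⟩ := hgen y hy
    exact ⟨_, hUG T s hT hs, hyT, hs⟩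
  let Q := spanSubsheaf G
  have hQ {a} (ha : a ∈ G) := isGen_spanSubsheaf hU G hG hgenG ha
  refine ⟨Q.toModules, fun x => ?_, ?_⟩
  · obtain ⟨a, ha, hxa⟩ := hcov x
    exact ⟨a.1, _, hxa, hQ ha⟩
  -- The map is adjoint to the inclusion of Q in the push-forward of L. It is an isomorphism because
  -- each generator s of L over an open subset of U is in G, so it is the image of a generator of Q.
  · let φ : (pullback j).obj Q.toModules ⟶ L :=
      ((pullbackPushforwardAdjunction j).homEquiv _ _).symm Q.incl
    have hφ {T : X.Opens} (s : Γ(Q.toModules, T)) : φ.app _ (pb j s) = Q.val s := by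
      have h : (pullbackPushforwardAdjunction j).homEquiv _ _ φ = Q.incl :=
        Equiv.apply_symm_apply _ _
      rw [Adjunction.homEquiv_unit] at h
      exact congr((($h).app T) s)
    have : IsIso φ := isIso_of_isGen φ fun u => by
      obtain ⟨T, hT, s, hu, hs⟩ := key u
      have ha := hUG T s hT (isGen_pushforward j hT s hs)
      obtain ⟨q, hq, hv⟩ : ∃ q : Γ(Q.toModules, T), IsGen q ∧ Q.val q = s := ⟨_, hQ ha, rfl⟩
      refine ⟨j ⁻¹ᵁ T, pb j q, hu, hq.pb j, ?_⟩
      have e : φ.app (j ⁻¹ᵁ T) (pb j q) = s := (hφ q).trans hv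
      rw [e]
      exact hs
    exact ⟨asIso φ⟩
end
end
end SimplicialPic

/-! ### Orders of isomorphisms at boundary points -/

namespace SimplicialPic
noncomputable section
open Scheme.Modules (pullback pushforward pullbackPushforwardAdjunction pullbackComp)

section
variable {U X : Scheme.{u}} {j : U ⟶ X} {P P' Q Q' : X.Modules}

lemma app_resR (f : U ⟶ X) {V W : X.Opens} (h : W ≤ V) (h' : f ⁻¹ᵁ W ≤ f ⁻¹ᵁ V) (r : Γ(X, V)) :
    f.app W (resR h r) = resR h' (f.app V r) :=
  congr(($(f.naturality (homOfLE h).op)).hom r)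

lemma res_injective_of_le {M : X.Modules} {V W : X.Opens} (h : W ≤ V) (h' : V ≤ W) {s t : Γ(M, V)}
    (e : res h s = res h t) : s = t := by
  obtain rfl := le_antisymm h h'
  rwa [res_self, res_self] at e

variable (j) in
/-- `α` has order `h` at `η`: generators of `P` and `P'` near `η` can be chosen so that `α` becomes
multiplication by `h` at `ξ`. -/
def OrdRel (α : (pullback j).obj P ≅ (pullback j).obj P') (ξ η : X)
    (h : (X.presheaf.stalk ξ)ˣ) : Prop :=
  ∃ (V : X.Opens) (s : Γ(P, V)) (t : Γ(P', V)) (T : X.Opens) (hT : T ≤ V) (hξ : ξ ∈ T)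
    (r : Γ(X, T)), η ∈ V ∧ IsGen s ∧ IsGen t ∧ T ≤ Set.range j ∧ germ hξ r = h ∧
      α.hom.app (j ⁻¹ᵁ T) (pb j (res hT s)) = j.app T r • pb j (res hT t)

lemma app_pb_smul (φ : (pullback j).obj P ⟶ (pullback j).obj P') {V : X.Opens} (s : Γ(P, V))
    (t : Γ(P', V)) (c r : Γ(X, V)) (e : φ.app (j ⁻¹ᵁ V) (pb j s) = j.app V r • pb j t) :
    φ.app (j ⁻¹ᵁ V) (pb j (c • s)) = j.app V (c * r) • pb j t := by
  rw [pb_smul, Scheme.Modules.Hom.app_smul, e, smul_smul, map_mul]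

lemma app_pb_res (φ : (pullback j).obj P ⟶ (pullback j).obj P') {V W : X.Opens} (h : W ≤ V)
    (s : Γ(P, V)) (t : Γ(P', V)) (r : Γ(X, V)) (e : φ.app (j ⁻¹ᵁ V) (pb j s) = j.app V r • pb j t) :
    φ.app (j ⁻¹ᵁ W) (pb j (res h s)) = j.app W (resR h r) • pb j (res h t) := by
  have h' : j ⁻¹ᵁ W ≤ j ⁻¹ᵁ V := j.preimage_mono h
  rw [← res_pb j h h', ← res_pb j h h', app_res, e, res_smul, app_resR j h h']

/-- Rescaling the generator of P near η by a unit multiplies h by that unit. With `OrdRel.div_mem`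
this shows that h is determined exactly up to units at η, so that it represents an order. -/
lemma OrdRel.smul {α : (pullback j).obj P ≅ (pullback j).obj P'} {ξ η : X}
    {h : (X.presheaf.stalk ξ)ˣ} (H : OrdRel j α ξ η h) (hξη : ξ ⤳ η) {g : (X.presheaf.stalk ξ)ˣ}
    (hg : g ∈ unitsAt hξη) : OrdRel j α ξ η (g * h) := by
  obtain ⟨V, s, t, T, hT, hξ, r, hη, hs, ht, hTj, hr, e⟩ := H
  obtain ⟨W, hW, hWV, c, hc, hcg⟩ := exists_isUnit_germ_eq hξη hg hη
  have hξW := hξη.mem_open W.2 hW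
  refine ⟨W, c • res hWV s, res hWV t, T ⊓ W, inf_le_right, ⟨hξ, hξW⟩,
    resR inf_le_right c * resR inf_le_left r, hW, (hs.res _).smul_isUnit hc, ht.res _,
    fun x hx => hTj hx.1, ?_, ?_⟩
  · rw [map_mul, Units.val_mul, ← hcg, ← hr]
    erw [germ_resR, germ_resR]
  · rw [res_smul, res_res, res_res]
    refine app_pb_smul _ _ _ _ _ ?_
    have := app_pb_res α.hom (inf_le_left : T ⊓ W ≤ T) _ _ _ e
    rwa [res_res, res_res] at this

lemma ordRel_ten (hP : IsLineBundle P) (hP' : IsLineBundle P') (hQ : IsLineBundle Q)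
    (hQ' : IsLineBundle Q') {α : (pullback j).obj P ≅ (pullback j).obj P'}
    {β : (pullback j).obj Q ≅ (pullback j).obj Q'} {ξ η : X} {h k : (X.presheaf.stalk ξ)ˣ}
    (hα : OrdRel j α ξ η h) (hβ : OrdRel j β ξ η k) :
    OrdRel j (ten hP hQ hP' hQ' α β) ξ η (h * k) := by
  obtain ⟨V, s, t, T, hT, hξ, r, hη, hs, ht, hTj, hr, e⟩ := hα
  obtain ⟨V', s', t', T', hT', hξ', r', hη', hs', ht', hTj', hr', e'⟩ := hβ
  have hTV : T ⊓ T' ≤ V ⊓ V' := inf_le_inf hT hT'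
  refine ⟨V ⊓ V', tmul (res inf_le_left s) (res inf_le_right s'),
    tmul (res inf_le_left t) (res inf_le_right t'), T ⊓ T', hTV, ⟨hξ, hξ'⟩,
    resR inf_le_left r * resR inf_le_right r', ⟨hη, hη'⟩, (hs.res _).tmul (hs'.res _),
    (ht.res _).tmul (ht'.res _), fun x hx => hTj hx.1, ?_, ?_⟩
  · rw [map_mul, Units.val_mul, ← hr, ← hr']
    erw [germ_resR, germ_resR]
  · have := pbT_isIso j hP' hQ'
    have inj := ((ConcreteCategory.isIso_iff_bijective ((pbT j P' Q').app (j ⁻¹ᵁ (T ⊓ T')))).1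
      inferInstance).1
    apply inj
    have h1 := app_pb_res α.hom (inf_le_left : T ⊓ T' ≤ T) _ _ _ e
    have h2 := app_pb_res β.hom (inf_le_right : T ⊓ T' ≤ T') _ _ _ e'
    rw [res_res, res_res] at h1 h2
    rw [← comp_app_apply, ten_hom, comp_app_apply, res_tmul, pbT_pb, tensorMap_app, res_res,
      res_res, h1, h2, Scheme.Modules.Hom.app_smul, res_tmul, pbT_pb, smul_tmul_left,
      smul_tmul_right, smul_smul, map_mul, res_res, res_res]

lemma OrdRel.conj {α : (pullback j).obj P ≅ (pullback j).obj P'}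
    {β : (pullback j).obj Q ≅ (pullback j).obj Q'} (φ : P ≅ Q) (φ' : P' ≅ Q')
    (E : α ≪≫ (pullback j).mapIso φ' = (pullback j).mapIso φ ≪≫ β) {ξ η : X}
    {h : (X.presheaf.stalk ξ)ˣ} (H : OrdRel j α ξ η h) : OrdRel j β ξ η h := by
  obtain ⟨V, s, t, T, hT, hξ, r, hη, hs, ht, hTj, hr, e⟩ := H
  refine ⟨V, φ.hom.app V s, φ'.hom.app V t, T, hT, hξ, r, hη, hs.app_iso _, ht.app_iso _, hTj, hr, ?_⟩
  have E' := congr(($E).hom)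
  simp only [Iso.trans_hom, Functor.mapIso_hom] at E'
  rw [← app_res, ← app_res, ← map_pb, ← map_pb, ← comp_app_apply, ← E', comp_app_apply, e,
    Scheme.Modules.Hom.app_smul]

variable [IsOpenImmersion j]

lemma app_injective_of_le {V : X.Opens} (hV : V ≤ Set.range j) : Function.Injective (j.app V) :=
  (bijective_app_of_le_opensRange j (V := V) hV).1

/-- α carries a generator to a unit multiple of a generator, and over opens inside the image of j
functions on X and on U agree. -/
lemma exists_coefficient (α : (pullback j).obj P ≅ (pullback j).obj P') {V : X.Opens}
    {s : Γ(P, V)} {t : Γ(P', V)} (hs : IsGen s) (ht : IsGen t) {T : X.Opens} (hT : T ≤ V)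
    (hTj : T ≤ Set.range j) :
    ∃ r : Γ(X, T), IsUnit r ∧
      α.hom.app (j ⁻¹ᵁ T) (pb j (res hT s)) = j.app T r • pb j (res hT t) := by
  obtain ⟨c, hc, e⟩ := ((ht.res hT).pb j).exists_isUnit_smul (((hs.res hT).pb j).app_iso α.hom)
  have hb := bijective_app_of_le_opensRange j (V := T) hTj
  obtain ⟨c, rfl⟩ := hc
  obtain ⟨r, hr⟩ := hb.2 c
  obtain ⟨r', hr'⟩ := hb.2 (c⁻¹ : Γ(U, j ⁻¹ᵁ T)ˣ)
  refine ⟨r, IsUnit.of_mul_eq_one r' (hb.1 ?_), by rw [e, hr]⟩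
  rw [map_mul, hr, hr', Units.mul_inv, map_one]

variable [NoetherianSpace X]
  [hreg : ∀ x : X, IsRegularLocalRing (X.presheaf.stalk x)]

lemma app_injective (hj : DenseRange j) (V : X.Opens) : Function.Injective (j.app V) := by
  intro r r' e
  refine resR_injective_of_dense (U := j.opensRange) hj le_rfl (inf_le_left : V ⊓ _ ≤ V) ?_
  refine app_injective_of_le (j := j) (V := V ⊓ j.opensRange) (fun x hx => hx.2) ?_
  have h' := j.preimage_mono (inf_le_left : V ⊓ j.opensRange ≤ V)
  rw [app_resR j _ h', app_resR j _ h', e]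

lemma pb_injective (hj : DenseRange j) (hP : IsLineBundle P) {V : X.Opens} {s t : Γ(P, V)}
    (e : pb j s = pb j t) : s = t := by
  refine res_ext _ _ fun x hx => ?_
  obtain ⟨W, hW, g, hxW, hg⟩ := hP.exists_le hx
  refine ⟨W, hW, hxW, ?_⟩
  obtain ⟨a, ha⟩ := hg.exists_smul (res hW s)
  obtain ⟨b, hb⟩ := hg.exists_smul (res hW t)
  have e1 := congr(res (j.preimage_mono hW) $e)
  rw [res_pb j hW, res_pb j hW, ha, hb, pb_smul, pb_smul] at e1
  rw [ha, hb, app_injective hj W ((hg.pb j).eq_of_smul e1)]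

/-- Functions on X inject into functions on the dense open U, hence so do sections of line bundles.
The cocycle condition on X_2 is deduced from the one on U_2 in this way. -/
lemma pullback_map_injective (hj : DenseRange j) (hP : IsLineBundle P) (hP' : IsLineBundle P')
    {β β' : P ⟶ P'} (e : (pullback j).map β = (pullback j).map β') : β = β' := by
  refine hom_ext_isGen _ _ fun x => ?_
  obtain ⟨V, s, hx, hs⟩ := hP x
  refine ⟨V, s, hx, hs, pb_injective hj hP' ?_⟩
  rw [← map_pb, ← map_pb, e]

lemma OrdRel.exists (hj : DenseRange j) (hP : IsLineBundle P) (hP' : IsLineBundle P')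
    (α : (pullback j).obj P ≅ (pullback j).obj P') {ξ η : X} (hξ : IsGenericFor ξ η) :
    ∃ h, OrdRel j α ξ η h := by
  obtain ⟨V, s, hη, hs⟩ := hP η
  obtain ⟨V', h', t, hη', ht⟩ := hP'.exists_le hη
  obtain ⟨r, hr, e⟩ := exists_coefficient α (hs.res h') ht (T := V' ⊓ j.opensRange) inf_le_left
    (fun x hx => hx.2)
  have hm : ξ ∈ V' ⊓ j.opensRange :=
    ⟨hξ.specializes.mem_open V'.2 hη', hξ.mem_of_dense (U := j.opensRange) hj⟩
  exact ⟨(hr.map (germ hm)).unit, V', _, t, _, inf_le_left, hm, r, hη', hs.res h', ht,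
    fun x hx => hx.2, rfl, e⟩

/-- Two choices of generators near η differ by units, s' = u s and t' = v t. Comparing coefficients
gives h' / h = u / v. -/
lemma OrdRel.div_mem {α : (pullback j).obj P ≅ (pullback j).obj P'} {ξ η : X} (hξη : ξ ⤳ η)
    {h h' : (X.presheaf.stalk ξ)ˣ} (H : OrdRel j α ξ η h) (H' : OrdRel j α ξ η h') :
    h' / h ∈ unitsAt hξη := by
  obtain ⟨V, s, t, T, hT, hξ, r, hη, hs, ht, hTj, hr, e⟩ := H
  obtain ⟨V', s', t', T', hT', hξ', r', hη', hs', ht', hTj', hr', e'⟩ := H'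
  have hηV : η ∈ V ⊓ V' := ⟨hη, hη'⟩
  obtain ⟨u, hu, eu⟩ := (hs.res (inf_le_left : V ⊓ V' ≤ V)).exists_isUnit_smul (hs'.res inf_le_right)
  obtain ⟨v, hv, ev⟩ := (ht.res (inf_le_left : V ⊓ V' ≤ V)).exists_isUnit_smul (ht'.res inf_le_right)
  have hTV : T ⊓ T' ≤ V ⊓ V' := inf_le_inf hT hT'
  have hξT : ξ ∈ T ⊓ T' := ⟨hξ, hξ'⟩
  have h1 := app_pb_res α.hom (inf_le_left : T ⊓ T' ≤ T) _ _ _ e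
  have h2 := app_pb_res α.hom (inf_le_right : T ⊓ T' ≤ T') _ _ _ e'
  rw [res_res, res_res] at h1 h2
  rw [← res_res inf_le_right hTV s', eu, res_smul, res_res, ← res_res inf_le_right hTV t', ev,
    res_smul, res_res, app_pb_smul _ _ _ _ _ h1, pb_smul, smul_smul, ← map_mul] at h2
  have key := app_injective_of_le (j := j) (V := T ⊓ T') (fun x hx => hTj hx.1)
    (((ht.res (hTV.trans inf_le_left)).pb j).eq_of_smul h2)
  have key := congr(germ hξT $key)
  simp only [map_mul, germ_resR, hr, hr'] at key
  rw [div_eq_mul_inv]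
  have := mem_unitsAt_of_isUnit hξη (u := (hu.map (germ (hTV hξT))).unit) (germ hηV u) (hu.map _)
    (sp_germ _ _ _)
  have h3 := mem_unitsAt_of_isUnit hξη (u := (hv.map (germ (hTV hξT))).unit) (germ hηV v) (hv.map _)
    (sp_germ _ _ _)
  convert _root_.div_mem this h3 using 1
  rw [← div_eq_mul_inv, div_eq_div_iff_mul_eq_mul]
  ext
  rw [Units.val_mul, Units.val_mul, IsUnit.unit_spec, IsUnit.unit_spec, key]

lemma ordRel_mapIso (hj : DenseRange j) (hP : IsLineBundle P) (β : P ≅ P') {ξ η : X}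
    (hξ : IsGenericFor ξ η) : OrdRel j ((pullback j).mapIso β) ξ η 1 := by
  obtain ⟨V, s, hη, hs⟩ := hP η
  refine ⟨V, s, β.hom.app V s, V ⊓ j.opensRange, inf_le_left,
    ⟨hξ.specializes.mem_open V.2 hη, hξ.mem_of_dense (U := j.opensRange) hj⟩, 1, hη, hs,
    hs.app_iso _, fun x hx => hx.2, map_one _, ?_⟩
  rw [Functor.mapIso_hom, map_pb, app_res, map_one, one_smul]

/-- An isomorphism over `U` which has order `1` at all height one points of the complement
extends. -/
theorem exists_mapIso_eq (hj : DenseRange j) (hP : IsLineBundle P) (hP' : IsLineBundle P')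
    (α : (pullback j).obj P ≅ (pullback j).obj P')
    (H : ∀ η ∈ boundaryPoints j.opensRange, ∀ ξ, IsGenericFor ξ η → OrdRel j α ξ η 1) :
    ∃ β : P ≅ P', α = (pullback j).mapIso β := by
  let R (V : X.Opens) (s : Γ(P, V)) (t : Γ(P', V)) : Prop :=
    IsGen s ∧ IsGen t ∧ α.hom.app (j ⁻¹ᵁ V) (pb j s) = pb j t
  have hcov (x : X) : ∃ (V : X.Opens) (s : Γ(P, V)) (t : Γ(P', V)), x ∈ V ∧ R V s t := by
    obtain ⟨V₀, s, hx₀, hs⟩ := hP x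
    obtain ⟨V, h', t, hx, ht⟩ := hP'.exists_le hx₀
    replace hs := hs.res h'
    obtain ⟨r, hr, e⟩ := exists_coefficient α hs ht (T := V ⊓ j.opensRange) inf_le_left
      (fun x hx => hx.2)
    obtain ⟨ξ, hξ⟩ := exists_isGenericFor x
    obtain ⟨W₀, hxW₀, hW₀⟩ := exists_open_isGenericFor hξ
    have hm : ξ ∈ V ⊓ j.opensRange :=
      ⟨hξ.specializes.mem_open V.2 hx, hξ.mem_of_dense (U := j.opensRange) hj⟩
    -- If the coefficient r were not a unit at x, it would fail at a height-one generization η. Over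
    -- U it is a unit by construction, and outside U the hypothesis gives order 1.
    have hu : (hr.map (germ hm)).unit ∈ unitsAt hξ.specializes := by
      by_contra hn
      obtain ⟨η, hη, π, -, hπ, hn'⟩ := exists_isUniformizer hξ specializes_rfl _ hn
      have hηV : η ∈ V := hη.mem_open V.2 hx
      by_cases hηj : η ∈ j.opensRange
      · exact hn' (mem_unitsAt_of_isUnit _ (germ (⟨hηV, hηj⟩ : η ∈ V ⊓ j.opensRange) r) (hr.map _)
          (sp_germ _ _ _))
      · have hξη := hξ.of_le hη
        have h1 := H η ⟨hηj, ξ, hξη, π, hπ⟩ ξ hξη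
        have h2 : OrdRel j α ξ η (hr.map (germ hm)).unit :=
          ⟨V, _, t, _, inf_le_left, hm, r, hηV, hs, ht, fun x hx => hx.2, rfl, e⟩
        have := h1.div_mem hξη.specializes h2
        rw [div_one] at this
        exact hn' this
    -- u is a unit near x that extends r. Replacing t by u t makes α send s to the chosen generator
    -- exactly, as the relation R requires.
    obtain ⟨W, hxW, hW, u, huu, hug⟩ := exists_isUnit_germ_eq _ hu (V := V ⊓ W₀) ⟨hx, hxW₀⟩
    have hWV : W ≤ V := hW.trans inf_le_left
    refine ⟨W, _, u • res hWV t, hxW, hs.res hWV, (ht.res hWV).smul_isUnit huu, ?_⟩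
    have le : j ⁻¹ᵁ W ≤ j ⁻¹ᵁ (W ⊓ j.opensRange) := fun y hy => ⟨hy, ⟨y, rfl⟩⟩
    refine res_injective_of_le (j.preimage_mono inf_le_left) le ?_
    have hle : W ⊓ j.opensRange ≤ V ⊓ j.opensRange := inf_le_inf_right _ hWV
    have er : resR (inf_le_left : W ⊓ j.opensRange ≤ W) u = resR hle r := by
      refine eq_of_germ_generic_eq (ξ := ξ) (T := W ⊓ j.opensRange)
        (fun y hy => (hW₀ y (hW hy.1).2).specializes) fun hξW => ?_
      rw [germ_resR, germ_resR, hug]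
      rfl
    have e' := app_pb_res α.hom hle _ _ _ e
    rw [← app_res, res_pb j inf_le_left, res_pb j inf_le_left, res_smul, pb_smul, er]
    simp only [res_res] at e' ⊢
    exact e'
  obtain ⟨φ, hφ⟩ := exists_hom_of_rel (M := P) (N := P') R (fun _ _ _ h => h.1)
    (by
      rintro V W h s t ⟨hs, ht, e⟩
      refine ⟨hs.res h, ht.res h, ?_⟩
      rw [← res_pb j h (j.preimage_mono h), ← res_pb j h (j.preimage_mono h), app_res, e])
    (by
      rintro V s t s' t' r ⟨hs, ht, e⟩ ⟨hs', ht', e'⟩ rfl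
      refine pb_injective hj hP' ?_
      rw [← e', pb_smul, pb_smul, Scheme.Modules.Hom.app_smul, e])
    hcov
  have : IsIso φ := isIso_of_isGen φ fun x => by
    obtain ⟨V, s, t, hx, hR⟩ := hcov x
    exact ⟨V, s, hx, hR.1, by rw [hφ V s t hR]; exact hR.2.1⟩
  refine ⟨asIso φ, ?_⟩
  ext1
  refine hom_ext_isGen _ _ fun x => ?_
  obtain ⟨V, s, t, hx, hR⟩ := hcov (j x)
  refine ⟨j ⁻¹ᵁ V, pb j s, hx, hR.1.pb j, ?_⟩
  rw [Functor.mapIso_hom, asIso_hom, map_pb, hφ V s t hR, hR.2.2]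
end
end
end SimplicialPic

/-! ### Compatible squares, cocycles and the extension relation -/

namespace SimplicialPic
noncomputable section
open Scheme.Modules (pullback pushforward pullbackPushforwardAdjunction pullbackComp)

section
variable {Y Z : Scheme.{u}} {g g' : Y ⟶ Z} {L M N : Z.Modules}

/-- `φ` is compatible with `a` and `b`. -/
def Sq (φ : L ≅ M) (a : (pullback g).obj L ≅ (pullback g').obj L)
    (b : (pullback g).obj M ≅ (pullback g').obj M) : Prop :=
  a ≪≫ (pullback g').mapIso φ = (pullback g).mapIso φ ≪≫ b

variable {φ : L ≅ M} {ψ : M ≅ N} {a : (pullback g).obj L ≅ (pullback g').obj L}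
  {b : (pullback g).obj M ≅ (pullback g').obj M} {c : (pullback g).obj N ≅ (pullback g').obj N}

lemma Sq.trans (h : Sq φ a b) (k : Sq ψ b c) : Sq (φ ≪≫ ψ) a c := by
  simp only [Sq, Functor.mapIso_trans] at h k ⊢
  rw [← Iso.trans_assoc, h, Iso.trans_assoc, k, Iso.trans_assoc]

lemma iso_right_cancel {P Q R : Y.Modules} {a b : P ≅ Q} {p : Q ≅ R} (h : a ≪≫ p = b ≪≫ p) :
    a = b := by
  ext1
  simpa using congr(($h).hom)

lemma conj_symm {P P' Q Q' : Y.Modules} {a : P ≅ P'} {b : Q ≅ Q'} {p : P ≅ Q} {p' : P' ≅ Q'}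
    (h : a ≪≫ p' = p ≪≫ b) : b ≪≫ p'.symm = p.symm ≪≫ a := by
  ext1
  have := congr(($h).hom)
  simp only [Iso.trans_hom, Iso.symm_hom] at this ⊢
  rw [Iso.comp_inv_eq, Category.assoc, this, Iso.inv_hom_id_assoc]

lemma Sq.symm (h : Sq φ a b) : Sq φ.symm b a := conj_symm h

lemma Sq.pull {X : Scheme.{u}} (h : Sq φ a b) {f : X ⟶ Y} {k k' : X ⟶ Z} (e : f ≫ g = k)
    (e' : f ≫ g' = k') : Sq φ (pull f a e e') (pull f b e e') := by
  rw [Sq, ← pull_map φ e, ← pull_map φ e', ← pull_trans, ← pull_trans, h]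

lemma Sq.ten {L' M' : Z.Modules} (hL : IsLineBundle L) (hL' : IsLineBundle L') (hM : IsLineBundle M)
    (hM' : IsLineBundle M') {φ' : L' ≅ M'} {a' : (pullback g).obj L' ≅ (pullback g').obj L'}
    {b' : (pullback g).obj M' ≅ (pullback g').obj M'} (h : Sq φ a b) (h' : Sq φ' a' b') :
    Sq (tensorIso φ φ') (ten hL hL' hL hL' a a') (ten hM hM' hM hM' b b') := by
  rw [Sq, ten_map hL hL' hM hM', ten_map hL hL' hM hM', ← ten_trans, ← ten_trans, h, h']

lemma Sq.eq_triUni {e : L ≅ unitM Z} (h : Sq e a (uni g g')) : a = triUni g g' e e := by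
  have h : a ≪≫ (pullback g').mapIso e = (pullback g).mapIso e ≪≫ uni g g' := h
  rw [triUni, ← Iso.trans_assoc, ← h, Iso.trans_assoc, Iso.self_symm_id, Iso.trans_refl]

end

section
variable {X : SimplicialObject Scheme.{u}}

/-- The cocycle condition. -/
def IsCocycle {L : (X _⦋0⦌).Modules}
    (a : (pullback (X.δ (0 : Fin 2))).obj L ≅ (pullback (X.δ (1 : Fin 2))).obj L) : Prop :=
  pull (X.δ (0 : Fin 3)) a rfl rfl ≪≫ pull (X.δ (2 : Fin 3)) a (δ₂₀ X) rfl =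
    pull (X.δ (1 : Fin 3)) a (δ₁₀ X) (δ₁₁ X)

lemma IsCocycle.of_sq {L M : (X _⦋0⦌).Modules} {φ : L ≅ M}
    {a : (pullback (X.δ (0 : Fin 2))).obj L ≅ (pullback (X.δ (1 : Fin 2))).obj L}
    {b : (pullback (X.δ (0 : Fin 2))).obj M ≅ (pullback (X.δ (1 : Fin 2))).obj M}
    (hb : IsCocycle b) (h : Sq φ a b) : IsCocycle a := by
  have h0 := h.pull (f := X.δ (0 : Fin 3)) rfl rfl
  have h2 := h.pull (f := X.δ (2 : Fin 3)) (δ₂₀ X) rfl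
  have h1 := h.pull (f := X.δ (1 : Fin 3)) (δ₁₀ X) (δ₁₁ X)
  simp only [Sq] at h0 h1 h2
  refine iso_right_cancel (p := (pullback (X.δ (2 : Fin 3) ≫ X.δ (1 : Fin 2))).mapIso φ) ?_
  rw [Iso.trans_assoc, h2, ← Iso.trans_assoc, h0, Iso.trans_assoc, hb, h1]

/-- Both the gluing isomorphism of A and its tensor product with b are cocycles, the latter because
it comes from a trivialization; the factor from A can be cancelled. -/
lemma SLineBundle.isCocycle_of_ten_eq (A : SLineBundle X) {D : (X _⦋0⦌).Modules}
    (hD : IsLineBundle D)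
    {b : (pullback (X.δ (0 : Fin 2))).obj D ≅ (pullback (X.δ (1 : Fin 2))).obj D}
    {e : tensor A.L D ≅ unitM _}
    (hb : ten A.isLineBundle hD A.isLineBundle hD A.α b = triUni _ _ e e) : IsCocycle b := by
  have hL := A.isLineBundle
  refine ten_left_cancel hL hD hL hD (pull (X.δ (1 : Fin 3)) A.α (δ₁₀ X) (δ₁₁ X)) _ _ ?_
  rw [← pull_ten, hb, ← A.cocycle, ten_trans hL hD hL hD hL hD, ← pull_ten, ← pull_ten, hb,
    pull_triUni, pull_triUni, pull_triUni, triUni_trans]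
end

section
variable {U X Z Z' : Scheme.{u}} {j : U ⟶ X} {d : X ⟶ Z} {d' : X ⟶ Z'} {L : Z.Modules}
  {L' : Z'.Modules}

lemma exists_base_eq {Y Y' : Scheme.{u}} {p : X ⟶ Y} {p' : X ⟶ Y'} {q : Y ⟶ Z} {q' : Y' ⟶ Z'}
    {h : X ⟶ Z} {h' : X ⟶ Z'} (e : p ≫ q = h) (e' : p' ≫ q' = h')
    (a : (pullback p).obj ((pullback q).obj L) ≅ (pullback p').obj ((pullback q').obj L')) :
    ∃ α : (pullback h).obj L ≅ (pullback h').obj L', base α e e' = a := by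
  refine ⟨(pc e L).symm ≪≫ a ≪≫ pc e' L', ?_⟩
  ext1
  simp [base]

lemma base_injective {Y Y' : Scheme.{u}} {p : X ⟶ Y} {p' : X ⟶ Y'} {q : Y ⟶ Z} {q' : Y' ⟶ Z'}
    {h : X ⟶ Z} {h' : X ⟶ Z'} (e : p ≫ q = h) (e' : p' ≫ q' = h')
    {α β : (pullback h).obj L ≅ (pullback h').obj L'} (H : base α e e' = base β e e') : α = β := by
  ext1
  simpa [base] using congr(($H).hom)

lemma base_pull (β : (pullback d).obj L ≅ (pullback d').obj L') :
    base (pull j β rfl rfl) rfl rfl = (pullback j).mapIso β := by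
  ext1
  simp [base, pull]
end

/-- The vectors that occur form a subgroup S of ℤ^E, which is finitely generated. Two classes
related to the same vector have a quotient related to 0, so they agree modulo H. Hence S maps
homomorphically onto C ⧸ H, although Rel need not define a map on C. -/
lemma group_fg_quotient_of_rel {C E : Type*} [CommGroup C] (H : Subgroup C) [Finite E]
    (Rel : C → (E → ℤ) → Prop)
    (hmul : ∀ c n c' n', Rel c n → Rel c' n' → Rel (c * c') (n + n'))
    (hinv : ∀ c n, Rel c n → Rel c⁻¹ (-n)) (htot : ∀ c, ∃ n, Rel c n)
    (hz : ∀ c, Rel c 0 → c ∈ H) : Group.FG (C ⧸ H) := by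
  let S : AddSubgroup (E → ℤ) :=
    { carrier := {n | ∃ c, Rel c n}
      add_mem' := by
        rintro n n' ⟨c, h⟩ ⟨c', h'⟩
        exact ⟨_, hmul _ _ _ _ h h'⟩
      zero_mem' := by
        obtain ⟨n, hn⟩ := htot 1
        exact ⟨1 * 1⁻¹, by simpa using hmul _ _ _ _ hn (hinv _ _ hn)⟩
      neg_mem' := by
        rintro n ⟨c, h⟩
        exact ⟨_, hinv _ _ h⟩ }
  have key {c c' : C} {n : E → ℤ} (h : Rel c n) (h' : Rel c' n) : (c : C ⧸ H) = c' := by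
    rw [QuotientGroup.eq]
    exact hz _ (by simpa using hmul _ _ _ _ (hinv _ _ h) h')
  choose f hf using fun n : S => n.2
  let F : Multiplicative S →* C ⧸ H := MonoidHom.mk' (fun n => (f n.toAdd : C ⧸ H)) fun m n =>
    key (hf (m.toAdd + n.toAdd)) (hmul _ _ _ _ (hf m.toAdd) (hf n.toAdd))
  have : AddGroup.FG S := by
    have := Fintype.ofFinite E
    have : IsNoetherian ℤ (AddSubgroup.toIntSubmodule S) := inferInstance
    have h : Module.Finite ℤ (AddSubgroup.toIntSubmodule S) := inferInstance
    exact Module.Finite.iff_addGroup_fg.1 h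
  refine Group.fg_of_surjective (f := F) fun q => ?_
  obtain ⟨c, rfl⟩ := QuotientGroup.mk_surjective q
  obtain ⟨n, hn⟩ := htot c
  exact ⟨Multiplicative.ofAdd ⟨n, c, hn⟩, key (hf ⟨n, c, hn⟩) hn⟩

section
variable {X U : SimplicialObject Scheme.{u}} (j : U ⟶ X)

/-- The line bundle `A` on `U` extends to a line bundle `M` on `X₀`, with orders `h`. -/
def ExtRel {ι : Type*} (ξ η : ι → (X _⦋1⦌ : Scheme.{u}))
    (h : ∀ i, ((X _⦋1⦌).presheaf.stalk (ξ i))ˣ) (A : SLineBundle U) : Prop :=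
  ∃ (M : (X _⦋0⦌).Modules) (_ : IsLineBundle M)
    (α : (pullback (j.app (op ⦋1⦌) ≫ X.δ (0 : Fin 2))).obj M ≅
      (pullback (j.app (op ⦋1⦌) ≫ X.δ (1 : Fin 2))).obj M)
    (φ : (pullback (j.app (op ⦋0⦌))).obj M ≅ A.L),
    Sq φ (base α (SimplicialObject.δ_naturality j 0) (SimplicialObject.δ_naturality j 1)) A.α ∧
    ∀ i, OrdRel (j.app (op ⦋1⦌)) (base α rfl rfl) (ξ i) (η i) (h i)

variable {j} {ι : Type*} {ξ η : ι → (X _⦋1⦌ : Scheme.{u})}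
  {h h' : ∀ i, ((X _⦋1⦌).presheaf.stalk (ξ i))ˣ} {A B : SLineBundle U}

/-- The extensions are tensored. `base_ten` matches the tensor product of the gluing isomorphisms on
iterated pull-backs with the one on composites, where orders and gluing data are compared. -/
lemma ExtRel.mul (hA : ExtRel j ξ η h A) (hB : ExtRel j ξ η h' B) :
    ExtRel j ξ η (h * h') (A.mul B) := by
  obtain ⟨M, hM, α, φ, hφ, hα⟩ := hA
  obtain ⟨N, hN, β, ψ, hψ, hβ⟩ := hB
  refine ⟨tensor M N, hM.tensor hN, ten hM hN hM hN α β, pbTIso _ hM hN ≪≫ tensorIso φ ψ,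
    Sq.trans (base_ten hM hN hM hN α β _ _) (hφ.ten _ _ A.isLineBundle B.isLineBundle hψ),
    fun i => ?_⟩
  have := ordRel_ten (hM.pullback _) (hM.pullback _) (hN.pullback _) (hN.pullback _) (hα i) (hβ i)
  exact this.conj (pbTIso _ hM hN).symm (pbTIso _ hM hN).symm
    (conj_symm (base_ten hM hN hM hN α β _ _))
end
end
end SimplicialPic

/-! ### Extending line bundles from U to X and finite generation -/

namespace SimplicialPic
noncomputable section
open Scheme.Modules (pullback pushforward pullbackPushforwardAdjunction pullbackComp)

section
variable {X U : SimplicialObject Scheme.{u}} {j : U ⟶ X} {ι : Type*}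
  {ξ η : ι → (X _⦋1⦌ : Scheme.{u})} {h : ∀ i, ((X _⦋1⦌).presheaf.stalk (ξ i))ˣ} {A : SLineBundle U}

lemma base_triUni_sq {U₀ U₁ X₀ : Scheme.{u}} {j₀ : U₀ ⟶ X₀} {v₀ v₁ : U₁ ⟶ U₀} {h₀ h₁ : U₁ ⟶ X₀}
    (m₀ : v₀ ≫ j₀ = h₀) (m₁ : v₁ ≫ j₀ = h₁) {L : X₀.Modules} (e : L ≅ unitM X₀) :
    Sq ((pullback j₀).mapIso e ≪≫ asIso (pbUnit j₀)) (base (triUni h₀ h₁ e e) m₀ m₁) (uni v₀ v₁) := by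
  refine Sq.trans ?_ (base_uni m₀ m₁)
  rw [Sq, ← base_map e m₀, ← base_map e m₁, ← base_trans, ← base_trans, triUni_map]

variable [NoetherianSpace (X _⦋1⦌ : Scheme.{u})]
  [∀ x : (X _⦋1⦌ : Scheme.{u}), IsRegularLocalRing ((X _⦋1⦌).presheaf.stalk x)]
  [IsOpenImmersion (j.app (op ⦋1⦌))]

/-- The dual of M extends the inverse of A, with β the unique isomorphism such that α ⊗ β is induced
by the evaluation pairing. Then α ⊗ β is defined over all of X_1 and has order 1, so the order of β
is inverse to that of α. -/
lemma ExtRel.exists_inv (hj : DenseRange (j.app (op ⦋1⦌))) (hξ : ∀ i, IsGenericFor (ξ i) (η i))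
    (hA : ExtRel j ξ η h A) : ∃ B : SLineBundle U, A.mul B ≈ SLineBundle.triv U ∧
      ExtRel j ξ η h⁻¹ B := by
  obtain ⟨M, hM, α, φ, hφ, hα⟩ := hA
  have hD := hM.dual
  have := evMap_isIso hM
  let e : tensor M (dual M) ≅ unitM _ := asIso (evMap M)
  obtain ⟨β, hβ⟩ := exists_ten_eq hM hD hM hD α (triUni _ _ e e)
  let m₀ := SimplicialObject.δ_naturality j (0 : Fin 2)
  let m₁ := SimplicialObject.δ_naturality j (1 : Fin 2)
  -- The three squares move from the pull-back of M ⊗ dual M to A.L tensored with the pulled-back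
  -- dual, and then to the unit. They give at once the cocycle condition for B and the isomorphism
  -- of A ⊗ B with the trivial bundle.
  have sq1 : Sq (pbTIso (j.app (op ⦋0⦌)) hM hD) (base (ten hM hD hM hD α β) m₀ m₁)
      (ten (hM.pullback _) (hD.pullback _) (hM.pullback _) (hD.pullback _) (base α m₀ m₁)
        (base β m₀ m₁)) := base_ten hM hD hM hD α β m₀ m₁
  have sq2 : Sq (tensorIso φ (Iso.refl _)) _ (ten A.isLineBundle (hD.pullback _) A.isLineBundle
      (hD.pullback _) A.α (base β m₀ m₁)) :=
    hφ.ten (hM.pullback _) (hD.pullback _) A.isLineBundle (hD.pullback _)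
      (φ' := Iso.refl ((pullback (j.app (op ⦋0⦌))).obj (dual M))) (a' := base β m₀ m₁)
      (b' := base β m₀ m₁) (by ext1; simp)
  have sq3 := base_triUni_sq m₀ m₁ e
  rw [hβ] at sq1
  have sq := (sq1.trans sq2).symm.trans sq3
  let B : SLineBundle U := ⟨_, hD.pullback (j.app (op ⦋0⦌)), base β m₀ m₁,
    A.isCocycle_of_ten_eq (hD.pullback _) sq.eq_triUni⟩
  refine ⟨B, ⟨_, sq⟩, dual M, hD, β, Iso.refl _, by rw [Sq]; ext1; simp [B], fun i => ?_⟩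
  obtain ⟨k, hk⟩ := OrdRel.exists hj (hD.pullback _) (hD.pullback _)
    (base (p := j.app (op ⦋1⦌)) β rfl rfl) (hξ i)
  have h1 := (ordRel_ten (hM.pullback _) (hM.pullback _) (hD.pullback _) (hD.pullback _)
    (hα i) hk).conj (pbTIso _ hM hD).symm (pbTIso _ hM hD).symm
    (conj_symm (base_ten hM hD hM hD α β rfl rfl))
  -- The trivialization over U_1 is the restriction of the one over X_1, so `ordRel_mapIso` gives it
  -- order 1. Comparison with the product order shows that h k is a unit at the boundary point, and
  -- rescaling by its inverse turns k into the inverse of h.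
  rw [hβ, ← pull_triUni e e rfl rfl, base_pull] at h1
  have h2 := (ordRel_mapIso hj ((hM.tensor hD).pullback _) _ (hξ i)).div_mem (hξ i).specializes h1
  rw [div_one] at h2
  have := hk.smul (hξ i).specializes (inv_mem h2)
  rwa [mul_inv, inv_mul_cancel_right] at this

/-- The bundle on U_0 extends to X_0, and its gluing isomorphism is transported along φ. Since each
η has height one with uniformizer π, the order can be normalized to a power of π. -/
lemma exists_extRel (hj : DenseRange (j.app (op ⦋1⦌))) (hξ : ∀ i, IsGenericFor (ξ i) (η i))
    [NoetherianSpace (X _⦋0⦌ : Scheme.{u})]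
    [∀ x : (X _⦋0⦌ : Scheme.{u}), IsRegularLocalRing ((X _⦋0⦌).presheaf.stalk x)]
    [IsOpenImmersion (j.app (op ⦋0⦌))] (hj₀ : DenseRange (j.app (op ⦋0⦌)))
    {π : ∀ i, ((X _⦋1⦌).presheaf.stalk (ξ i))ˣ}
    (hπ : ∀ i, IsUniformizer (hξ i).specializes (π i)) (A : SLineBundle U) :
    ∃ n : ι → ℤ, ExtRel j ξ η (fun i => π i ^ n i) A := by
  obtain ⟨M, hM, ⟨φ⟩⟩ := exists_extension (j.app (op ⦋0⦌)) hj₀ A.isLineBundle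
  obtain ⟨α, hα⟩ := exists_base_eq (L := M) (L' := M) (SimplicialObject.δ_naturality j (0 : Fin 2))
    (SimplicialObject.δ_naturality j (1 : Fin 2))
    ((pullback (U.δ (0 : Fin 2))).mapIso φ ≪≫ A.α ≪≫ ((pullback (U.δ (1 : Fin 2))).mapIso φ).symm)
  have key (i) : ∃ n : ℤ, OrdRel (j.app (op ⦋1⦌)) (base α rfl rfl) (ξ i) (η i) (π i ^ n) := by
    obtain ⟨k, hk⟩ := OrdRel.exists hj (hM.pullback _) (hM.pullback _)
      (base (p := j.app (op ⦋1⦌)) α rfl rfl) (hξ i)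
    obtain ⟨n, hn⟩ := (hπ i).exists_zpow k
    have := hk.smul (hξ i).specializes (inv_mem hn)
    -- k πⁿ is a unit at η, so dividing k by it leaves the power -n of π as an admissible order.
    refine ⟨-n, ?_⟩
    rwa [mul_comm k, mul_inv, inv_mul_cancel_right, ← zpow_neg] at this
  choose n hn using key
  refine ⟨n, M, hM, α, φ, ?_, hn⟩
  rw [Sq, hα, Iso.trans_assoc, Iso.trans_assoc, Iso.symm_self_id, Iso.trans_refl]

/-- Order 1 at every boundary point extends the gluing isomorphism to β over X_1. The cocycle
condition for β is an equality of maps of line bundles on X_2, and it holds on the dense open U_2.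
-/
lemma ExtRel.exists_pb [NoetherianSpace (X _⦋2⦌ : Scheme.{u})]
    [∀ x : (X _⦋2⦌ : Scheme.{u}), IsRegularLocalRing ((X _⦋2⦌).presheaf.stalk x)]
    [IsOpenImmersion (j.app (op ⦋2⦌))] (hj₂ : DenseRange (j.app (op ⦋2⦌)))
    (hj : DenseRange (j.app (op ⦋1⦌))) (hξ : ∀ i, IsGenericFor (ξ i) (η i))
    (hη : ∀ y ∈ boundaryPoints (j.app (op ⦋1⦌)).opensRange, ∃ i, η i = y)
    (hA : ExtRel j ξ η 1 A) : ∃ B : SLineBundle X, B.pb j ≈ A := by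
  obtain ⟨M, hM, α, φ, hφ, hα⟩ := hA
  obtain ⟨β, hβ⟩ := exists_mapIso_eq hj (hM.pullback _) (hM.pullback _) (base α rfl rfl) (by
    rintro y hy ζ hζ
    obtain ⟨i, rfl⟩ := hη y hy
    obtain rfl : ζ = ξ i := (hξ i).eq_of_specializes (hζ.of_specializes _ (hξ i).specializes)
    exact hα i)
  rw [← base_pull] at hβ
  obtain rfl := base_injective _ _ hβ
  have hc : IsCocycle (X := U) _ := IsCocycle.of_sq A.cocycle hφ
  let n₀ := SimplicialObject.δ_naturality j (0 : Fin 3)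
  let n₁ := SimplicialObject.δ_naturality j (1 : Fin 3)
  let n₂ := SimplicialObject.δ_naturality j (2 : Fin 3)
  let m₀ := SimplicialObject.δ_naturality j (0 : Fin 2)
  let m₁ := SimplicialObject.δ_naturality j (1 : Fin 2)
  have x₀₀ : (U.δ (0 : Fin 3) ≫ U.δ (0 : Fin 2)) ≫ j.app (op ⦋0⦌) =
      j.app (op ⦋2⦌) ≫ X.δ (0 : Fin 3) ≫ X.δ (0 : Fin 2) := by
    rw [Category.assoc, m₀, ← Category.assoc, n₀, Category.assoc]
  have x₀₁ : (U.δ (0 : Fin 3) ≫ U.δ (1 : Fin 2)) ≫ j.app (op ⦋0⦌) =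
      j.app (op ⦋2⦌) ≫ X.δ (0 : Fin 3) ≫ X.δ (1 : Fin 2) := by
    rw [Category.assoc, m₁, ← Category.assoc, n₀, Category.assoc]
  have x₂₁ : (U.δ (2 : Fin 3) ≫ U.δ (1 : Fin 2)) ≫ j.app (op ⦋0⦌) =
      j.app (op ⦋2⦌) ≫ X.δ (2 : Fin 3) ≫ X.δ (1 : Fin 2) := by
    rw [Category.assoc, m₁, ← Category.assoc, n₂, Category.assoc]
  have hc' : IsCocycle β := by
    rw [IsCocycle, pull_base_pull β m₀ m₁ n₀ rfl rfl rfl rfl x₀₀ x₀₁,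
      pull_base_pull β m₀ m₁ n₂ (δ₂₀ X) rfl (δ₂₀ U) rfl x₀₁ x₂₁,
      pull_base_pull β m₀ m₁ n₁ (δ₁₀ X) (δ₁₁ X) (δ₁₀ U) (δ₁₁ U) x₀₀ x₂₁, ← base_trans,
      ← pull_trans] at hc
    have hc := base_injective _ _ hc
    -- The cocycle identity is now one on pull-backs along composites through U_2. Rewriting it with
    -- iterated pull-backs exhibits both sides as restrictions of isomorphisms on X_2, so that
    -- faithfulness applies.
    have hc := congrArg (fun γ => base γ (rfl : j.app (op ⦋2⦌) ≫ _ = _)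
      (rfl : j.app (op ⦋2⦌) ≫ _ = _)) hc
    simp only [base_pull] at hc
    ext1
    exact pullback_map_injective hj₂ (hM.pullback _) (hM.pullback _) congr(($hc).hom)
  let B : SLineBundle X := ⟨M, hM, β, hc'⟩
  refine ⟨B, show SLineBundle.Iso (B.pb j) A from ⟨φ, ?_⟩⟩
  have e : (B.pb j).α = base (pull (j.app (op ⦋1⦌)) β rfl rfl) m₀ m₁ := rfl
  rw [e]
  exact hφ
end

section
variable {X U : SimplicialObject Scheme.{u}} (j : U ⟶ X)

/-- A class c is related to n if some representative extends with orders given by the powers n of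
chosen uniformizers at the boundary points of X_1. The four conditions of `group_fg_quotient_of_rel`
are additivity, inversion, existence of extensions, and descent of classes with vanishing orders. -/
theorem group_fg_pic_quotient (hnoeth : ∀ p : ℕ, NoetherianSpace (X _⦋p⦌ : Scheme.{u}))
    (hreg : ∀ (p : ℕ) (x : (X _⦋p⦌ : Scheme.{u})), IsRegularLocalRing ((X _⦋p⦌).presheaf.stalk x))
    (hopen : ∀ p : ℕ, IsOpenImmersion (j.app (op ⦋p⦌)))
    (hdense : ∀ p : ℕ, DenseRange (j.app (op ⦋p⦌))) :
    Group.FG (Pic U ⧸ (picMap j).range) := by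
  have := hreg 0
  have := hreg 1
  have := hreg 2
  let E := boundaryPoints (j.app (op ⦋1⦌)).opensRange
  have : Finite E := (finite_boundaryPoints (U := (j.app (op ⦋1⦌)).opensRange) (hdense 1)).to_subtype
  choose ξ hξ π hπ using fun i : E => i.2.2
  refine group_fg_quotient_of_rel (E := E) (picMap j).range
    (fun c n => ∃ A, Pic.mk A = c ∧ ExtRel j ξ (fun i => i.1) (fun i => π i ^ n i) A) ?_ ?_ ?_ ?_
  · rintro _ n _ n' ⟨A, rfl, hA⟩ ⟨B, rfl, hB⟩
    refine ⟨A.mul B, (Pic.mk_mul A B).symm, ?_⟩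
    convert hA.mul hB using 2
    exact zpow_add _ _ _
  · rintro _ n ⟨A, rfl, hA⟩
    obtain ⟨B, hAB, hB⟩ := hA.exists_inv (hdense 1) hξ
    refine ⟨B, eq_inv_of_mul_eq_one_right ((Pic.mk_mul A B).trans (Quotient.sound hAB)), ?_⟩
    convert hB using 2
    exact zpow_neg _ _
  · intro c
    induction c using Quotient.inductionOn with | h A => ?_
    obtain ⟨n, hn⟩ := exists_extRel (hdense 1) hξ (hdense 0) hπ A
    exact ⟨n, A, rfl, hn⟩
  · rintro _ ⟨A, rfl, hA⟩
    obtain ⟨B, hB⟩ := ExtRel.exists_pb (hdense 2) (hdense 1) hξ (fun y hy => ⟨⟨y, hy⟩, rfl⟩)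
      (A := A) (by convert hA using 2; exact (zpow_zero _).symm)
    exact ⟨Pic.mk B, (picMap_mk j B).trans (Quotient.sound hB)⟩

lemma noetherianSpace_of_isProper {k : Type u} [Field k] {Y : Scheme.{u}}
    (f : Y ⟶ Spec (CommRingCat.of k)) [IsProper f] : NoetherianSpace Y := by
  have : IsLocallyNoetherian Y := LocallyOfFiniteType.isLocallyNoetherian f
  have : CompactSpace Y := QuasiCompact.compactSpace_of_compactSpace f
  have : AlgebraicGeometry.IsNoetherian Y := ⟨⟩
  infer_instance
end
end
end SimplicialPic

theorem mainTheorem7 {k : Type u} [Field k]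
    (X U : SimplicialObject (Over (Spec (CommRingCat.of k)))) (j : U ⟶ X)
    (hreg : ∀ (p : ℕ) (x : (X _⦋p⦌).left), IsRegularLocalRing ((X _⦋p⦌).left.presheaf.stalk x))
    (hproper : ∀ p : ℕ, IsProper (X _⦋p⦌).hom)
    (hopen : ∀ p : ℕ, IsOpenImmersion (j.app (op ⦋p⦌)).left)
    (hdense : ∀ p : ℕ, DenseRange (j.app (op ⦋p⦌)).left)
    (hface : ∀ (p : ℕ) (i : Fin (p + 2)) (x : (X _⦋p + 1⦌).left),
      x ∉ Set.range (j.app (op ⦋p + 1⦌)).left → (X.δ i).left x ∉ Set.range (j.app (op ⦋p⦌)).left) :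
    Group.FG (SimplicialPic.Pic (((SimplicialObject.whiskering _ _).obj (Over.forget _)).obj U) ⧸
      (SimplicialPic.picMap (((SimplicialObject.whiskering _ _).obj (Over.forget _)).map j)).range) := by
  refine SimplicialPic.group_fg_pic_quotient _ (fun p => ?_) hreg hopen hdense
  exact @SimplicialPic.noetherianSpace_of_isProper _ _ _ (X _⦋p⦌).hom (hproper p)
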